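/- Let $m\ge 2$. For $i=1,2$ let $V_i$ be the representation $\rho_i(A)=|\det A|^{w_i}(\det A)^{z_i}\rho_{D_i}(A)$ of $GL(m,\mathbb R)$, where $w_i\in\mathbb R$, $z_i\in\mathbb Z$, and $\rho_{D_i}$ is the irreducible representation attached to a Young diagram $D_i$ with fewer than $m$ rows. Write $\mathcal V_i=C^\infty(\mathbb R^m,V_i)$, $S^k_{V_1,V_2}=S^k\mathbb R^m\otimes V_1^*\otimes V_2$, let $\mathcal S=\bigoplus_{k\ge 0}C^\infty(\mathbb R^m,S^k_{V_1,V_2})$ be the space of symbols, and let $\mathcal D$ be the space of linear differential operators $\mathcal V_1\to\mathcal V_2$. Let $\rho_*$ denote the action of $gl(m,\mathbb R)$ on each of these representations. A vector field $X$ acts on $\mathcal V_1$, $\mathcal V_2$ and $\mathcal S$ by $(L_XT)(x)=(X.T)(x)-\rho_*(D_xX)T(x)$, and on operators by $\mathcal L_XD=L_X\circ D-D\circ L_X$. The Lie algebra $sl(m+1,\mathbb R)$ acts through the vector fields $X^h(x)=-v-(A-a\,\mathrm{Id})x+\xi(x)x$ for $h=\begin{pmatrix}A&v\\ \xi&a\end{pmatrix}$,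 and $\mathfrak g_1\cong\mathbb R^{m*}$ is the subspace $A=0$, $v=0$, $a=0$. Let $Q_{\mathrm{Aff}}:\mathcal S\to\mathcal D$, $\sum C_\alpha(x)\xi^\alpha\mapsto\sum C_\alpha(x)\circ\partial^\alpha$, be the standard ordering; it is used to transport $\mathcal L$ to $\mathcal S$. Let $C$ and $\mathcal C$ be the Casimir operators (with respect to the Killing form of $sl(m+1,\mathbb R)$) of the representations $h\mapsto L_{X^h}$ and $h\mapsto\mathcal L_{X^h}$ on $\mathcal S$, and put $\gamma(h)=\mathcal L_{X^h}-L_{X^h}$. Each $S^k_{V_1,V_2}$ is a finite direct sum $\bigoplus_s I_{k,s}$ of irreducible representations of $sl(m,\mathbb R)$. Fix such decompositions and put $E_{k,s}=C^\infty(\mathbb R^m,I_{k,s})$; let $\alpha_{k,s}$ be the scalar by which $C$ acts on $E_{k,s}$. Put $\mathrm{tree}^0(E_{k,s})=E_{k,s}$, let $\mathrm{tree}^{l+1}(E_{k,s})=\gamma(\mathfrak g_1)(\mathrm{tree}^l(E_{k,s}))$ (linear span), and $\mathrm{tree}(E_{k,s})=\bigoplus_{l\ge 0}\mathrm{tree}^l(E_{k,s})$.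 The pair $(V_1,V_2)$ is critical if, for some $k,s$, $\alpha_{k,s}$ is an eigenvalue of $C$ on $\bigoplus_{l\ge1}\mathrm{tree}^l(E_{k,s})$. Theorem. Such decompositions exist; and for any choice of them for which $(V_1,V_2)$ is not critical, there is an $sl(m+1,\mathbb R)$-equivariant quantization $Q:\mathcal S\to\mathcal D$, that is, a linear bijection such that $Q(T)$ has order at most $k$ and principal symbol $\sigma(Q(T))=T$ for every $k$ and every $T\in C^\infty(\mathbb R^m,S^k_{V_1,V_2})$, and such that $\mathcal L_{X^h}\circ Q=Q\circ L_{X^h}$ for all $h\in sl(m+1,\mathbb R)$. Moreover, for all $k,s$, the operator $C$ acts on $E_{k,s}$ by a scalar $\alpha_{k,s}$, for every $T\in E_{k,s}$ there is a unique $\hat T=T_k+T_{k-1}+\dots+T_0$ with $T_k=T$, $T_{k-l}\in\mathrm{tree}^l(E_{k,s})$ for $1\le l\le k$ and $\mathcal C\hat T=\alpha_{k,s}\hat T$, and $Q(T)=Q_{\mathrm{Aff}}(\hat T)$. -/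

import Mathlib

open scoped ContDiff

namespace ProjQuant

noncomputable section

/-! ### The representations of `GL(m, ℝ)` -/

/-- Tensors in `(ℝ^m)^{⊗ ι}`, as arrays of coordinates. -/
abbrev Tensors (m : ℕ) (ι : Type) : Type := (ι → Fin m) → ℝ

/-- The diagonal action of `A` on `(ℝ^m)^{⊗ ι}`:
`v₁ ⊗ v₂ ⊗ ⋯ ↦ A v₁ ⊗ A v₂ ⊗ ⋯`. -/
def tensorPow {m : ℕ} (ι : Type) [Fintype ι] [DecidableEq ι] (A : Matrix (Fin m) (Fin m) ℝ) :
    Tensors m ι →ₗ[ℝ] Tensors m ι where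
  toFun t i := ∑ j : ι → Fin m, (∏ c, A (i c) (j c)) * t j
  map_add' t u := by
    funext i; simp [mul_add, Finset.sum_add_distrib]
  map_smul' a t := by
    funext i; simp [Finset.mul_sum, mul_left_comm]

/-- The place permutation action of the permutations of `ι` on `(ℝ^m)^{⊗ ι}`. -/
def permute {m : ℕ} {ι : Type} (σ : Equiv.Perm ι) : Tensors m ι →ₗ[ℝ] Tensors m ι :=
  LinearMap.funLeft ℝ ℝ fun i : ι → Fin m => i ∘ σ

/-- The Young symmetrizer of the diagram `D`: antisymmetrize along the columns, then symmetrize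
along the rows. The places of the tensors are the boxes of `D`; a box `(i, j)` lies in row `i` and
column `j`. -/
def youngSymmetrizer (m : ℕ) (D : YoungDiagram) : Tensors m D.cells →ₗ[ℝ] Tensors m D.cells :=
  (∑ p : {p : Equiv.Perm D.cells // ∀ c, (p c).1.1 = c.1.1}, permute p.1) ∘ₗ
  (∑ q : {q : Equiv.Perm D.cells // ∀ c, (q c).1.2 = c.1.2},
    ((Equiv.Perm.sign q.1 : ℤ) : ℝ) • permute q.1)

/-- The space of the irreducible representation of `GL(m, ℝ)` attached to the Young diagram `D`. -/
def schurModule (m : ℕ) (D : YoungDiagram) : Submodule ℝ (Tensors m D.cells) :=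
  LinearMap.range (youngSymmetrizer m D)

theorem tensorPow_one {m : ℕ} (ι : Type) [Fintype ι] [DecidableEq ι] :
    tensorPow ι (1 : Matrix (Fin m) (Fin m) ℝ) = LinearMap.id := by
  refine LinearMap.ext fun t => funext fun i => ?_
  change ∑ j : ι → Fin m, (∏ c, (1 : Matrix (Fin m) (Fin m) ℝ) (i c) (j c)) * t j = t i
  rw [Finset.sum_eq_single i]
  · simp
  · intro j _ hj
    obtain ⟨c, hc⟩ := Function.ne_iff.mp hj
    rw [Finset.prod_eq_zero (Finset.mem_univ c), zero_mul]
    exact Matrix.one_apply_ne (Ne.symm hc)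
  · simp

theorem tensorPow_mul {m : ℕ} (ι : Type) [Fintype ι] [DecidableEq ι]
    (A B : Matrix (Fin m) (Fin m) ℝ) :
    tensorPow ι (A * B) = tensorPow ι A ∘ₗ tensorPow ι B := by
  refine LinearMap.ext fun t => funext fun i => ?_
  change ∑ j : ι → Fin m, (∏ c, (A * B) (i c) (j c)) * t j =
    ∑ l : ι → Fin m, (∏ c, A (i c) (l c)) * ∑ j : ι → Fin m, (∏ c, B (l c) (j c)) * t j
  simp only [Finset.mul_sum]
  rw [Finset.sum_comm]
  refine Finset.sum_congr rfl fun j _ => ?_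
  simp only [Matrix.mul_apply, Finset.prod_univ_sum, Fintype.piFinset_univ, Finset.sum_mul,
    Finset.prod_mul_distrib, mul_assoc]

theorem tensorPow_permute {m : ℕ} {ι : Type} [Fintype ι] [DecidableEq ι]
    (A : Matrix (Fin m) (Fin m) ℝ) (σ : Equiv.Perm ι) :
    tensorPow ι A ∘ₗ permute σ = permute σ ∘ₗ tensorPow ι A := by
  refine LinearMap.ext fun t => funext fun i => ?_
  change ∑ j : ι → Fin m, (∏ c, A (i c) (j c)) * t (j ∘ σ) =
    ∑ j : ι → Fin m, (∏ c, A (i (σ c)) (j c)) * t j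
  refine Fintype.sum_equiv (σ.symm.arrowCongr (Equiv.refl (Fin m))) _ _ fun j => ?_
  congr 1
  exact (Equiv.prod_comp σ fun c => A (i c) (j c)).symm

theorem tensorPow_mem_schurModule {m : ℕ} (D : YoungDiagram) (A : Matrix (Fin m) (Fin m) ℝ)
    (t : Tensors m D.cells) (ht : t ∈ schurModule m D) :
    tensorPow D.cells A t ∈ schurModule m D := by
  have key : tensorPow D.cells A ∘ₗ youngSymmetrizer m D =
      youngSymmetrizer m D ∘ₗ tensorPow D.cells A := by
    unfold youngSymmetrizer
    refine LinearMap.ext fun t => ?_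
    have h : ∀ (σ : Equiv.Perm D.cells) (u : Tensors m D.cells),
        tensorPow D.cells A (permute σ u) = permute σ (tensorPow D.cells A u) :=
      fun σ u => LinearMap.congr_fun (tensorPow_permute A σ) u
    simp only [LinearMap.comp_apply, LinearMap.sum_apply, LinearMap.smul_apply, map_sum, map_smul,
      h]
  obtain ⟨u, rfl⟩ := ht
  exact ⟨tensorPow D.cells A u, (LinearMap.congr_fun key u).symm⟩

/-- The representation `A ↦ |det A|^w (det A)^z ρ_D(A)` of `GL(m, ℝ)`, where `ρ_D` is the
representation attached to the Young diagram `D`. -/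
def tensorRep (m : ℕ) (D : YoungDiagram) (w : ℝ) (z : ℤ) :
    Representation ℝ (GL (Fin m) ℝ) (schurModule m D) where
  toFun A := (|A.1.det| ^ w * A.1.det ^ z) •
    (tensorPow D.cells A.1).restrict (tensorPow_mem_schurModule D A.1)
  map_one' := by
    refine LinearMap.ext fun t => Subtype.ext ?_
    simp [tensorPow_one]
  map_mul' A B := by
    refine LinearMap.ext fun t => Subtype.ext ?_
    simp only [Units.val_mul, Matrix.det_mul, abs_mul, tensorPow_mul, mul_zpow,
      Real.mul_rpow (abs_nonneg _) (abs_nonneg _), LinearMap.smul_apply, Module.End.mul_apply,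
      LinearMap.restrict_apply, map_smul, Submodule.coe_smul, LinearMap.comp_apply, smul_smul]
    congr 1
    ring

section Infinitesimal

variable {m : ℕ} {V : Type*} [NormedAddCommGroup V] [NormedSpace ℝ V] [FiniteDimensional ℝ V]

open Classical in
/-- The representation `ρ_*` of `gl(m, ℝ)`: the differential of `ρ` at the identity. (The value
`0` outside the open set `GL(m, ℝ)` plays no role.) -/
def infinitesimal (ρ : Representation ℝ (GL (Fin m) ℝ) V) :
    Matrix (Fin m) (Fin m) ℝ →ₗ[ℝ] (V →L[ℝ] V) :=
  (fderiv ℝ (fun A : Matrix (Fin m) (Fin m) ℝ =>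
    if h : IsUnit A then LinearMap.toContinuousLinearMap (ρ h.unit) else 0) 1).toLinearMap

end Infinitesimal

/-! ### Smooth functions, vector fields, Lie derivatives -/

/-- The space `C^∞(ℝ^m, F)`. -/
def SmoothFn (m : ℕ) (F : Type*) [NormedAddCommGroup F] [NormedSpace ℝ F] :
    Submodule ℝ ((Fin m → ℝ) → F) where
  carrier := {f | ContDiff ℝ ∞ f}
  add_mem' := by
    intro f g (hf : ContDiff ℝ ∞ f) (hg : ContDiff ℝ ∞ g)
    exact (hf.add hg : ContDiff ℝ ∞ (f + g))
  zero_mem' := (contDiff_const : ContDiff ℝ ∞ fun _ : Fin m → ℝ => (0 : F))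
  smul_mem' := by
    intro c f (hf : ContDiff ℝ ∞ f)
    exact (hf.const_smul c : ContDiff ℝ ∞ (c • f))

section Calculus

variable {m : ℕ} {F G : Type*} [NormedAddCommGroup F] [NormedSpace ℝ F]
  [NormedAddCommGroup G] [NormedSpace ℝ G]

theorem contDiff_of (f : SmoothFn m F) : ContDiff ℝ ∞ f.1 := f.2

/-- The partial derivative `∂/∂x^i`. -/
def partialD (i : Fin m) : Module.End ℝ (SmoothFn m F) where
  toFun f := ⟨fun x => fderiv ℝ f.1 x (Pi.single i 1),
    ((contDiff_of f).fderiv_right (m := ∞) le_rfl).clm_apply contDiff_const⟩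
  map_add' f g := by
    refine Subtype.ext (funext fun x => ?_)
    have hf : DifferentiableAt ℝ f.1 x := ((contDiff_of f).differentiable (by simp)) x
    have hg : DifferentiableAt ℝ g.1 x := ((contDiff_of g).differentiable (by simp)) x
    change fderiv ℝ (f.1 + g.1) x _ = _
    rw [fderiv_add hf hg]
    rfl
  map_smul' c f := by
    refine Subtype.ext (funext fun x => ?_)
    change fderiv ℝ (c • f.1) x _ = _
    rw [fderiv_const_smul_field]
    rfl

/-- The partial derivative `∂^α` of multi-index `α`. -/
def partialPow (α : Fin m →₀ ℕ) : Module.End ℝ (SmoothFn m F) :=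
  (List.ofFn fun i : Fin m => partialD i ^ α i).prod

/-- Multiplication of smooth functions by a smooth real-valued function. -/
def mulFn (g : SmoothFn m ℝ) : Module.End ℝ (SmoothFn m F) where
  toFun f := ⟨fun x => g.1 x • f.1 x, (contDiff_of g).smul (contDiff_of f)⟩
  map_add' _ _ := Subtype.ext (funext fun _ => smul_add _ _ _)
  map_smul' _ _ := Subtype.ext (funext fun _ => smul_comm _ _ _)

/-- Pointwise application of a smooth function with values in linear maps. -/
def applyFn : SmoothFn m (F →L[ℝ] G) →ₗ[ℝ] SmoothFn m F →ₗ[ℝ] SmoothFn m G :=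
  LinearMap.mk₂ ℝ (fun c f => ⟨fun x => c.1 x (f.1 x), (contDiff_of c).clm_apply (contDiff_of f)⟩)
    (fun _ _ _ => rfl) (fun _ _ _ => rfl)
    (fun c f g => Subtype.ext (funext fun x => map_add (c.1 x) (f.1 x) (g.1 x)))
    (fun a c f => Subtype.ext (funext fun x => map_smul (c.1 x) a (f.1 x)))

/-- The Jacobian entry `∂X^i/∂x^j` of a vector field `X`. -/
def jacobian (X : SmoothFn m (Fin m → ℝ)) (i j : Fin m) : SmoothFn m ℝ :=
  ⟨fun x => (partialD j X).1 x i, (contDiff_pi.mp (contDiff_of (partialD j X))) i⟩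

/-- The matrix of the differential `D_x X`. -/
def jacobianMatrix (X : SmoothFn m (Fin m → ℝ)) (x : Fin m → ℝ) : Matrix (Fin m) (Fin m) ℝ :=
  Matrix.of fun i j => (jacobian X i j).1 x

theorem contDiff_jacobianMatrix (r : Matrix (Fin m) (Fin m) ℝ →ₗ[ℝ] F)
    (X : SmoothFn m (Fin m → ℝ)) : ContDiff ℝ ∞ fun x => r (jacobianMatrix X x) := by
  have h : (fun x => r (jacobianMatrix X x)) =
      fun x => ∑ i, ∑ j, (jacobian X i j).1 x • r (Matrix.single i j 1) := by
    funext x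
    conv_lhs => rw [Matrix.matrix_eq_sum_single (jacobianMatrix X x)]
    simp only [map_sum]
    refine Finset.sum_congr rfl fun i _ => Finset.sum_congr rfl fun j _ => ?_
    rw [← map_smul, Matrix.smul_single, smul_eq_mul, mul_one]
    rfl
  rw [h]
  exact ContDiff.sum fun i _ => ContDiff.sum fun j _ =>
    (contDiff_of (jacobian X i j)).smul contDiff_const

/-- The Lie derivative of `F`-valued functions in the direction of the vector field `X`, where
`gl(m, ℝ)` acts on `F` through `r`: `(L_X f)(x) = (X.f)(x) - r(D_x X) f(x)`. -/
def lieDeriv (r : Matrix (Fin m) (Fin m) ℝ →ₗ[ℝ] (F →L[ℝ] F)) (X : SmoothFn m (Fin m → ℝ)) :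
    Module.End ℝ (SmoothFn m F) where
  toFun f := ⟨fun x => fderiv ℝ f.1 x (X.1 x) - r (jacobianMatrix X x) (f.1 x),
    (((contDiff_of f).fderiv_right (m := ∞) le_rfl).clm_apply (contDiff_of X)).sub
      ((contDiff_jacobianMatrix r X).clm_apply (contDiff_of f))⟩
  map_add' f g := by
    refine Subtype.ext (funext fun x => ?_)
    have hf : DifferentiableAt ℝ f.1 x := ((contDiff_of f).differentiable (by simp)) x
    have hg : DifferentiableAt ℝ g.1 x := ((contDiff_of g).differentiable (by simp)) x
    change fderiv ℝ (f.1 + g.1) x (X.1 x) - r (jacobianMatrix X x) (f.1 x + g.1 x) =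
      (fderiv ℝ f.1 x (X.1 x) - r (jacobianMatrix X x) (f.1 x)) +
      (fderiv ℝ g.1 x (X.1 x) - r (jacobianMatrix X x) (g.1 x))
    rw [fderiv_add hf hg, map_add, add_apply]
    abel
  map_smul' c f := by
    refine Subtype.ext (funext fun x => ?_)
    change fderiv ℝ (c • f.1) x (X.1 x) - r (jacobianMatrix X x) (c • f.1 x) =
      c • (fderiv ℝ f.1 x (X.1 x) - r (jacobianMatrix X x) (f.1 x))
    rw [fderiv_const_smul_field, map_smul, smul_sub]
    rfl

end Calculus

/-! ### The projective algebra of vector fields -/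

/-- The Lie algebra `sl(m+1, ℝ)`; its elements are block matrices `[A v; ξ a]`, with `A` of size
`m` and `a` of size `1`. -/
abbrev SL (m : ℕ) : Type := LieAlgebra.SpecialLinear.sl (Fin m ⊕ Unit) ℝ

/-- The vector field on `ℝ^m` of the infinitesimal projective transformation
`h = [A v; ξ a]`, namely `X^h(x) = -v - (A - a) x + ξ(x) x`. -/
def projField {m : ℕ} (h : SL m) : SmoothFn m (Fin m → ℝ) :=
  ⟨fun x i => -h.1 (.inl i) (.inr ()) -
      ((∑ j, h.1 (.inl i) (.inl j) * x j) - h.1 (.inr ()) (.inr ()) * x i) +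
      (∑ j, h.1 (.inr ()) (.inl j) * x j) * x i, by
    change ContDiff ℝ ∞ _
    fun_prop⟩

/-- The element `ξ` of `g₁ = ℝ^{m*}`, seen in `sl(m+1, ℝ)`. -/
def g1 {m : ℕ} (ξ : Fin m → ℝ) : SL m :=
  ⟨Matrix.fromBlocks 0 0 (Matrix.of fun _ j => ξ j) 0, by
    change Matrix.traceLinearMap _ ℝ ℝ _ = 0
    simp [Matrix.trace]⟩

/-- The Casimir operator `∑ β(bᵢ) β(bᵢ*)` of `β`, where `b` is a basis of `sl(m+1, ℝ)` and `b*` is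
the basis that is dual to it for the Killing form: `bᵢ* = ∑ⱼ (K⁻¹)ᵢⱼ bⱼ` with `K` the Gram matrix
of `b`. -/
def casimir {m : ℕ} {W : Type*} [AddCommMonoid W] [Module ℝ W] (β : SL m → Module.End ℝ W) :
    Module.End ℝ W :=
  let b := Module.finBasis ℝ (SL m)
  let K := Matrix.of fun i j => killingForm ℝ (SL m) (b i) (b j)
  ∑ i, ∑ j, K⁻¹ i j • (β (b i) ∘ₗ β (b j))

/-! ### Symbols and differential operators -/

/-- Polynomials in `ξ = (ξ_1, …, ξ_m)` with coefficients in `F`, a polynomial `∑ c_α ξ^α` being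
given by its coefficients `c_α`; this is `⊕_k S^k ℝ^m ⊗ F`. -/
abbrev Poly (m : ℕ) (F : Type*) [AddCommGroup F] : Type _ := (Fin m →₀ ℕ) →₀ F

section Poly

variable {m : ℕ} {F G : Type*} [AddCommGroup F] [Module ℝ F] [AddCommGroup G] [Module ℝ G]

/-- Polynomials that are homogeneous of degree `k`. -/
def homogeneous (m : ℕ) (F : Type*) [AddCommGroup F] [Module ℝ F] (k : ℕ) :
    Submodule ℝ (Poly m F) :=
  Finsupp.supported F ℝ {α | α.degree = k}

/-- A linear map applied to the coefficients of a polynomial. -/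
def coeffMap (u : F →ₗ[ℝ] G) : Poly m F →ₗ[ℝ] Poly m G := Finsupp.mapRange.linearMap u

/-- The operator `ξ_i ∂/∂ξ_j`. -/
def xiD (i j : Fin m) : Module.End ℝ (Poly m F) :=
  Finsupp.lsum ℝ fun α =>
    (α j : ℝ) • Finsupp.lsingle (α - Finsupp.single j 1 + Finsupp.single i 1)

end Poly

section Symbols

variable {m : ℕ} {V₁ V₂ : Type*}
  [NormedAddCommGroup V₁] [NormedSpace ℝ V₁] [FiniteDimensional ℝ V₁]
  [NormedAddCommGroup V₂] [NormedSpace ℝ V₂] [FiniteDimensional ℝ V₂]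

/-- The fibre `⊕_k S^k_{V₁,V₂}`, where `S^k_{V₁,V₂} = S^k ℝ^m ⊗ V₁* ⊗ V₂`. -/
abbrev Fibre (m : ℕ) (V₁ V₂ : Type*) [NormedAddCommGroup V₁] [NormedSpace ℝ V₁]
    [NormedAddCommGroup V₂] [NormedSpace ℝ V₂] : Type _ := Poly m (V₁ →L[ℝ] V₂)

/-- The space `⊕_k C^∞(ℝ^m, S^k_{V₁,V₂})` of symbols: polynomials in `ξ` whose coefficients are
smooth functions from `ℝ^m` to `Hom(V₁, V₂)`. -/
abbrev Symbol (m : ℕ) (V₁ V₂ : Type*) [NormedAddCommGroup V₁] [NormedSpace ℝ V₁]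
    [NormedAddCommGroup V₂] [NormedSpace ℝ V₂] : Type _ := Poly m (SmoothFn m (V₁ →L[ℝ] V₂))

/-- Linear operators from `C^∞(ℝ^m, V₁)` to `C^∞(ℝ^m, V₂)`. -/
abbrev Operator (m : ℕ) (V₁ V₂ : Type*) [NormedAddCommGroup V₁] [NormedSpace ℝ V₁]
    [NormedAddCommGroup V₂] [NormedSpace ℝ V₂] : Type _ := SmoothFn m V₁ →ₗ[ℝ] SmoothFn m V₂

/-- The value `T(x)` of a symbol at a point of `ℝ^m`. -/
def valueAt (x : Fin m → ℝ) : Symbol m V₁ V₂ →ₗ[ℝ] Fibre m V₁ V₂ :=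
  coeffMap (LinearMap.proj x ∘ₗ (SmoothFn m (V₁ →L[ℝ] V₂)).subtype)

/-- The standard ordering `Q_Aff (∑ C_α ξ^α) = ∑ C_α ∘ ∂^α`. -/
def affineQuantization : Symbol m V₁ V₂ →ₗ[ℝ] Operator m V₁ V₂ :=
  Finsupp.lsum ℝ fun α => LinearMap.lcomp ℝ (SmoothFn m V₂) (partialPow α) ∘ₗ applyFn

/-- The differential operators from `C^∞(ℝ^m, V₁)` to `C^∞(ℝ^m, V₂)`: the operators
`∑ C_α ∘ ∂^α` (finite sum) with smooth coefficients. -/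
def DiffOp (m : ℕ) (V₁ V₂ : Type*) [NormedAddCommGroup V₁] [NormedSpace ℝ V₁]
    [NormedAddCommGroup V₂] [NormedSpace ℝ V₂] : Submodule ℝ (Operator m V₁ V₂) :=
  LinearMap.range affineQuantization

/-- `D = ∑_{|α| ≤ k} C_α ∘ ∂^α` is a differential operator of order at most `k` and
`σ(D) = ∑_{|α| = k} C_α ξ^α` is `T`. -/
def HasPrincipalSymbol (k : ℕ) (D : Operator m V₁ V₂) (T : Symbol m V₁ V₂) : Prop :=
  ∃ c : Symbol m V₁ V₂, (∀ α, k < α.degree → c α = 0) ∧ D = affineQuantization c ∧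
    T = c.filter fun α => α.degree = k

variable (ρ₁ : Representation ℝ (GL (Fin m) ℝ) V₁) (ρ₂ : Representation ℝ (GL (Fin m) ℝ) V₂)

/-- The natural action of `gl(m, ℝ)` on `V₁* ⊗ V₂ = Hom(V₁, V₂)`. -/
def homAct : Matrix (Fin m) (Fin m) ℝ →ₗ[ℝ] ((V₁ →L[ℝ] V₂) →L[ℝ] (V₁ →L[ℝ] V₂)) where
  toFun B := LinearMap.toContinuousLinearMap
    { toFun := fun c => infinitesimal ρ₂ B ∘L c - c ∘L infinitesimal ρ₁ B
      map_add' := fun c d => by ext v; simp; abel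
      map_smul' := fun a c => by ext v; simp [smul_sub] }
  map_add' B B' := by ext c v; simp; abel
  map_smul' a B := by ext c v; simp [smul_sub]

/-- The natural action `ρ_*` of `gl(m, ℝ)` on `⊕_k S^k ℝ^m ⊗ V₁* ⊗ V₂`. On `S^k ℝ^m` it is the
derivation of the polynomial algebra in `ξ` that extends `ξ_j ↦ ∑_i B_{ij} ξ_i`, the variable `ξ_j`
being the linear form given by the `j`-th basis vector of `ℝ^m`. -/
def fibreAct (B : Matrix (Fin m) (Fin m) ℝ) : Module.End ℝ (Fibre m V₁ V₂) :=
  ∑ i, ∑ j, B i j • xiD i j + coeffMap (homAct ρ₁ ρ₂ B).toLinearMap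

/-- The Lie derivative of symbols, `(L_X T)(x) = (X.T)(x) - ρ_*(D_x X) T(x)`: the terms that come
from the coefficients in `Hom(V₁, V₂)` are collected in the first summand; see
`valueAt_lieSymbolField` for the formula at a point. -/
def lieSymbolField (X : SmoothFn m (Fin m → ℝ)) : Module.End ℝ (Symbol m V₁ V₂) :=
  coeffMap (lieDeriv (homAct ρ₁ ρ₂) X) - ∑ i, ∑ j, xiD i j ∘ₗ coeffMap (mulFn (jacobian X i j))

theorem coeffMap_xiD {F G : Type*} [AddCommGroup F] [Module ℝ F] [AddCommGroup G] [Module ℝ G]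
    (u : F →ₗ[ℝ] G) (i j : Fin m) (T : Poly m F) :
    coeffMap u (xiD i j T) = xiD i j (coeffMap u T) := by
  have : coeffMap u ∘ₗ xiD i j = xiD i j ∘ₗ coeffMap u := by
    refine Finsupp.lhom_ext fun α c => ?_
    simp [coeffMap, xiD]
  exact LinearMap.congr_fun this T

theorem valueAt_lieSymbolField (X : SmoothFn m (Fin m → ℝ)) (T : Symbol m V₁ V₂)
    (x : Fin m → ℝ) (α : Fin m →₀ ℕ) :
    valueAt x (lieSymbolField ρ₁ ρ₂ X T) α =
      fderiv ℝ (fun y => valueAt y T α) x (X.1 x) -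
        fibreAct ρ₁ ρ₂ (jacobianMatrix X x) (valueAt x T) α := by
  have h : ∀ i j, valueAt x (xiD i j (coeffMap (mulFn (jacobian X i j)) T)) =
      jacobianMatrix X x i j • xiD i j (valueAt x T) := by
    intro i j
    rw [valueAt, coeffMap_xiD, ← map_smul]
    congr 1
    exact Finsupp.ext fun β => rfl
  simp only [lieSymbolField, fibreAct, LinearMap.sub_apply, LinearMap.add_apply,
    LinearMap.sum_apply, LinearMap.comp_apply, LinearMap.smul_apply, map_sub, map_sum, h,
    Finsupp.sub_apply, Finsupp.add_apply]
  have h' : valueAt x (coeffMap (lieDeriv (homAct ρ₁ ρ₂) X) T) α =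
      fderiv ℝ (fun y => valueAt y T α) x (X.1 x) -
        coeffMap (homAct ρ₁ ρ₂ (jacobianMatrix X x)).toLinearMap (valueAt x T) α := rfl
  rw [h']
  abel

/-- The action `L_{X^h}` of `sl(m+1, ℝ)` on symbols. -/
def lieSymbol (h : SL m) : Module.End ℝ (Symbol m V₁ V₂) := lieSymbolField ρ₁ ρ₂ (projField h)

/-- The action of `sl(m+1, ℝ)` on operators, given by the commutator
`𝓛_{X^h} D = L_{X^h} ∘ D - D ∘ L_{X^h}`. -/
def lieOperator (h : SL m) : Module.End ℝ (Operator m V₁ V₂) where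
  toFun D := lieDeriv (infinitesimal ρ₂) (projField h) ∘ₗ D -
    D ∘ₗ lieDeriv (infinitesimal ρ₁) (projField h)
  map_add' D D' := by ext1 f; simp; abel
  map_smul' a D := by ext1 f; simp [smul_sub]

/-- The Casimir operator `C` of the representation `L` on symbols. -/
def casimirSymbol : Module.End ℝ (Symbol m V₁ V₂) := casimir (lieSymbol ρ₁ ρ₂)

/-- The Casimir operator `𝒞` of the representation `𝓛` on operators. Symbols are identified with
differential operators through `Q_Aff` when `𝒞` is applied to symbols. -/
def casimirOperator : Module.End ℝ (Operator m V₁ V₂) := casimir (lieOperator ρ₁ ρ₂)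

/-! ### Irreducible components, tree-like subspaces, critical pairs -/

/-- Stability of a subspace of the fibre under `sl(m, ℝ)`. -/
def IsSLStable (I : Submodule ℝ (Fibre m V₁ V₂)) : Prop :=
  ∀ B : Matrix (Fin m) (Fin m) ℝ, B.trace = 0 → ∀ w ∈ I, fibreAct ρ₁ ρ₂ B w ∈ I

/-- `I` is an irreducible representation of `sl(m, ℝ)`. -/
def IsIrreducibleSL (I : Submodule ℝ (Fibre m V₁ V₂)) : Prop :=
  IsSLStable ρ₁ ρ₂ I ∧ I ≠ ⊥ ∧ ∀ J ≤ I, IsSLStable ρ₁ ρ₂ J → J = ⊥ ∨ J = I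

/-- A decomposition `S^k_{V₁,V₂} = ⊕_s I_{k,s}`, for every `k`, into finitely many irreducible
representations of `sl(m, ℝ)`. -/
structure Decomposition where
  n : ℕ → ℕ
  I : (k : ℕ) → Fin (n k) → Submodule ℝ (Fibre m V₁ V₂)
  irreducible : ∀ k s, IsIrreducibleSL ρ₁ ρ₂ (I k s)
  independent : ∀ k, iSupIndep (I k)
  sum_eq : ∀ k, ⨆ s, I k s = homogeneous m (V₁ →L[ℝ] V₂) k

/-- The space `C^∞(ℝ^m, I)` of the symbols with values in `I`. -/
def sections (I : Submodule ℝ (Fibre m V₁ V₂)) : Submodule ℝ (Symbol m V₁ V₂) :=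
  ⨅ x : Fin m → ℝ, I.comap (valueAt x)

/-- `U = γ(h) T`, where `γ(h) = 𝓛_{X^h} - L_{X^h}` and `𝓛` is transported to symbols
through `Q_Aff`. -/
def IsGamma (h : SL m) (T U : Symbol m V₁ V₂) : Prop :=
  affineQuantization U =
    lieOperator ρ₁ ρ₂ h (affineQuantization T) - affineQuantization (lieSymbol ρ₁ ρ₂ h T)

/-- The tree-like subspaces `tree^l(E)`: `tree^0(E) = E` and `tree^{l+1}(E) = γ(g₁)(tree^l(E))`. -/
def tree (E : Submodule ℝ (Symbol m V₁ V₂)) : ℕ → Submodule ℝ (Symbol m V₁ V₂)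
  | 0 => E
  | l + 1 => Submodule.span ℝ {U | ∃ ξ : Fin m → ℝ, ∃ T ∈ tree E l, IsGamma ρ₁ ρ₂ (g1 ξ) T U}

variable {ρ₁ ρ₂}

/-- The space `E_{k,s} = C^∞(ℝ^m, I_{k,s})`. -/
def Decomposition.E (d : Decomposition ρ₁ ρ₂) (k : ℕ) (s : Fin (d.n k)) :
    Submodule ℝ (Symbol m V₁ V₂) := sections (d.I k s)

/-- `a` is the eigenvalue `α_{k,s}`: the Casimir operator `C` is `a` times the identity on
`E_{k,s}`. -/
def Decomposition.IsAlpha (d : Decomposition ρ₁ ρ₂) (k : ℕ) (s : Fin (d.n k)) (a : ℝ) : Prop :=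
  ∀ T ∈ d.E k s, casimirSymbol ρ₁ ρ₂ T = a • T

/-- The pair `(V₁, V₂)` is critical: some `α_{k,s}` is an eigenvalue of `C` on
`⊕_{l ≥ 1} tree^l(E_{k,s})`. -/
def Decomposition.IsCritical (d : Decomposition ρ₁ ρ₂) : Prop :=
  ∃ k s a, d.IsAlpha k s a ∧
    ∃ U ∈ ⨆ l, tree ρ₁ ρ₂ (d.E k s) (l + 1), U ≠ 0 ∧ casimirSymbol ρ₁ ρ₂ U = a • U

/-- `U = T_k + T_{k-1} + ⋯ + T_0` with `T_k = T` and `T_{k-l} ∈ tree^l(E_{k,s})`, and `𝒞 U = a U`. -/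
def Decomposition.IsTreeEigenvector (d : Decomposition ρ₁ ρ₂) (k : ℕ) (s : Fin (d.n k)) (a : ℝ)
    (T U : Symbol m V₁ V₂) : Prop :=
  (∃ t : ℕ → Symbol m V₁ V₂, t 0 = T ∧ (∀ l, t l ∈ tree ρ₁ ρ₂ (d.E k s) l) ∧
    U = ∑ l ∈ Finset.range (k + 1), t l) ∧
  casimirOperator ρ₁ ρ₂ (affineQuantization U) = a • affineQuantization U

/-- A quantization: a linear bijection from symbols to differential operators with `σ(Q(T)) = T`
for every symbol `T` of degree `k`, for every `k`. -/
def IsQuantization (Q : Symbol m V₁ V₂ ≃ₗ[ℝ] DiffOp m V₁ V₂) : Prop :=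
  ∀ k, ∀ T ∈ homogeneous m (SmoothFn m (V₁ →L[ℝ] V₂)) k,
    HasPrincipalSymbol k (Q T : Operator m V₁ V₂) T

variable (ρ₁ ρ₂) in
/-- `sl(m+1, ℝ)`-equivariance: `𝓛_{X^h} ∘ Q = Q ∘ L_{X^h}`. -/
def IsProjectivelyEquivariant (Q : Symbol m V₁ V₂ ≃ₗ[ℝ] DiffOp m V₁ V₂) : Prop :=
  ∀ (h : SL m) (T : Symbol m V₁ V₂),
    lieOperator ρ₁ ρ₂ h (Q T : Operator m V₁ V₂) = (Q (lieSymbol ρ₁ ρ₂ h T) : Operator m V₁ V₂)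

end Symbols

end

end ProjQuant

/-! The quantization sends a symbol `T` to the eigenvector of `𝒞` that has `T` as leading term; the
theorem holds because this eigenvector exists, is unique, and is respected by the group of
symmetries.

Transported to symbols, `𝓛 = L + γ`. The cocycle `γ` sees only the `g₁` part of its argument; it
acts pointwise, by endomorphisms of the fibre that lower the degree in `ξ` by one
(`corresponds_lieOperator`, `fibGamma_mem_homogeneous`). The Killing form pairs `g₁` with the
translations, on which `γ` vanishes, so the Casimir sum has no term quadratic in `γ` and `𝒞 = C + N`
with `N = -(m+1)⁻¹ ∑ γ(ε^j) ∂_j` (`corresponds_casimirOperator`). In `C` itself all coordinates and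
derivatives cancel (`WeylSystem.sum_projElem_mul`): `C` acts pointwise too, by an endomorphism of
the fibre that commutes with `gl(m)` (`pointwise_casimirSymbol`, `fibCasimir_comm`).

The fibre carries a scalar product for which `E_{ij}` and `E_{ji}` are adjoint (`exists_fibreForm`).
Hence every homogeneous component splits into irreducibles (`nonempty_decomposition`), and `C`,
being symmetric, is a real scalar on each irreducible component (`exists_fibCasimir_scalar`).

The space `tree^l(E_{k,s})` consists of all smooth functions with values in a finite-dimensional
`gl(m)`-stable space of polynomials of degree `k - l` (`tree_sections`); it is zero for `l > k`.
There `C` preserves the level `l` and `N` raises it by one, so `C + N` is triangular. In the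
non-critical case `C - α` is invertible on each level `l ≥ 1` (`exists_resolvent`), and the equation
`(C + N) T̂ = α T̂` is solved level by level, in exactly one way (`IsLadder.eigen_ladderSum`,
`IsLadder.eigen_unique`).

Equivariance follows from uniqueness. As `𝒞` commutes with `𝓛`, the symbol `𝓛 T̂` is again an
eigenvector for `α`; since `γ` raises the level, its leading term is `L T`, so it is the eigenvector
attached to `L T` (`IsLadder.ladderSum_equivariant`). Finally `T ↦ T̂` is the identity up to terms
of lower degree, hence bijective and compatible with principal symbols
(`IsUnitriangular.bijective`).

The commutator computations take place in an arbitrary ring with the relations of coordinates,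
derivatives and elementary matrices, so that functions, symbols and fibres share them. -/

namespace ProjQuant

noncomputable section

/-! ### The projective realization in an abstract algebra -/

section Abstract

variable {m : ℕ} {A : Type*} [Ring A]

/-- Operators `x_i`, `d_i`, `r_{ij}` with the relations of coordinates, partial derivatives, and
endomorphisms that commute with both. -/
structure WeylSystem (x d : Fin m → A) (r : Fin m → Fin m → A) : Prop where
  xx : ∀ i j, x i * x j = x j * x i
  dd : ∀ i j, d i * d j = d j * d i
  dx : ∀ i j, d i * x j = x j * d i + if i = j then 1 else 0
  rx : ∀ i j k, r i j * x k = x k * r i j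
  rd : ∀ i j k, r i j * d k = d k * r i j

/-- The relations of the elementary matrices. -/
def IsGL {ι : Type*} [DecidableEq ι] (e : ι → ι → A) : Prop :=
  ∀ i j k l, e i j * e k l - e k l * e i j =
    (if j = k then e i l else 0) - (if l = i then e k j else 0)

/-- The Euler field. -/
def eulerOp (x d : Fin m → A) : A := ∑ i, x i * d i

/-- The image of the elementary matrices of size `m + 1` under the projective realization. -/
def projElem (x d : Fin m → A) (r : Fin m → Fin m → A) : Fin m ⊕ Unit → Fin m ⊕ Unit → A
  | .inl i, .inr _ => - d i
  | .inl i, .inl j => - (x j * d i) + r i j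
  | .inr _, .inr _ => eulerOp x d - ∑ i, r i i
  | .inr _, .inl j => x j * (eulerOp x d - ∑ i, r i i) - ∑ i, x i * r i j

variable {x d : Fin m → A} {r : Fin m → Fin m → A}

namespace WeylSystem

variable (h : WeylSystem x d r)
include h

theorem euler_x (j : Fin m) : eulerOp x d * x j = x j * eulerOp x d + x j := by
  simp only [eulerOp, Finset.sum_mul, Finset.mul_sum, mul_assoc, h.dx, mul_add,
    Finset.sum_add_distrib]
  congr 1
  · refine Finset.sum_congr rfl fun i _ => ?_
    rw [← mul_assoc, h.xx, mul_assoc]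
  · simp


theorem d_euler (i : Fin m) : d i * eulerOp x d = eulerOp x d * d i + d i := by
  simp only [eulerOp, Finset.sum_mul, Finset.mul_sum, ← mul_assoc, h.dx, add_mul,
    Finset.sum_add_distrib]
  congr 1
  · refine Finset.sum_congr rfl fun j _ => ?_
    rw [mul_assoc, h.dd, mul_assoc]
  · simp

theorem r_euler (i j : Fin m) : r i j * eulerOp x d = eulerOp x d * r i j := by
  simp only [eulerOp, Finset.sum_mul, Finset.mul_sum]
  refine Finset.sum_congr rfl fun k _ => ?_
  rw [← mul_assoc, h.rx, mul_assoc, h.rd, mul_assoc]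

theorem tr_x (k : Fin m) : (∑ i, r i i) * x k = x k * ∑ i, r i i := by
  simp only [Finset.sum_mul, Finset.mul_sum, h.rx]

theorem tr_d (k : Fin m) : (∑ i, r i i) * d k = d k * ∑ i, r i i := by
  simp only [Finset.sum_mul, Finset.mul_sum, h.rd]

theorem tr_euler : (∑ i, r i i) * eulerOp x d = eulerOp x d * ∑ i, r i i := by
  simp only [Finset.sum_mul _ _ (eulerOp x d), Finset.mul_sum _ _ (eulerOp x d), h.r_euler]

omit h in
theorem tr_r (hr : IsGL r) (i j : Fin m) : (∑ k, r k k) * r i j = r i j * ∑ k, r k k := by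
  rw [← sub_eq_zero, ← neg_sub, neg_eq_zero, Finset.sum_mul, Finset.mul_sum,
    ← Finset.sum_sub_distrib]
  simp [hr i j]

theorem d_s (i j : Fin m) : d i * ∑ k, x k * r k j = (∑ k, x k * r k j) * d i + r i j := by
  simp only [Finset.sum_mul, Finset.mul_sum, ← mul_assoc, h.dx, add_mul,
    Finset.sum_add_distrib]
  congr 1
  · refine Finset.sum_congr rfl fun k _ => ?_
    rw [mul_assoc, mul_assoc, h.rd]
  · simp

theorem s_x (j k : Fin m) : (∑ i, x i * r i j) * x k = x k * ∑ i, x i * r i j := by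
  simp only [Finset.sum_mul, Finset.mul_sum]
  refine Finset.sum_congr rfl fun i _ => ?_
  rw [mul_assoc, h.rx, ← mul_assoc, h.xx, mul_assoc]

theorem euler_s (j : Fin m) : eulerOp x d * ∑ i, x i * r i j =
    (∑ i, x i * r i j) * eulerOp x d + ∑ i, x i * r i j := by
  simp only [Finset.sum_mul _ _ (eulerOp x d), Finset.mul_sum _ _ (eulerOp x d),
    ← Finset.sum_add_distrib]
  refine Finset.sum_congr rfl fun i _ => ?_
  rw [← mul_assoc, h.euler_x, mul_assoc, h.r_euler]
  noncomm_ring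

theorem tr_s (hr : IsGL r) (j : Fin m) : (∑ k, r k k) * ∑ i, x i * r i j =
    (∑ i, x i * r i j) * ∑ k, r k k := by
  rw [Finset.mul_sum, Finset.sum_mul _ _ (∑ k, r k k)]
  refine Finset.sum_congr rfl fun i _ => ?_
  rw [← mul_assoc, h.tr_x, mul_assoc, tr_r hr, mul_assoc]

theorem r_s (hr : IsGL r) (i j k : Fin m) : r i j * ∑ l, x l * r l k =
    (∑ l, x l * r l k) * r i j + (x j * r i k - if k = i then ∑ l, x l * r l j else 0) := by
  rw [← sub_eq_iff_eq_add', Finset.mul_sum, Finset.sum_mul, ← Finset.sum_sub_distrib]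
  have : ∀ l, r i j * (x l * r l k) - x l * r l k * r i j =
      x l * (if j = l then r i k else 0) - if k = i then x l * r l j else 0 := by
    intro l
    have h1 := hr i j l k
    rw [← mul_assoc, h.rx, mul_assoc, mul_assoc, ← mul_sub, h1, mul_sub]
    simp
  simp only [this, Finset.sum_sub_distrib]
  split_ifs <;> simp

/-- The right-hand correction is what makes the quadratic fields of `g₁` commute: it cancels the
brackets of `x_j E` with `∑ x_i r_{ik}`, where `E` is the Euler field. -/
theorem s_s (hr : IsGL r) (j k : Fin m) : (∑ i, x i * r i j) * ∑ i, x i * r i k =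
    (∑ i, x i * r i k) * (∑ i, x i * r i j) + x j * (∑ i, x i * r i k)
      - x k * ∑ i, x i * r i j := by
  have : ∀ i, x i * r i j * (∑ i, x i * r i k) = (∑ i, x i * r i k) * (x i * r i j) +
      (x j * (x i * r i k) - if k = i then x i * ∑ i, x i * r i j else 0) := by
    intro i
    rw [mul_assoc, h.r_s hr, mul_add, ← mul_assoc, ← h.s_x, mul_assoc, mul_sub, ← mul_assoc (x i),
      h.xx i j, mul_assoc]
    simp
  rw [Finset.sum_mul, Finset.sum_congr rfl fun i _ => this i, Finset.sum_add_distrib,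
    Finset.sum_sub_distrib, ← Finset.mul_sum, ← Finset.mul_sum, add_sub_assoc]
  simp


/-- The projective realization satisfies the relations of `gl(m + 1)`. -/
theorem isGL_projElem (hr : IsGL r) : IsGL (projElem x d r) := by
  -- Both sides change sign when the two pairs of indices are exchanged, so one order of each pair
  -- of blocks is enough.
  have skew : ∀ i j k l, (projElem x d r i j * projElem x d r k l -
      projElem x d r k l * projElem x d r i j = (if j = k then projElem x d r i l else 0) -
      (if l = i then projElem x d r k j else 0)) → projElem x d r k l * projElem x d r i j -
      projElem x d r i j * projElem x d r k l = (if l = i then projElem x d r k j else 0) -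
      (if j = k then projElem x d r i l else 0) := by
    intro i j k l H
    rw [← neg_sub, H, neg_sub]
  -- The letters D, G, Z, H stand for the four blocks: translations `E_{i∞}`, linear fields
  -- `E_{ij}`, the entry `E_{∞∞}`, and quadratic fields `E_{∞j}`.
  have hDG : ∀ i k l, projElem x d r (.inl i) (.inr ()) * projElem x d r (.inl k) (.inl l) -
      projElem x d r (.inl k) (.inl l) * projElem x d r (.inl i) (.inr ()) =
      - if l = i then projElem x d r (.inl k) (.inr ()) else 0 := by
    intro i k l
    have h1 := h.dx i l
    simp only [projElem]
    by_cases hil : l = i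
    · subst hil
      simp only [if_true] at h1 ⊢
      linear_combination (norm := noncomm_ring) h1 * d k + h.rd k l l + x l * h.dd l k
    · simp only [if_neg hil, if_neg (Ne.symm hil)] at h1 ⊢
      linear_combination (norm := noncomm_ring) h1 * d k + h.rd k l i + x l * h.dd i k
  have hDZ : ∀ i, projElem x d r (.inl i) (.inr ()) * projElem x d r (.inr ()) (.inr ()) -
      projElem x d r (.inr ()) (.inr ()) * projElem x d r (.inl i) (.inr ()) =
      projElem x d r (.inl i) (.inr ()) := by
    intro i
    simp only [projElem]
    linear_combination (norm := noncomm_ring) - h.d_euler i - h.tr_d i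
  have hDH : ∀ i j, projElem x d r (.inl i) (.inr ()) * projElem x d r (.inr ()) (.inl j) -
      projElem x d r (.inr ()) (.inl j) * projElem x d r (.inl i) (.inr ()) =
      projElem x d r (.inl i) (.inl j) - if j = i then projElem x d r (.inr ()) (.inr ()) else 0 := by
    intro i j
    have h1 := h.dx i j
    simp only [projElem]
    generalize hE : eulerOp x d = E
    generalize hR : ∑ i, r i i = R
    generalize hS : ∑ i, x i * r i j = S
    have a1 := h.d_euler i
    have a2 := h.tr_d i
    have a3 := h.d_s i j
    rw [hE] at a1
    rw [hR] at a2
    rw [hS] at a3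
    by_cases hij : j = i
    · subst hij
      simp only [if_true] at h1 ⊢
      linear_combination (norm := noncomm_ring) - h1 * (E - R) - x j * a1 + a3 - x j * a2
    · simp only [if_neg hij, if_neg (Ne.symm hij)] at h1 ⊢
      linear_combination (norm := noncomm_ring) - h1 * (E - R) - x j * a1 + a3 - x j * a2
  have hGG : ∀ i j k l, projElem x d r (.inl i) (.inl j) * projElem x d r (.inl k) (.inl l) -
      projElem x d r (.inl k) (.inl l) * projElem x d r (.inl i) (.inl j) =
      (if j = k then projElem x d r (.inl i) (.inl l) else 0) -
      (if l = i then projElem x d r (.inl k) (.inl j) else 0) := by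
    intro i j k l
    have h1 := h.dx i l
    have h2 := h.dx k j
    have h3 := hr i j k l
    have key : projElem x d r (.inl i) (.inl j) * projElem x d r (.inl k) (.inl l) -
      projElem x d r (.inl k) (.inl l) * projElem x d r (.inl i) (.inl j) =
      x j * (if i = l then 1 else 0) * d k - x l * (if k = j then 1 else 0) * d i +
      ((if j = k then r i l else 0) - (if l = i then r k j else 0)) := by
      rw [← h3]
      simp only [projElem]
      linear_combination (norm := noncomm_ring) x j * h1 * d k - x l * h2 * d i
        + h.xx j l * d i * d k + x l * x j * h.dd i k - h.rx i j l * d k - x l * h.rd i j k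
        + h.rx k l j * d i + x j * h.rd k l i
    rw [key]
    simp only [projElem, @eq_comm _ k j, @eq_comm _ i l]
    split_ifs <;> noncomm_ring
  have hGZ : ∀ i j, projElem x d r (.inl i) (.inl j) * projElem x d r (.inr ()) (.inr ()) -
      projElem x d r (.inr ()) (.inr ()) * projElem x d r (.inl i) (.inl j) = 0 := by
    intro i j
    simp only [projElem]
    linear_combination (norm := noncomm_ring) - x j * h.d_euler i + h.euler_x j * d i
      - x j * h.tr_d i - h.tr_x j * d i + h.r_euler i j + tr_r hr i j
  have hGH : ∀ i j k, projElem x d r (.inl i) (.inl j) * projElem x d r (.inr ()) (.inl k) -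
      projElem x d r (.inr ()) (.inl k) * projElem x d r (.inl i) (.inl j) =
      - if k = i then projElem x d r (.inr ()) (.inl j) else 0 := by
    intro i j k
    simp only [projElem]
    have h1 := h.dx i k
    have a1 := h.d_euler i
    have a2 := h.tr_d i
    have a3 := h.d_s i k
    have a4 := h.euler_x j
    have a5 := h.tr_x j
    have a6 := h.r_s hr i j k
    have a7 := h.s_x k j
    have a8 := h.rx i j k
    have a9 := h.r_euler i j
    have a10 := tr_r hr i j
    generalize eulerOp x d = E at *
    generalize ∑ i, r i i = R at *
    generalize ∑ i, x i * r i k = S at *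
    generalize ∑ i, x i * r i j = S' at *
    by_cases hki : k = i
    · subst hki
      simp only [if_true] at h1 a6 ⊢
      linear_combination (norm := noncomm_ring) - x j * h1 * (E - R) - h.xx j k * d k * (E - R)
        - x k * x j * a1 + x k * a4 * d k - x k * a5 * d k - x k * x j * a2 + x j * a3 - a7 * d k
        + a8 * (E - R) + x k * a9 + x k * a10 - a6
    · simp only [if_neg hki, if_neg (Ne.symm hki)] at h1 a6 ⊢
      linear_combination (norm := noncomm_ring) - x j * h1 * (E - R) - h.xx j k * d i * (E - R)
        - x k * x j * a1 + x k * a4 * d i - x k * a5 * d i - x k * x j * a2 + x j * a3 - a7 * d i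
        + a8 * (E - R) + x k * a9 + x k * a10 - a6
  have hZH : ∀ j, projElem x d r (.inr ()) (.inr ()) * projElem x d r (.inr ()) (.inl j) -
      projElem x d r (.inr ()) (.inl j) * projElem x d r (.inr ()) (.inr ()) =
      projElem x d r (.inr ()) (.inl j) := by
    intro j
    simp only [projElem]
    have a1 := h.euler_x j
    have a2 := h.tr_x j
    have a3 := h.euler_s j
    have a4 := h.tr_s hr j
    generalize eulerOp x d = E at *
    generalize ∑ i, r i i = R at *
    generalize ∑ i, x i * r i j = S at *
    linear_combination (norm := noncomm_ring) a1 * (E - R) - a2 * (E - R) - a3 + a4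
  have hHH : ∀ j k, projElem x d r (.inr ()) (.inl j) * projElem x d r (.inr ()) (.inl k) -
      projElem x d r (.inr ()) (.inl k) * projElem x d r (.inr ()) (.inl j) = 0 := by
    intro j k
    simp only [projElem]
    have a1 := h.euler_x j
    have a2 := h.tr_x j
    have a3 := h.euler_s j
    have a4 := h.tr_s hr j
    have b1 := h.euler_x k
    have b2 := h.tr_x k
    have b3 := h.euler_s k
    have b4 := h.tr_s hr k
    have c1 := h.s_x j k
    have c2 := h.s_x k j
    have c3 := h.s_s hr j k
    have c4 := h.xx j k
    generalize eulerOp x d = E at *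
    generalize ∑ i, r i i = R at *
    generalize ∑ i, x i * r i j = S at *
    generalize ∑ i, x i * r i k = S' at *
    linear_combination (norm := noncomm_ring) x j * (b1 - b2) * (E - R) - x k * (a1 - a2) * (E - R)
      + c4 * (E - R) * (E - R) + c4 * (E - R) + c3 - x j * (b3 - b4) - c1 * (E - R) + x k * (a3 - a4)
      + c2 * (E - R)
  intro i j k l
  rcases i with i | ⟨⟩ <;> rcases j with j | ⟨⟩ <;> rcases k with k | ⟨⟩ <;> rcases l with l | ⟨⟩
  · simpa using hGG i j k l
  · apply skew; simpa using hDG k i j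
  · simpa using hGH i j l
  · simpa using hGZ i j
  · simpa using hDG i k l
  · simp only [projElem]
    simpa using sub_eq_zero.2 (h.dd i k)
  · simpa using hDH i l
  · simpa using hDZ i
  · apply skew; simpa using hGH k l j
  · apply skew; simpa using hDH k j
  · simpa using hHH j l
  · apply skew; simpa using hZH j
  · apply skew; simpa using hGZ k l
  · apply skew; simpa using hDZ k
  · simpa using hZH l
  · simp

-- The realization kills the identity matrix, so it is really one of `gl(m+1)` modulo scalars;
-- `casimir_eq` needs this to ignore the trace part.
omit h in
theorem sum_projElem : ∑ i, projElem x d r i i = 0 := by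
  simp [projElem, eulerOp, Finset.sum_add_distrib]

/-- The Casimir element of the projective realization. -/
theorem sum_projElem_mul : ∑ i, ∑ j, projElem x d r i j * projElem x d r j i =
    ∑ i, ∑ j, r i j * r j i + (∑ i, r i i) * (∑ i, r i i) + (m + 1 : A) * ∑ i, r i i := by
  have hdx : ∑ i, d i * x i = eulerOp x d + m := by
    simp [eulerOp, h.dx, Finset.sum_add_distrib]
  have hxEd : ∑ j, x j * eulerOp x d * d j = eulerOp x d * eulerOp x d - eulerOp x d := by
    have : ∀ j, x j * eulerOp x d * d j = x j * d j * eulerOp x d - x j * d j := fun j => by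
      linear_combination (norm := noncomm_ring) - x j * h.d_euler j
    simp only [this, Finset.sum_sub_distrib, ← Finset.sum_mul]
    rfl
  have h1 : ∑ i, ∑ j, projElem x d r (.inl i) (.inl j) * projElem x d r (.inl j) (.inl i) =
      eulerOp x d * eulerOp x d - eulerOp x d + m * eulerOp x d -
      2 * ∑ j, (∑ i, x i * r i j) * d j + ∑ i, ∑ j, r i j * r j i := by
    have e : ∀ i j, projElem x d r (.inl i) (.inl j) * projElem x d r (.inl j) (.inl i) =
        x j * (d i * x i) * d j - x j * r j i * d i - x i * r i j * d j + r i j * r j i :=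
      fun i j => by
        simp only [projElem]
        linear_combination (norm := noncomm_ring) x j * h.rd j i i - h.rx i j i * d j
    have e1 : ∑ i, ∑ j, x j * (d i * x i) * d j =
        eulerOp x d * eulerOp x d - eulerOp x d + m * eulerOp x d := by
      rw [Finset.sum_comm]
      simp only [← Finset.sum_mul, ← Finset.mul_sum, hdx, mul_add, add_mul, Finset.sum_add_distrib,
        hxEd]
      congr 1
      simp only [eulerOp, Finset.mul_sum]
      exact Finset.sum_congr rfl fun j _ => by rw [← mul_assoc, (Nat.cast_commute m (x j)).eq]
    have e2 : ∑ i, ∑ j, x i * r i j * d j = ∑ j, (∑ i, x i * r i j) * d j := by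
      rw [Finset.sum_comm]
      simp only [Finset.sum_mul]
    have e3 : ∑ i, ∑ j, x j * r j i * d i = ∑ j, (∑ i, x i * r i j) * d j := by
      simp only [Finset.sum_mul]
    simp only [e, Finset.sum_add_distrib, Finset.sum_sub_distrib, e1, e2, e3]
    noncomm_ring
  have h2 : ∑ i, projElem x d r (.inl i) (.inr ()) * projElem x d r (.inr ()) (.inl i) =
      - (eulerOp x d + m) * (eulerOp x d - ∑ i, r i i) + ∑ j, (∑ i, x i * r i j) * d j
        + ∑ i, r i i := by
    have e : ∀ i, projElem x d r (.inl i) (.inr ()) * projElem x d r (.inr ()) (.inl i) =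
        - (d i * x i) * (eulerOp x d - ∑ i, r i i) + (∑ k, x k * r k i) * d i + r i i :=
      fun i => by
        simp only [projElem]
        linear_combination (norm := noncomm_ring) h.d_s i i
    simp only [e, Finset.sum_add_distrib, ← Finset.sum_mul, Finset.sum_neg_distrib, hdx]
  have h3 : ∑ i, projElem x d r (.inr ()) (.inl i) * projElem x d r (.inl i) (.inr ()) =
      - (eulerOp x d * eulerOp x d - eulerOp x d) + eulerOp x d * (∑ i, r i i)
        + ∑ j, (∑ i, x i * r i j) * d j := by
    have e : ∀ i, projElem x d r (.inr ()) (.inl i) * projElem x d r (.inl i) (.inr ()) =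
        - (x i * eulerOp x d * d i) + x i * d i * (∑ i, r i i) + (∑ k, x k * r k i) * d i :=
      fun i => by
        simp only [projElem]
        linear_combination (norm := noncomm_ring) x i * h.tr_d i
    simp only [e, Finset.sum_add_distrib, ← Finset.sum_mul, Finset.sum_neg_distrib, hxEd]
    rfl
  -- In the sum of the four blocks the powers of the Euler operator and the terms `∑ x_i r_{ij} d_j`
  -- cancel. Only `r` survives, which is why the Casimir operator of symbols does not differentiate.
  have h4 := h.tr_euler
  simp only [Fintype.sum_sum_type, Finset.univ_unique, Finset.sum_singleton, PUnit.default_eq_unit,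
    Finset.sum_add_distrib, h1, h2, h3]
  simp only [projElem]
  generalize eulerOp x d = E at *
  generalize ∑ i, r i i = R at *
  linear_combination (norm := noncomm_ring) -h4

end WeylSystem
end Abstract

/-! ### Casimir operators and the Killing form of `sl(m + 1, ℝ)` -/

section Casimir

attribute [local instance] LieRing.ofAssociativeRing

/-- Under `M_n ≅ ℝ^n ⊗ ℝ^n` the map is `X ⊗ Yᵀ`, and traces multiply on tensor products. -/
theorem trace_mul_mul {n : Type*} [Fintype n] [DecidableEq n] (X Y : Matrix n n ℝ) :
    LinearMap.trace ℝ (Matrix n n ℝ) (LinearMap.mulLeft ℝ X ∘ₗ LinearMap.mulRight ℝ Y) =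
      X.trace * Y.trace := by
  rw [LinearMap.trace_eq_matrix_trace ℝ (Matrix.stdBasis ℝ n n)]
  simp only [Matrix.trace, Matrix.diag_apply, LinearMap.toMatrix_apply, Fintype.sum_prod_type,
    Matrix.stdBasis_eq_single, LinearMap.comp_apply, LinearMap.mulLeft_apply,
    LinearMap.mulRight_apply, Finset.sum_mul_sum]
  refine Finset.sum_congr rfl fun i _ => Finset.sum_congr rfl fun j _ => ?_
  have : ∀ M : Matrix n n ℝ, (Matrix.stdBasis ℝ n n).repr M (i, j) = M i j := fun M => by
    simp [Matrix.stdBasis]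
  rw [this]
  simp [Matrix.mul_apply, Matrix.single_apply, ite_and]

/-- The map `z ↦ [x, [y, z]]` makes sense on all matrices and takes values in `sl`, so its trace may
be computed on all matrices. Of its four terms the two mixed ones vanish because `x` and `y` are
traceless; each of the others contributes `(m + 1) tr(xy)`. -/
theorem killingForm_sl {m : ℕ} (x y : SL m) :
    killingForm ℝ (SL m) x y = 2 * (m + 1) * (x.1 * y.1).trace := by
  have hx : x.1.trace = 0 := x.2
  have hy : y.1.trace = 0 := y.2
  let f : Matrix (Fin m ⊕ Unit) (Fin m ⊕ Unit) ℝ →ₗ[ℝ] Matrix (Fin m ⊕ Unit) (Fin m ⊕ Unit) ℝ :=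
    LinearMap.mulLeft ℝ (x.1 * y.1) ∘ₗ LinearMap.mulRight ℝ 1
      - LinearMap.mulLeft ℝ x.1 ∘ₗ LinearMap.mulRight ℝ y.1
      - LinearMap.mulLeft ℝ y.1 ∘ₗ LinearMap.mulRight ℝ x.1
      + LinearMap.mulLeft ℝ 1 ∘ₗ LinearMap.mulRight ℝ (y.1 * x.1)
  have hf : ∀ z, f z = ⁅x.1, ⁅y.1, z⁆⁆ := fun z => by
    simp only [f, Ring.lie_def, LinearMap.add_apply, LinearMap.sub_apply, LinearMap.comp_apply,
      LinearMap.mulLeft_apply, LinearMap.mulRight_apply]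
    noncomm_ring
  have hmem : ∀ z, f z ∈ (LieAlgebra.SpecialLinear.sl (Fin m ⊕ Unit) ℝ).toSubmodule := fun z => by
    rw [hf]
    exact LieAlgebra.matrix_trace_commutator_zero (Fin m ⊕ Unit) ℝ x.1 ⁅y.1, z⁆
  have h1 := LinearMap.trace_restrict_eq_of_forall_mem
    (LieAlgebra.SpecialLinear.sl (Fin m ⊕ Unit) ℝ).toSubmodule f hmem
  have h2 : f.restrict (fun z _ => hmem z) =
      LieAlgebra.ad ℝ (SL m) x ∘ₗ LieAlgebra.ad ℝ (SL m) y := by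
    refine LinearMap.ext fun z => Subtype.ext ?_
    exact hf z.1
  rw [killingForm_apply_apply, ← h2]
  refine h1.trans ?_
  simp only [f, map_add, map_sub, trace_mul_mul, hx, hy, Matrix.trace_one, Matrix.trace_mul_comm y.1]
  simp
  ring

theorem sum_comm_four {α γ M : Type*} [Fintype α] [Fintype γ] [AddCommMonoid M]
    (f : α → γ → γ → γ → γ → M) : ∑ k, ∑ p, ∑ q, ∑ i, ∑ j, f k p q i j =
      ∑ p, ∑ q, ∑ i, ∑ j, ∑ k, f k p q i j := by
  rw [Finset.sum_comm]
  refine Finset.sum_congr rfl fun p _ => ?_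
  rw [Finset.sum_comm]
  refine Finset.sum_congr rfl fun q _ => ?_
  rw [Finset.sum_comm]
  exact Finset.sum_congr rfl fun i _ => Finset.sum_comm

/-- By `hT` the canonical tensor `∑ κ b ⊗ b` is a multiple of the flip minus a multiple of `1 ⊗ 1`;
the second part contributes nothing since `∑ e_{ii} = 0`. -/
theorem sum_smul_mul_eq {ι A : Type*} [Fintype ι] [DecidableEq ι] [Ring A] [Algebra ℝ A] {N : ℕ}
    (b : Fin N → Matrix ι ι ℝ) (κ : Fin N → Fin N → ℝ) (e : ι → ι → A) (he : ∑ i, e i i = 0)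
    (s t : ℝ) (hT : ∀ i j p q, ∑ k, ∑ l, κ k l * (b k p q * b l i j) =
      s * (if j = p then if i = q then 1 else 0 else 0)
        - t * (if i = j then if p = q then 1 else 0 else 0)) :
    ∑ k, ∑ l, κ k l • ((∑ i, ∑ j, b k i j • e i j) * (∑ i, ∑ j, b l i j • e i j)) =
      s • ∑ i, ∑ j, e i j * e j i := by
  have h6 : ∀ k l, κ k l • ((∑ i, ∑ j, b k i j • e i j) * (∑ i, ∑ j, b l i j • e i j)) =
      ∑ p, ∑ q, ∑ i, ∑ j, (κ k l * (b k p q * b l i j)) • (e p q * e i j) := by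
    intro k l
    simp only [Finset.sum_mul]
    simp only [Finset.mul_sum, Finset.smul_sum, smul_mul_assoc, mul_smul_comm, smul_smul,
      mul_comm (b l _ _)]
  have h7 : ∑ k, ∑ l, κ k l • ((∑ i, ∑ j, b k i j • e i j) * (∑ i, ∑ j, b l i j • e i j)) =
      ∑ p, ∑ q, ∑ i, ∑ j, (∑ k, ∑ l, κ k l * (b k p q * b l i j)) • (e p q * e i j) := by
    simp only [h6, Finset.sum_smul]
    rw [Finset.sum_congr rfl fun k _ => sum_comm_four _, sum_comm_four]
  have h8 : ∑ p, ∑ i, e p p * e i i = 0 := by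
    rw [← Finset.sum_mul_sum, he, zero_mul]
  rw [h7]
  simp only [hT, sub_smul, Finset.sum_sub_distrib, mul_ite, mul_one, mul_zero, ite_smul, zero_smul]
  have h9 : ∑ p, ∑ q, ∑ i, ∑ j, (if j = p then if i = q then s • (e p q * e i j) else 0 else 0) =
      s • ∑ i, ∑ j, e i j * e j i := by
    simp [Finset.smul_sum]
  have h10 : ∑ p, ∑ q, ∑ i, ∑ j, (if i = j then if p = q then t • (e p q * e i j) else 0 else 0) =
      0 := by
    simp [← Finset.smul_sum, h8]
  rw [h9, h10, sub_zero]

/-- The sum `∑ β(bᵢ) β(bᵢ*)` over Killing-dual bases, in terms of elementary matrices. -/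
theorem casimir_eq {m : ℕ} {W : Type*} [AddCommGroup W] [Module ℝ W]
    (β : SL m → Module.End ℝ W) (e : Fin m ⊕ Unit → Fin m ⊕ Unit → Module.End ℝ W)
    (hβ : ∀ h, β h = ∑ i, ∑ j, h.1 i j • e i j) (he : ∑ i, e i i = 0) :
    casimir β = (2 * (m + 1) : ℝ)⁻¹ • ∑ i, ∑ j, e i j * e j i := by
  have hn : (m + 1 : ℝ) ≠ 0 := by positivity
  let b := Module.finBasis ℝ (SL m)
  let K := Matrix.of fun i j => killingForm ℝ (SL m) (b i) (b j)
  let ι := Fin m ⊕ Unit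
  -- The traceless part of an elementary matrix. Pairing with it under the Killing form extracts the
  -- entry `(j, i)`, up to the factor `2(m + 1)`.
  let E : ι → ι → SL m := fun i j =>
    ⟨Matrix.single i j 1 - (if i = j then (m + 1 : ℝ)⁻¹ else 0) • (1 : Matrix ι ι ℝ), by
      change Matrix.traceLinearMap _ ℝ ℝ _ = 0
      simp only [Matrix.traceLinearMap_apply, Matrix.trace_sub, Matrix.trace_smul,
        Matrix.trace_one]
      split_ifs with h
      · subst h; simp [ι]; field_simp; simp
      · simp [Matrix.trace_single_eq_of_ne i j _ h]⟩
  have hE : ∀ (y : SL m) i j, killingForm ℝ (SL m) y (E i j) = 2 * (m + 1) * y.1 j i := by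
    intro y i j
    have hy : y.1.trace = 0 := y.2
    rw [killingForm_sl]
    simp only [E, mul_sub, Matrix.trace_sub, Matrix.trace_mul_single, Matrix.mul_smul,
      Matrix.trace_smul, Matrix.mul_one, hy]
    simp
  -- A kernel vector of the Gram matrix gives a `y` orthogonal to everything, in particular to all
  -- `E j i`, so all its entries vanish.
  have hK : IsUnit K.det := by
    rw [isUnit_iff_ne_zero]
    intro h0
    obtain ⟨v, hv, hv0⟩ := Matrix.exists_mulVec_eq_zero_iff.2 h0
    apply hv
    let y : SL m := ∑ j, v j • b j
    have h1 : ∀ z, killingForm ℝ (SL m) z y = 0 := by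
      intro z
      have : killingForm ℝ (SL m) z y = ∑ i, b.repr z i * (K.mulVec v) i := by
        conv_lhs => rw [← b.sum_repr z]
        simp only [y, map_sum, map_smul, LinearMap.sum_apply, LinearMap.smul_apply, smul_eq_mul,
          Matrix.mulVec, dotProduct, K, Matrix.of_apply, Finset.mul_sum]
        rw [Finset.sum_comm]
        refine Finset.sum_congr rfl fun i _ => Finset.sum_congr rfl fun j _ => ?_
        ring
      rw [this, hv0]
      simp
    have h2 : y = 0 := by
      refine Subtype.ext (Matrix.ext fun i j => ?_)
      have := hE y j i
      rw [LieModule.traceForm_comm, h1] at this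
      have h3 : (2 * (m + 1) : ℝ) ≠ 0 := by positivity
      exact (mul_eq_zero.1 this.symm).resolve_left h3
    exact funext fun i => Fintype.linearIndependent_iff.1 b.linearIndependent v h2 i
  -- The canonical tensor of `sl`, found by expanding `E j i` in the basis: its coordinates are
  -- `K⁻¹` applied to its Killing products with the `b k`.
  have hT : ∀ i j p q : ι, ∑ k, ∑ l, K⁻¹ k l * ((b k).1 p q * (b l).1 i j) =
      (2 * (m + 1) : ℝ)⁻¹ * (if j = p then if i = q then 1 else 0 else 0)
        - (2 * (m + 1) : ℝ)⁻¹ * (m + 1 : ℝ)⁻¹ * (if i = j then if p = q then 1 else 0 else 0) := by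
    intro i j p q
    have h1 : K.mulVec (fun l => b.repr (E j i) l) = fun k => 2 * (m + 1) * (b k).1 i j := by
      funext k
      rw [← hE]
      conv_rhs => rw [← b.sum_repr (E j i)]
      simp only [map_sum, map_smul, smul_eq_mul, Matrix.mulVec, dotProduct, K, Matrix.of_apply]
      exact Finset.sum_congr rfl fun l _ => mul_comm _ _
    have h2 : ∀ k, b.repr (E j i) k = ∑ l, K⁻¹ k l * (2 * (m + 1) * (b l).1 i j) := by
      intro k
      have := congrArg (K⁻¹.mulVec) h1
      rw [Matrix.mulVec_mulVec, Matrix.nonsing_inv_mul _ hK, Matrix.one_mulVec] at this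
      exact congrFun this k
    have h3 : (E j i).1 p q = ∑ k, b.repr (E j i) k * (b k).1 p q := by
      conv_lhs => rw [← b.sum_repr (E j i)]
      have : ((∑ k, b.repr (E j i) k • b k : SL m) : Matrix ι ι ℝ) =
          ∑ k, b.repr (E j i) k • (b k).1 :=
        map_sum (LieAlgebra.SpecialLinear.sl ι ℝ).toSubmodule.subtype _ _
      rw [this, Matrix.sum_apply]
      rfl
    have h4 : ∑ k, ∑ l, K⁻¹ k l * ((b k).1 p q * (b l).1 i j) =
        (2 * (m + 1) : ℝ)⁻¹ * (E j i).1 p q := by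
      rw [h3, Finset.mul_sum]
      refine Finset.sum_congr rfl fun k _ => ?_
      rw [h2, Finset.sum_mul, Finset.mul_sum]
      refine Finset.sum_congr rfl fun l _ => ?_
      field_simp
    rw [h4]
    have h5 : (E j i).1 p q = (if j = p then if i = q then 1 else 0 else 0) -
        (m + 1 : ℝ)⁻¹ * (if i = j then if p = q then 1 else 0 else 0) := by
      simp only [E, Matrix.sub_apply, Matrix.smul_apply, Matrix.single_apply, Matrix.one_apply,
        smul_eq_mul, @eq_comm _ j i, ite_and, ite_mul, zero_mul, mul_ite, mul_zero]
      congr 1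
      split_ifs <;> rfl
    rw [h5]
    ring
  have h5 : casimir β = ∑ k, ∑ l, K⁻¹ k l • (β (b k) * β (b l)) := rfl
  simp only [h5, hβ]
  exact sum_smul_mul_eq (fun k => (b k).1) (fun k l => K⁻¹ k l) e he _ _ hT

/-- The Leibniz rule for the commutator with `e k l` produces four sums, which cancel in pairs. -/
theorem IsGL.commute_casimir {A ι : Type*} [Ring A] [Fintype ι] [DecidableEq ι]
    {e : ι → ι → A} (he : IsGL e) (k l : ι) :
    (∑ i, ∑ j, e i j * e j i) * e k l = e k l * ∑ i, ∑ j, e i j * e j i := by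
  rw [← sub_eq_zero, ← neg_sub, neg_eq_zero]
  have : ∀ i j, e k l * (e i j * e j i) - (e i j * e j i) * e k l =
      ((if l = i then e k j else 0) - (if j = k then e i l else 0)) * e j i +
      e i j * ((if l = j then e k i else 0) - (if i = k then e j l else 0)) := by
    intro i j
    rw [← he, ← he]
    noncomm_ring
  simp only [Finset.sum_mul, Finset.mul_sum, ← Finset.sum_sub_distrib, this, sub_mul, mul_sub]
  simp [Finset.sum_add_distrib, ite_mul, mul_ite]

end Casimir

/-! ### Operators on polynomials -/

section PolyOps

variable {m : ℕ} {F G : Type*} [AddCommGroup F] [Module ℝ F] [AddCommGroup G] [Module ℝ G]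

/-- Multiplication by `ξ_i`. -/
def xiMul (i : Fin m) : Module.End ℝ (Poly m F) :=
  Finsupp.lmapDomain F ℝ fun α => α + Finsupp.single i 1

/-- The derivation `∂/∂ξ_i`. -/
def xiDer (i : Fin m) : Module.End ℝ (Poly m F) :=
  Finsupp.lsum ℝ fun α => (α i : ℝ) • Finsupp.lsingle (α - Finsupp.single i 1)

@[simp] theorem xiMul_single (i : Fin m) (α : Fin m →₀ ℕ) (c : F) :
    xiMul i (Finsupp.single α c) = Finsupp.single (α + Finsupp.single i 1) c := by
  simp [xiMul]

@[simp] theorem xiDer_single (i : Fin m) (α : Fin m →₀ ℕ) (c : F) :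
    xiDer i (Finsupp.single α c) =
      (α i : ℝ) • Finsupp.single (α - Finsupp.single i 1) c := by
  simp [xiDer]

@[simp] theorem coeffMap_single (u : F →ₗ[ℝ] G) (α : Fin m →₀ ℕ) (c : F) :
    coeffMap u (Finsupp.single α c) = Finsupp.single α (u c) := by
  simp [coeffMap]

@[simp] theorem coeffMap_apply (u : F →ₗ[ℝ] G) (P : Poly m F) (α : Fin m →₀ ℕ) :
    coeffMap u P α = u (P α) := rfl

theorem xiD_eq (i j : Fin m) : (xiD i j : Module.End ℝ (Poly m F)) = xiMul i * xiDer j :=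
  Finsupp.lhom_ext fun α c => by simp [xiD]

theorem coeffMap_xiMul (u : F →ₗ[ℝ] G) (i : Fin m) (P : Poly m F) :
    coeffMap u (xiMul i P) = xiMul i (coeffMap u P) := by
  have : coeffMap u ∘ₗ xiMul i = xiMul i ∘ₗ coeffMap u := Finsupp.lhom_ext fun α c => by simp
  exact LinearMap.congr_fun this P

theorem coeffMap_xiDer (u : F →ₗ[ℝ] G) (i : Fin m) (P : Poly m F) :
    coeffMap u (xiDer i P) = xiDer i (coeffMap u P) := by
  have : coeffMap u ∘ₗ xiDer i = xiDer i ∘ₗ coeffMap u := Finsupp.lhom_ext fun α c => by simp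
  exact LinearMap.congr_fun this P

theorem coeffMap_add (u v : F →ₗ[ℝ] G) :
    (coeffMap (u + v) : Poly m F →ₗ[ℝ] Poly m G) = coeffMap u + coeffMap v :=
  LinearMap.ext fun _ => Finsupp.ext fun _ => rfl

theorem coeffMap_sub (u v : F →ₗ[ℝ] G) :
    (coeffMap (u - v) : Poly m F →ₗ[ℝ] Poly m G) = coeffMap u - coeffMap v :=
  LinearMap.ext fun _ => Finsupp.ext fun _ => rfl

theorem coeffMap_smul (a : ℝ) (u : F →ₗ[ℝ] G) :
    (coeffMap (a • u) : Poly m F →ₗ[ℝ] Poly m G) = a • coeffMap u :=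
  LinearMap.ext fun _ => Finsupp.ext fun _ => rfl

theorem coeffMap_sum {ι : Type*} (s : Finset ι) (u : ι → F →ₗ[ℝ] G) :
    (coeffMap (∑ i ∈ s, u i) : Poly m F →ₗ[ℝ] Poly m G) = ∑ i ∈ s, coeffMap (u i) :=
  LinearMap.ext fun P => Finsupp.ext fun α => by
    simp [LinearMap.sum_apply, Finsupp.finsetSum_apply]

theorem coeffMap_mul (u v : Module.End ℝ F) :
    (coeffMap (u * v) : Module.End ℝ (Poly m F)) = coeffMap u * coeffMap v :=
  LinearMap.ext fun _ => Finsupp.ext fun _ => rfl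

theorem coeffMap_one : (coeffMap (1 : Module.End ℝ F) : Module.End ℝ (Poly m F)) = 1 :=
  LinearMap.ext fun _ => Finsupp.ext fun _ => rfl

theorem xiMul_comm (i j : Fin m) (P : Poly m F) : xiMul i (xiMul j P) = xiMul j (xiMul i P) := by
  have : (xiMul i ∘ₗ xiMul j : Module.End ℝ (Poly m F)) = xiMul j ∘ₗ xiMul i :=
    Finsupp.lhom_ext fun α c => by simp [add_right_comm]
  exact LinearMap.congr_fun this P

theorem xiDer_comm (i j : Fin m) (P : Poly m F) : xiDer i (xiDer j P) = xiDer j (xiDer i P) := by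
  have : (xiDer i ∘ₗ xiDer j : Module.End ℝ (Poly m F)) = xiDer j ∘ₗ xiDer i := by
    refine Finsupp.lhom_ext fun α c => ?_
    rcases eq_or_ne i j with rfl | hij
    · rfl
    · simp [smul_smul, tsub_right_comm (a := α), hij, hij.symm, mul_comm]
  exact LinearMap.congr_fun this P

theorem xiDer_xiMul (i j : Fin m) (P : Poly m F) :
    xiDer i (xiMul j P) = xiMul j (xiDer i P) + if i = j then P else 0 := by
  have : (xiDer i ∘ₗ xiMul j : Module.End ℝ (Poly m F)) =
      xiMul j ∘ₗ xiDer i + if i = j then LinearMap.id else 0 := by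
    refine Finsupp.lhom_ext fun α c => ?_
    rcases eq_or_ne i j with rfl | hij
    -- When `α i = 0` the truncated difference `α - single i 1` is `α` itself, but it comes with the
    -- coefficient `α i = 0`.
    · rcases Nat.eq_zero_or_pos (α i) with h | h
      · simp [h]
      · have h1 : Finsupp.single i 1 ≤ α := by simpa [Finsupp.single_le_iff, Nat.one_le_iff_ne_zero, Nat.pos_iff_ne_zero] using h
        simp [tsub_add_cancel_of_le h1, add_smul]
    · rcases Nat.eq_zero_or_pos (α i) with h | h
      · simp [h, hij]
      · have h1 : Finsupp.single i 1 ≤ α := by simpa [Finsupp.single_le_iff, Nat.one_le_iff_ne_zero, Nat.pos_iff_ne_zero] using h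
        simp [hij, tsub_add_eq_add_tsub h1]
  rw [← LinearMap.comp_apply, this]
  split_ifs <;> simp

theorem xiDer_apply (i : Fin m) (P : Poly m F) (α : Fin m →₀ ℕ) :
    xiDer i P α = (α i + 1 : ℝ) • P (α + Finsupp.single i 1) := by
  have : Finsupp.lapply α ∘ₗ (xiDer i : Module.End ℝ (Poly m F)) =
      (α i + 1 : ℝ) • Finsupp.lapply (α + Finsupp.single i 1) := by
    refine Finsupp.lhom_ext fun β c => ?_
    simp only [LinearMap.comp_apply, xiDer_single, Finsupp.lapply_apply, LinearMap.smul_apply,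
      Finsupp.smul_apply, Finsupp.single_apply]
    by_cases hβ : β = α + Finsupp.single i 1
    · subst hβ
      simp
    · rw [if_neg hβ]
      rcases Nat.eq_zero_or_pos (β i) with h | h
      · simp [h]
      · have h1 : Finsupp.single i 1 ≤ β := by simpa [Finsupp.single_le_iff, Nat.one_le_iff_ne_zero, Nat.pos_iff_ne_zero] using h
        rw [if_neg]
        · simp
        · rintro rfl
          exact hβ (tsub_add_cancel_of_le h1).symm
  exact LinearMap.congr_fun this P

theorem xiMul_apply_add (i : Fin m) (P : Poly m F) (α : Fin m →₀ ℕ) :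
    xiMul i P (α + Finsupp.single i 1) = P α :=
  Finsupp.mapDomain_apply (add_left_injective _) _ _

theorem xiMul_apply_of_eq_zero (i : Fin m) (P : Poly m F) (α : Fin m →₀ ℕ) (h : α i = 0) :
    xiMul i P α = 0 := by
  refine Finsupp.mapDomain_of_notMem_range _ _ ?_
  rintro ⟨β, rfl⟩
  simp at h

theorem mem_homogeneous_iff {k : ℕ} {P : Poly m F} :
    P ∈ homogeneous m F k ↔ ∀ α : Fin m →₀ ℕ, α.degree ≠ k → P α = 0 := by
  rw [homogeneous, Finsupp.mem_supported']
  rfl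

theorem xiMul_mem_homogeneous (i : Fin m) {k : ℕ} {P : Poly m F} (hP : P ∈ homogeneous m F k) :
    xiMul i P ∈ homogeneous m F (k + 1) := by
  rw [mem_homogeneous_iff] at *
  intro α hα
  rcases Nat.eq_zero_or_pos (α i) with h | h
  · exact xiMul_apply_of_eq_zero i P α h
  · have h1 : Finsupp.single i 1 ≤ α := by
      simpa [Finsupp.single_le_iff, Nat.one_le_iff_ne_zero, Nat.pos_iff_ne_zero] using h
    obtain ⟨β, rfl⟩ : ∃ β, α = β + Finsupp.single i 1 := ⟨_, (tsub_add_cancel_of_le h1).symm⟩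
    rw [xiMul_apply_add]
    refine hP _ fun h => hα ?_
    simp [h]

theorem xiDer_mem_homogeneous (i : Fin m) {k : ℕ} {P : Poly m F}
    (hP : P ∈ homogeneous m F (k + 1)) : xiDer i P ∈ homogeneous m F k := by
  rw [mem_homogeneous_iff] at *
  intro α hα
  rw [xiDer_apply, hP _ (by simpa using hα), smul_zero]

theorem xiDer_eq_zero (i : Fin m) {P : Poly m F} (hP : P ∈ homogeneous m F 0) :
    xiDer i P = 0 := by
  rw [mem_homogeneous_iff] at hP
  refine Finsupp.ext fun α => ?_
  rw [xiDer_apply, hP _ (by simp), smul_zero, Finsupp.zero_apply]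

theorem coeffMap_mem_homogeneous (u : F →ₗ[ℝ] G) {k : ℕ} {P : Poly m F}
    (hP : P ∈ homogeneous m F k) : coeffMap u P ∈ homogeneous m G k := by
  rw [mem_homogeneous_iff] at *
  intro α hα
  rw [coeffMap_apply, hP α hα, map_zero]

end PolyOps

/-! ### Operators on smooth functions -/

section SmoothOps

variable {m : ℕ} {F G : Type*} [NormedAddCommGroup F] [NormedSpace ℝ F]
  [NormedAddCommGroup G] [NormedSpace ℝ G]

/-- Composition with a constant linear map. -/
def postComp : (F →L[ℝ] G) →ₗ[ℝ] SmoothFn m F →ₗ[ℝ] SmoothFn m G :=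
  LinearMap.mk₂ ℝ (fun u f => ⟨fun x => u (f.1 x), u.contDiff.comp (contDiff_of f)⟩)
    (fun _ _ _ => rfl) (fun _ _ _ => rfl)
    (fun u f g => Subtype.ext (funext fun x => map_add u (f.1 x) (g.1 x)))
    (fun a u f => Subtype.ext (funext fun x => map_smul u a (f.1 x)))

/-- The coordinate function `x_i`. -/
def coordFn (i : Fin m) : SmoothFn m ℝ := ⟨fun x => x i, show ContDiff ℝ ∞ _ from contDiff_apply ℝ ℝ i⟩

theorem differentiableAt_of (f : SmoothFn m F) (x : Fin m → ℝ) : DifferentiableAt ℝ f.1 x :=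
  (contDiff_of f).differentiable (by simp) x

theorem partialD_mulFn (i : Fin m) (g : SmoothFn m ℝ) (f : SmoothFn m F) :
    partialD i (mulFn g f) = mulFn g (partialD i f) + mulFn (partialD i g) f := by
  refine Subtype.ext (funext fun x => ?_)
  change fderiv ℝ (fun y => g.1 y • f.1 y) x (Pi.single i 1) = _
  rw [fderiv_fun_smul (differentiableAt_of g x) (differentiableAt_of f x)]
  rfl

theorem partialD_coordFn (i j : Fin m) (x : Fin m → ℝ) :
    (partialD i (coordFn j)).1 x = if i = j then 1 else 0 := by
  change fderiv ℝ (ContinuousLinearMap.proj (R := ℝ) (φ := fun _ : Fin m => ℝ) j) x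
    (Pi.single i 1) = _
  rw [(ContinuousLinearMap.proj (R := ℝ) (φ := fun _ : Fin m => ℝ) j).hasFDerivAt.fderiv]
  simp [Pi.single_apply, eq_comm]

theorem partialD_comm (i j : Fin m) (f : SmoothFn m F) :
    partialD i (partialD j f) = partialD j (partialD i f) := by
  refine Subtype.ext (funext fun x => ?_)
  have h1 : DifferentiableAt ℝ (fderiv ℝ f.1) x :=
    ((contDiff_of f).fderiv_right (m := ∞) le_rfl).differentiable (by simp) x
  have h2 : ∀ i j : Fin m, (partialD i (partialD j f)).1 x =
      fderiv ℝ (fderiv ℝ f.1) x (Pi.single i 1) (Pi.single j 1) := by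
    intro i j
    change fderiv ℝ (fun y => fderiv ℝ f.1 y (Pi.single j 1)) x (Pi.single i 1) = _
    rw [fderiv_clm_apply h1 (differentiableAt_const _)]
    simp
  rw [h2, h2]
  exact ((contDiff_of f).contDiffAt.isSymmSndFDerivAt (by
    rw [minSmoothness_of_isRCLikeNormedField]
    exact WithTop.coe_le_coe.2 (le_top : (2 : ℕ∞) ≤ ⊤))) _ _

theorem mulFn_comm (g h : SmoothFn m ℝ) (f : SmoothFn m F) :
    mulFn g (mulFn h f) = mulFn h (mulFn g f) :=
  Subtype.ext (funext fun _ => smul_comm _ _ _)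

theorem postComp_mulFn (u : F →L[ℝ] G) (g : SmoothFn m ℝ) (f : SmoothFn m F) :
    postComp u (mulFn g f) = mulFn g (postComp u f) :=
  Subtype.ext (funext fun _ => map_smul u _ _)

theorem partialD_postComp (u : F →L[ℝ] G) (i : Fin m) (f : SmoothFn m F) :
    partialD i (postComp u f) = postComp u (partialD i f) := by
  refine Subtype.ext (funext fun x => ?_)
  change fderiv ℝ (u ∘ f.1) x (Pi.single i 1) = _
  rw [fderiv_comp x u.differentiableAt (differentiableAt_of f x), u.fderiv]
  rfl

end SmoothOps

/-! ### Lie derivatives along projective vector fields -/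

section Abstract

variable {m : ℕ} {A : Type*} [Ring A] [Algebra ℝ A]

/-- The components of the projective vector field of the matrix `M`. -/
def fieldElem (x : Fin m → A) (M : Matrix (Fin m ⊕ Unit) (Fin m ⊕ Unit) ℝ) (i : Fin m) : A :=
  - M (.inl i) (.inr ()) • (1 : A) - (∑ j, M (.inl i) (.inl j) • x j - M (.inr ()) (.inr ()) • x i) +
    ∑ j, M (.inr ()) (.inl j) • (x j * x i)

/-- The Jacobian of the projective vector field of the matrix `M`. -/
def jacobianElem (x : Fin m → A) (M : Matrix (Fin m ⊕ Unit) (Fin m ⊕ Unit) ℝ) (i j : Fin m) : A :=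
  - M (.inl i) (.inl j) • (1 : A) + M (.inr ()) (.inl j) • x i +
    if i = j then M (.inr ()) (.inr ()) • (1 : A) + ∑ k, M (.inr ()) (.inl k) • x k else 0

/-- This recognizes the Lie derivative `X - r(DX)` in the realization: the fields and their
Jacobians are collected from the blocks of `M`. -/
theorem sum_smul_projElem (x d : Fin m → A) (r : Fin m → Fin m → A)
    (M : Matrix (Fin m ⊕ Unit) (Fin m ⊕ Unit) ℝ) :
    ∑ i, ∑ j, M i j • projElem x d r i j =
      ∑ i, fieldElem x M i * d i - ∑ i, ∑ j, jacobianElem x M i j * r i j := by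
  have h1 : ∑ i, fieldElem x M i * d i = - ∑ i, M (.inl i) (.inr ()) • d i -
      ∑ i, ∑ j, M (.inl i) (.inl j) • (x j * d i) + M (.inr ()) (.inr ()) • eulerOp x d +
      ∑ j, M (.inr ()) (.inl j) • (x j * eulerOp x d) := by
    simp only [fieldElem, eulerOp, Finset.mul_sum, Finset.smul_sum, add_mul, sub_mul, Finset.sum_mul,
      Finset.sum_add_distrib, Finset.sum_sub_distrib, smul_mul_assoc, one_mul, neg_smul, neg_mul,
      Finset.sum_neg_distrib, mul_assoc]
    rw [Finset.sum_comm (f := fun i j => M (.inr ()) (.inl j) • (x j * (x i * d i)))]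
    abel
  have h2 : ∑ i, ∑ j, jacobianElem x M i j * r i j = - ∑ i, ∑ j, M (.inl i) (.inl j) • r i j +
      ∑ j, M (.inr ()) (.inl j) • ∑ i, x i * r i j + M (.inr ()) (.inr ()) • ∑ i, r i i +
      ∑ k, M (.inr ()) (.inl k) • (x k * ∑ i, r i i) := by
    simp only [jacobianElem, Finset.mul_sum, Finset.smul_sum, add_mul, ite_mul, zero_mul,
      Finset.sum_mul, Finset.sum_add_distrib, smul_mul_assoc, one_mul, neg_smul, neg_mul,
      Finset.sum_neg_distrib, Finset.sum_ite_eq, Finset.mem_univ, if_true]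
    rw [Finset.sum_comm (f := fun i j => M (.inr ()) (.inl j) • (x i * r i j)),
      Finset.sum_comm (f := fun k i => M (.inr ()) (.inl k) • (x k * r i i))]
    abel
  rw [h1, h2]
  simp only [Fintype.sum_sum_type, Finset.univ_unique, Finset.sum_singleton, projElem,
    PUnit.default_eq_unit, smul_add, smul_sub, smul_neg, Finset.sum_add_distrib, mul_sub,
    Finset.sum_sub_distrib, Finset.sum_neg_distrib]
  abel

end Abstract

/-! ### Projective Lie derivatives of vector-valued functions. -/

section Functions

variable {m : ℕ} {F : Type*} [NormedAddCommGroup F] [NormedSpace ℝ F]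

/-- Multiplication by the coordinate function `x_i`. -/
def coordOp (i : Fin m) : Module.End ℝ (SmoothFn m F) := mulFn (coordFn i)

/-- The elementary matrices, acting on the values of functions. -/
def elemOp (r : Matrix (Fin m) (Fin m) ℝ →ₗ[ℝ] (F →L[ℝ] F)) (i j : Fin m) :
    Module.End ℝ (SmoothFn m F) := postComp (r (Matrix.single i j 1))

theorem weylSystem_smoothFn (r : Matrix (Fin m) (Fin m) ℝ →ₗ[ℝ] (F →L[ℝ] F)) :
    WeylSystem (coordOp (F := F)) partialD (elemOp r) where
  xx i j := LinearMap.ext fun f => mulFn_comm _ _ f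
  dd i j := LinearMap.ext fun f => partialD_comm _ _ f
  dx i j := LinearMap.ext fun f => by
    refine (partialD_mulFn i (coordFn j) f).trans (congrArg _ ?_)
    refine Subtype.ext (funext fun x => ?_)
    change (partialD i (coordFn j)).1 x • f.1 x = _
    rw [partialD_coordFn]
    split_ifs <;> simp
  rx i j k := LinearMap.ext fun f => postComp_mulFn _ _ f
  rd i j k := LinearMap.ext fun f => (partialD_postComp _ _ f).symm

theorem isGL_elemOp {r : Matrix (Fin m) (Fin m) ℝ →ₗ[ℝ] (F →L[ℝ] F)}
    (hr : ∀ A B, r (A * B - B * A) = r A * r B - r B * r A) : IsGL (elemOp r) := by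
  intro i j k l
  have h1 : elemOp r i j * elemOp r k l - elemOp r k l * elemOp r i j =
      postComp (r (Matrix.single i j 1 * Matrix.single k l 1 -
        Matrix.single k l 1 * Matrix.single i j 1)) := by
    rw [hr]
    rfl
  have h2 : ∀ i j k l : Fin m, (Matrix.single i j 1 * Matrix.single k l 1 :
      Matrix (Fin m) (Fin m) ℝ) = if j = k then Matrix.single i l 1 else 0 := by
    intro i j k l
    split_ifs with h
    · subst h; simp
    · simp [h]
  rw [h1, h2, h2, map_sub, map_sub]
  congr 1 <;> split_ifs <;> simp [elemOp]

/-- Evaluation of a function at a point. -/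
def evalAt (x : Fin m → ℝ) : SmoothFn m F →ₗ[ℝ] F :=
  LinearMap.proj x ∘ₗ (SmoothFn m F).subtype

theorem smoothFn_ext {f g : SmoothFn m F} (h : ∀ x, evalAt x f = evalAt x g) : f = g :=
  Subtype.ext (funext h)

theorem evalAt_mulFn (x : Fin m → ℝ) (g : SmoothFn m ℝ) (f : SmoothFn m F) :
    evalAt x (mulFn g f) = g.1 x • evalAt x f := rfl

theorem evalAt_coordOp (x : Fin m → ℝ) (i : Fin m) (f : SmoothFn m F) :
    evalAt x (coordOp i f) = x i • evalAt x f := rfl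

theorem evalAt_fieldElem (h : SL m) (x : Fin m → ℝ) (i : Fin m) (f : SmoothFn m F) :
    evalAt x (fieldElem coordOp h.1 i f) = (projField h).1 x i • evalAt x f := by
  simp only [fieldElem, LinearMap.add_apply, LinearMap.sub_apply, LinearMap.smul_apply,
    LinearMap.sum_apply, Module.End.mul_apply, Module.End.one_apply, map_add,
    map_sub, map_neg, map_smul, map_sum, evalAt_coordOp, projField, add_smul, sub_smul, neg_smul,
    Finset.sum_smul, smul_smul, Finset.sum_mul]
  congr 1
  refine Finset.sum_congr rfl fun j _ => ?_
  rw [mul_assoc]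

theorem jacobian_projField (h : SL m) (x : Fin m → ℝ) (i j : Fin m) :
    (jacobian (projField h) i j).1 x = - h.1 (.inl i) (.inl j) + h.1 (.inr ()) (.inl j) * x i +
      if i = j then h.1 (.inr ()) (.inr ()) + ∑ k, h.1 (.inr ()) (.inl k) * x k else 0 := by
  have hc : ∀ k, HasFDerivAt (fun y : Fin m → ℝ => y k)
      (ContinuousLinearMap.proj (R := ℝ) (φ := fun _ : Fin m => ℝ) k) x := fun k =>
    (ContinuousLinearMap.proj (R := ℝ) (φ := fun _ : Fin m => ℝ) k).hasFDerivAt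
  have h1 := fun i => ((((hasFDerivAt_const (-h.1 (.inl i) (.inr ())) x).sub
    ((HasFDerivAt.fun_sum fun j (_ : j ∈ Finset.univ) =>
      (hc j).const_mul (h.1 (.inl i) (.inl j))).sub
      ((hc i).const_mul (h.1 (.inr ()) (.inr ()))))).add
    ((HasFDerivAt.fun_sum fun j (_ : j ∈ Finset.univ) =>
      (hc j).const_mul (h.1 (.inr ()) (.inl j))).mul (hc i))))
  change fderiv ℝ (projField h).1 x (Pi.single j 1) i = _
  rw [(hasFDerivAt_pi.2 h1 : HasFDerivAt (projField h).1 _ x).fderiv]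
  simp [Pi.single_apply]
  split_ifs <;> ring

theorem evalAt_jacobianElem (h : SL m) (x : Fin m → ℝ) (i j : Fin m) (f : SmoothFn m F) :
    evalAt x (jacobianElem coordOp h.1 i j f) =
      (jacobian (projField h) i j).1 x • evalAt x f := by
  rw [jacobian_projField]
  split_ifs with hij
  · simp only [jacobianElem, if_pos hij, LinearMap.add_apply, LinearMap.smul_apply,
      LinearMap.sum_apply, Module.End.one_apply, map_add,
      map_neg, map_smul, map_sum, evalAt_coordOp, add_smul, neg_smul, Finset.sum_smul, smul_smul]
  · simp only [jacobianElem, if_neg hij, LinearMap.add_apply, LinearMap.smul_apply,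
      Module.End.one_apply, map_add, LinearMap.zero_apply, map_zero,
      map_neg, map_smul, evalAt_coordOp, add_smul, neg_smul, smul_smul, zero_smul]

theorem jacobianElem_eq (h : SL m) (i j : Fin m) :
    (jacobianElem coordOp h.1 i j : Module.End ℝ (SmoothFn m F)) =
      mulFn (jacobian (projField h) i j) :=
  LinearMap.ext fun f => smoothFn_ext fun x => by
    rw [evalAt_jacobianElem, evalAt_mulFn]

theorem fderiv_eq_sum (f : SmoothFn m F) (x v : Fin m → ℝ) :
    fderiv ℝ f.1 x v = ∑ i, v i • (partialD i f).1 x := by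
  conv_lhs => rw [← Finset.univ_sum_single v]
  rw [map_sum]
  refine Finset.sum_congr rfl fun i _ => ?_
  rw [show (Pi.single i (v i) : Fin m → ℝ) = v i • Pi.single i 1 by simp [← Pi.single_smul],
    map_smul]
  rfl

/-- The Lie derivative along a projective vector field. -/
theorem lieDeriv_projField (r : Matrix (Fin m) (Fin m) ℝ →ₗ[ℝ] (F →L[ℝ] F)) (h : SL m) :
    lieDeriv r (projField h) = ∑ i, ∑ j, h.1 i j • projElem coordOp partialD (elemOp r) i j := by
  rw [sum_smul_projElem]
  refine LinearMap.ext fun f => smoothFn_ext fun x => ?_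
  simp only [LinearMap.sub_apply, LinearMap.sum_apply, Module.End.mul_apply, map_sub, map_sum,
    evalAt_fieldElem, evalAt_jacobianElem]
  change fderiv ℝ f.1 x ((projField h).1 x) - r (jacobianMatrix (projField h) x) (f.1 x) = _
  rw [fderiv_eq_sum]
  congr 1
  conv_lhs => rw [Matrix.matrix_eq_sum_single (jacobianMatrix (projField h) x)]
  simp only [map_sum, sum_apply]
  refine Finset.sum_congr rfl fun i _ => Finset.sum_congr rfl fun j _ => ?_
  rw [show Matrix.single i j (jacobianMatrix (projField h) x i j) =
    jacobianMatrix (projField h) x i j • Matrix.single i j 1 by simp [Matrix.smul_single], map_smul]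
  rfl

end Functions

/-! ### The standard ordering as an intertwining operator -/

section StandardOrdering

variable {m : ℕ} {V₁ V₂ : Type*}
  [NormedAddCommGroup V₁] [NormedSpace ℝ V₁] [FiniteDimensional ℝ V₁]
  [NormedAddCommGroup V₂] [NormedSpace ℝ V₂] [FiniteDimensional ℝ V₂]

set_option linter.unusedSectionVars false

scoped instance : AddCommGroup (Operator m V₁ V₂) := LinearMap.addCommGroup

scoped instance : Ring (Module.End ℝ (Operator m V₁ V₂)) := Module.End.instRing

scoped instance : Module ℝ (Module.End ℝ (Operator m V₁ V₂)) := LinearMap.module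

scoped instance : Algebra ℝ (Module.End ℝ (Operator m V₁ V₂)) := Module.End.instAlgebra ℝ ℝ _

scoped instance : SMul ℝ (Module.End ℝ (Operator m V₁ V₂)) := LinearMap.instSMul

scoped instance : Module ℝ (Symbol m V₁ V₂) := Finsupp.module _ _

scoped instance : Ring (Module.End ℝ (Symbol m V₁ V₂)) := Module.End.instRing

scoped instance : Algebra ℝ (Module.End ℝ (Symbol m V₁ V₂)) := Module.End.instAlgebra ℝ ℝ _

scoped instance : SMul ℝ (Module.End ℝ (Symbol m V₁ V₂)) := LinearMap.instSMul

scoped instance : Module ℝ (Module.End ℝ (Symbol m V₁ V₂)) := LinearMap.module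

/-- The factors of `partialPow` come in a fixed order; commutativity lets an additional factor move
to the end. -/
theorem prod_ofFn_pow_add_single {M : Type*} [Monoid M] {n : ℕ} (D : Fin n → M)
    (hD : ∀ i j, D i * D j = D j * D i) (α : Fin n → ℕ) (j : Fin n) :
    (List.ofFn fun i => D i ^ (α i + if i = j then 1 else 0)).prod =
      (List.ofFn fun i => D i ^ α i).prod * D j := by
  induction n with
  | zero => exact j.elim0
  | succ n ih =>
    simp only [List.ofFn_succ, List.prod_cons]
    refine Fin.cases ?_ (fun k => ?_) j
    · have hc : Commute (D 0) (List.ofFn fun i : Fin n => D i.succ ^ α i.succ).prod := by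
        refine Commute.list_prod_right _ _ fun y hy => ?_
        obtain ⟨i, rfl⟩ := (List.mem_ofFn' _ _).1 hy
        exact (show Commute (D 0) (D i.succ) from hD _ _).pow_right _
      simp [pow_succ, mul_assoc, hc.eq, Fin.succ_ne_zero]
    · have := ih (fun i => D i.succ) (fun i j => hD _ _) (fun i => α i.succ) k
      simp [mul_assoc, ← this, (Fin.succ_ne_zero k).symm]

theorem finsupp_induction {p : (Fin m →₀ ℕ) → Prop} (h0 : p 0)
    (h1 : ∀ α i, p α → p (α + Finsupp.single i 1)) (α : Fin m →₀ ℕ) : p α := by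
  induction h : α.degree generalizing α with
  | zero => rwa [(Finsupp.degree_eq_zero_iff α).1 h]
  | succ n ih =>
    have hα : α ≠ 0 := by
      rintro rfl
      simp at h
    obtain ⟨i, hi⟩ := Finsupp.ne_iff.1 hα
    have hle : Finsupp.single i 1 ≤ α := by
      simpa [Finsupp.single_le_iff, Nat.one_le_iff_ne_zero] using hi
    rw [← tsub_add_cancel_of_le hle] at h ⊢
    refine h1 _ _ (ih _ ?_)
    simpa using h

theorem partialPow_zero {F : Type*} [NormedAddCommGroup F] [NormedSpace ℝ F] :
    (partialPow 0 : Module.End ℝ (SmoothFn m F)) = 1 := by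
  simp [partialPow, List.ofFn_const]

theorem partialPow_add_single {F : Type*} [NormedAddCommGroup F] [NormedSpace ℝ F]
    (α : Fin m →₀ ℕ) (j : Fin m) :
    (partialPow (α + Finsupp.single j 1) : Module.End ℝ (SmoothFn m F)) =
      partialPow α * partialD j := by
  have := prod_ofFn_pow_add_single (fun i => (partialD i : Module.End ℝ (SmoothFn m F)))
    (fun i j => LinearMap.ext fun f => partialD_comm i j f) α j
  rw [partialPow, partialPow, ← this]
  simp [Finsupp.single_apply, eq_comm]

theorem partialPow_partialD {F : Type*} [NormedAddCommGroup F] [NormedSpace ℝ F]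
    (α : Fin m →₀ ℕ) (j : Fin m) (f : SmoothFn m F) :
    partialPow α (partialD j f) = partialD j (partialPow α f) := by
  induction α using finsupp_induction generalizing f with
  | h0 => simp [partialPow_zero]
  | h1 α i ih =>
    simp only [partialPow_add_single, Module.End.mul_apply]
    rw [partialD_comm, ih]

theorem partialPow_postComp {F G : Type*} [NormedAddCommGroup F] [NormedSpace ℝ F]
    [NormedAddCommGroup G] [NormedSpace ℝ G] (u : F →L[ℝ] G)
    (α : Fin m →₀ ℕ) (f : SmoothFn m F) :
    partialPow α (postComp u f) = postComp u (partialPow α f) := by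
  induction α using finsupp_induction generalizing f with
  | h0 => simp [partialPow_zero]
  | h1 α i ih =>
    simp only [partialPow_add_single, Module.End.mul_apply]
    rw [partialD_postComp, ih]

/-- The commutator `[∂^α, x_i] = α_i ∂^{α - ε_i}`, which turns into `∂/∂ξ_i` on the side of symbols.
-/
theorem partialPow_coordOp {F : Type*} [NormedAddCommGroup F] [NormedSpace ℝ F]
    (α : Fin m →₀ ℕ) (i : Fin m) (f : SmoothFn m F) :
    partialPow α (coordOp i f) =
      coordOp i (partialPow α f) + (α i : ℝ) • partialPow (α - Finsupp.single i 1) f := by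
  have hdx : ∀ (j : Fin m) (f : SmoothFn m F), partialD j (coordOp i f) =
      coordOp i (partialD j f) + if j = i then f else 0 := fun j f => by
    have := LinearMap.congr_fun ((weylSystem_smoothFn (m := m) (F := F) 0).dx j i) f
    refine this.trans ?_
    simp only [LinearMap.add_apply, Module.End.mul_apply]
    split_ifs <;> simp
  induction α using finsupp_induction generalizing f with
  | h0 => simp [partialPow_zero]
  | h1 α j ih =>
    simp only [partialPow_add_single, Module.End.mul_apply]
    rw [hdx, map_add, ih]
    rcases eq_or_ne j i with rfl | hij
    · rw [if_pos rfl]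
      rcases Nat.eq_zero_or_pos (α j) with h | h
      · simp [h]
      · have hle : Finsupp.single j 1 ≤ α := by
          simpa [Finsupp.single_le_iff, Nat.one_le_iff_ne_zero, Nat.pos_iff_ne_zero] using h
        rw [add_tsub_cancel_right, ← Module.End.mul_apply (partialPow (α - _)),
          ← partialPow_add_single, tsub_add_cancel_of_le hle]
        simp [add_smul, add_assoc]
    · rw [if_neg hij]
      rcases Nat.eq_zero_or_pos (α i) with h | h
      · simp [h, hij]
      · have hle : Finsupp.single i 1 ≤ α := by
          simpa [Finsupp.single_le_iff, Nat.one_le_iff_ne_zero, Nat.pos_iff_ne_zero] using h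
        rw [← tsub_add_eq_add_tsub hle, partialPow_add_single]
        simp [hij]

/-- Composition on the left with an endomorphism of `V₂`. -/
def compLeft (u : V₂ →L[ℝ] V₂) : (V₁ →L[ℝ] V₂) →L[ℝ] (V₁ →L[ℝ] V₂) :=
  ContinuousLinearMap.compL ℝ V₁ V₂ V₂ u

/-- Composition on the right with an endomorphism of `V₁`. -/
def compRight (u : V₁ →L[ℝ] V₁) : (V₁ →L[ℝ] V₂) →L[ℝ] (V₁ →L[ℝ] V₂) :=
  (ContinuousLinearMap.compL ℝ V₁ V₁ V₂).flip u

theorem affineQuantization_single (α : Fin m →₀ ℕ) (c : SmoothFn m (V₁ →L[ℝ] V₂))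
    (f : SmoothFn m V₁) :
    affineQuantization (Finsupp.single α c) f = applyFn c (partialPow α f) := by
  simp [affineQuantization]

/-- Left multiplication of operators. -/
def leftOp : Module.End ℝ (SmoothFn m V₂) →ₗ[ℝ] Module.End ℝ (Operator m V₁ V₂) :=
  LinearMap.llcomp ℝ _ _ _

/-- Right multiplication of operators. -/
def rightOp : Module.End ℝ (SmoothFn m V₁) →ₗ[ℝ] Module.End ℝ (Operator m V₁ V₂) :=
  (LinearMap.llcomp ℝ _ _ _).flip

theorem leftOp_mul (a b : Module.End ℝ (SmoothFn m V₂)) :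
    (leftOp (a * b) : Module.End ℝ (Operator m V₁ V₂)) = leftOp a * leftOp b := rfl

theorem rightOp_mul (a b : Module.End ℝ (SmoothFn m V₁)) :
    (rightOp (a * b) : Module.End ℝ (Operator m V₁ V₂)) = rightOp b * rightOp a := rfl

theorem leftOp_rightOp (a : Module.End ℝ (SmoothFn m V₂)) (b : Module.End ℝ (SmoothFn m V₁)) :
    (leftOp a * rightOp b : Module.End ℝ (Operator m V₁ V₂)) = rightOp b * leftOp a := rfl

/-- `a` on symbols corresponds to `A` on operators through the standard ordering. -/
def Corresponds (A : Module.End ℝ (Operator m V₁ V₂)) (a : Module.End ℝ (Symbol m V₁ V₂)) : Prop :=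
  ∀ T, A (affineQuantization T) = affineQuantization (a T)

namespace Corresponds

variable {A B : Module.End ℝ (Operator m V₁ V₂)} {a b : Module.End ℝ (Symbol m V₁ V₂)}

theorem add (h : Corresponds A a) (h' : Corresponds B b) : Corresponds (A + B) (a + b) := fun T => by
  simp [h T, h' T]

theorem sub (h : Corresponds A a) (h' : Corresponds B b) : Corresponds (A - B) (a - b) := fun T => by
  simp [h T, h' T]

theorem neg (h : Corresponds A a) : Corresponds (-A) (-a) := fun T => by
  simp [h T]

theorem smul (c : ℝ) (h : Corresponds A a) : Corresponds (c • A) (c • a) := fun T => by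
  simp [h T]

theorem mul (h : Corresponds A a) (h' : Corresponds B b) : Corresponds (A * B) (a * b) := fun T => by
  rw [Module.End.mul_apply, h' T, h]; rfl

theorem sum {ι : Type*} (s : Finset ι) {A : ι → Module.End ℝ (Operator m V₁ V₂)}
    {a : ι → Module.End ℝ (Symbol m V₁ V₂)} (h : ∀ i, Corresponds (A i) (a i)) :
    Corresponds (∑ i ∈ s, A i) (∑ i ∈ s, a i) := fun T => by
  simp [h _ T, LinearMap.sum_apply]

theorem of_single (h : ∀ α c f, A (affineQuantization (Finsupp.single α c)) f =
    affineQuantization (a (Finsupp.single α c)) f) : Corresponds A a := by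
  have : A ∘ₗ affineQuantization = affineQuantization ∘ₗ a :=
    Finsupp.lhom_ext fun α c => LinearMap.ext fun f => h α c f
  exact fun T => LinearMap.congr_fun this T

theorem left_coordOp (i : Fin m) :
    Corresponds (V₁ := V₁) (V₂ := V₂) (leftOp (coordOp i)) (coeffMap (coordOp i)) :=
  of_single fun α c f => by
    rw [coeffMap_single, affineQuantization_single]
    change coordOp i (affineQuantization (Finsupp.single α c) f) = _
    rw [affineQuantization_single]
    rfl

theorem left_postComp (u : V₂ →L[ℝ] V₂) :
    Corresponds (m := m) (V₁ := V₁) (leftOp (postComp u)) (coeffMap (postComp (compLeft u))) :=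
  of_single fun α c f => by
    rw [coeffMap_single, affineQuantization_single]
    change postComp u (affineQuantization (Finsupp.single α c) f) = _
    rw [affineQuantization_single]
    rfl

/-- By the Leibniz rule `∂_i` either differentiates the coefficient or joins `∂^α` as one more
`ξ_i`. -/
theorem left_partialD (i : Fin m) :
    Corresponds (V₁ := V₁) (V₂ := V₂) (leftOp (partialD i)) (coeffMap (partialD i) + xiMul i) :=
  of_single fun α c f => by
    rw [LinearMap.add_apply, coeffMap_single, xiMul_single, map_add, LinearMap.add_apply,
      affineQuantization_single, affineQuantization_single]
    change partialD i (affineQuantization (Finsupp.single α c) f) = _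
    rw [affineQuantization_single, partialPow_add_single, Module.End.mul_apply, partialPow_partialD]
    refine Subtype.ext (funext fun x => ?_)
    change fderiv ℝ (fun y => c.1 y ((partialPow α f).1 y)) x (Pi.single i 1) = _
    rw [fderiv_clm_apply (differentiableAt_of c x) (differentiableAt_of _ x)]
    exact add_comm _ _

/-- Moving `x_i` to the left through `∂^α` costs the commutator of `partialPow_coordOp`. -/
theorem right_coordOp (i : Fin m) :
    Corresponds (V₁ := V₁) (V₂ := V₂) (rightOp (coordOp i)) (coeffMap (coordOp i) + xiDer i) :=
  of_single fun α c f => by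
    rw [LinearMap.add_apply, coeffMap_single, xiDer_single, map_add, LinearMap.add_apply,
      affineQuantization_single, map_smul, LinearMap.smul_apply, affineQuantization_single]
    change affineQuantization (Finsupp.single α c) (coordOp i f) = _
    rw [affineQuantization_single, partialPow_coordOp, map_add, map_smul]
    congr 1
    refine Subtype.ext (funext fun x => ?_)
    exact map_smul (c.1 x) _ _

theorem right_partialD (i : Fin m) :
    Corresponds (V₁ := V₁) (V₂ := V₂) (rightOp (partialD i)) (xiMul i) :=
  of_single fun α c f => by
    rw [xiMul_single, affineQuantization_single, partialPow_add_single]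
    change affineQuantization (Finsupp.single α c) (partialD i f) = _
    rw [affineQuantization_single]
    rfl

theorem right_postComp (u : V₁ →L[ℝ] V₁) :
    Corresponds (m := m) (V₂ := V₂) (rightOp (postComp u)) (coeffMap (postComp (compRight u))) :=
  of_single fun α c f => by
    rw [coeffMap_single, affineQuantization_single]
    change affineQuantization (Finsupp.single α c) (postComp u f) = _
    rw [affineQuantization_single, partialPow_postComp]
    rfl

end Corresponds

/-- Commuting an operator with multiplication by `x_i` differentiates its symbol with respect to
`ξ_i`. If the operator is zero, all these derivatives are symbols of the zero operator and of
smaller degree, hence zero by induction, and the symbol is constant in `ξ`. -/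
theorem affineQuantization_injective :
    Function.Injective (affineQuantization : Symbol m V₁ V₂ →ₗ[ℝ] Operator m V₁ V₂) := by
  rw [injective_iff_map_eq_zero]
  have key : ∀ n (T : Symbol m V₁ V₂), (∀ α, n ≤ α.degree → T α = 0) →
      affineQuantization T = 0 → T = 0 := by
    intro n
    induction n with
    | zero => exact fun T hT _ => Finsupp.ext fun α => hT α (Nat.zero_le _)
    | succ n ih =>
      intro T hT hQ
      have hY : ∀ i, xiDer i T = 0 := by
        intro i
        refine ih _ (fun α hα => ?_) ?_
        · rw [xiDer_apply, hT _ (by simpa using hα), smul_zero]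
        · have h1 := Corresponds.right_coordOp i T
          have h2 := Corresponds.left_coordOp i T
          rw [LinearMap.add_apply, map_add, ← h2, hQ, map_zero, map_zero, zero_add] at h1
          exact h1.symm
      have h0 : T = Finsupp.single 0 (T 0) := by
        refine Finsupp.ext fun α => ?_
        rcases eq_or_ne α 0 with rfl | hα
        · simp
        · obtain ⟨i, hi⟩ := Finsupp.ne_iff.1 hα
          have hle : Finsupp.single i 1 ≤ α := by
            simpa [Finsupp.single_le_iff, Nat.one_le_iff_ne_zero] using hi
          have := DFunLike.congr_fun (hY i) (α - Finsupp.single i 1)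
          rw [xiDer_apply, tsub_add_cancel_of_le hle, Finsupp.zero_apply] at this
          rw [(smul_eq_zero.1 this).resolve_left (by positivity), Finsupp.single_apply,
            if_neg hα.symm]
      -- An operator of order zero is determined by its values on constant functions.
      have h1 : T 0 = 0 := by
        refine Subtype.ext (funext fun x => ContinuousLinearMap.ext fun v => ?_)
        have h2 : affineQuantization (Finsupp.single 0 (T 0))
            (⟨fun _ => v, (contDiff_const : ContDiff ℝ ∞ fun _ : Fin m → ℝ => v)⟩ :
              SmoothFn m V₁) = 0 := by
          rw [← h0, hQ]
          rfl
        rw [affineQuantization_single, partialPow_zero] at h2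
        exact congrFun (congrArg Subtype.val h2) x
      rw [h0, h1, Finsupp.single_zero]
  intro T hT
  refine key (T.support.sup Finsupp.degree + 1) T (fun α hα => ?_) hT
  by_contra h
  exact absurd (Finset.le_sup (f := Finsupp.degree) (Finsupp.mem_support_iff.2 h)) (by omega)

end StandardOrdering

/-! ### The cocycle `γ` in an abstract algebra -/

section Abstract

variable {m : ℕ} {A : Type*} [Ring A]

/-- The operators `γ(ε^j)`; `Ξ` and `Y` stand for `ξ_i` and `∂/∂ξ_i`, and `B` for the composition
on the right with elementary matrices. -/
def gammaElem (Ξ Y : Fin m → A) (B : Fin m → Fin m → A) (j : Fin m) : A :=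
  - (∑ i, Ξ i * Y i) * Y j + (∑ i, B i i) * Y j + ∑ i, B i j * Y i

/-- The operators `γ(E_{ij})`. -/
def gammaPart (Ξ Y : Fin m → A) (B : Fin m → Fin m → A) : Fin m ⊕ Unit → Fin m ⊕ Unit → A
  | .inr _, .inl j => gammaElem Ξ Y B j
  | _, _ => 0

/-- `projElem` with the factors of every product in reverse order. -/
def revElem (y Ξ : Fin m → A) (B : Fin m → Fin m → A) : Fin m ⊕ Unit → Fin m ⊕ Unit → A
  | .inl i, .inr _ => - Ξ i
  | .inl i, .inl j => - (Ξ i * y j) + B i j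
  | .inr _, .inr _ => ∑ i, Ξ i * y i - ∑ i, B i i
  | .inr _, .inl j => (∑ i, Ξ i * y i - ∑ i, B i i) * y j - ∑ i, B i j * y i

/-- On symbols, composing with `∂_i` on the left is `P_i + Ξ_i` and on the right `Ξ_i`; composing
with `x_i` is `X_i` on the left and `X_i + Y_i` on the right. Right composition reverses products,
hence `revElem`. The difference of both actions is the Lie derivative of symbols plus a remainder
concentrated in the blocks `E_{∞j}` and free of `X` and `P`. -/
theorem projElem_sub_revElem {X P Ξ Y : Fin m → A} {L B : Fin m → Fin m → A}
    (hXX : ∀ i j, X i * X j = X j * X i) (hΞX : ∀ i j, Ξ i * X j = X j * Ξ i)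
    (hYX : ∀ i j, Y i * X j = X j * Y i)
    (hBX : ∀ i j k, B i j * X k = X k * B i j) (I J : Fin m ⊕ Unit) :
    projElem X (fun i => P i + Ξ i) L I J - revElem (fun i => X i + Y i) Ξ B I J =
      projElem X P (fun i j => Ξ i * Y j + (L i j - B i j)) I J + gammaPart Ξ Y B I J := by
  rcases I with i | ⟨⟩ <;> rcases J with j | ⟨⟩
  · simp only [projElem, revElem, gammaPart]
    linear_combination (norm := noncomm_ring) hΞX i j
  · simp only [projElem, revElem, gammaPart]
    noncomm_ring
  · simp only [projElem, revElem, gammaPart, gammaElem, eulerOp, Finset.mul_sum, Finset.sum_mul,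
      mul_add, add_mul, mul_sub, sub_mul, Finset.sum_add_distrib, Finset.sum_sub_distrib, neg_mul,
      ← Finset.sum_neg_distrib]
    simp only [← Finset.sum_add_distrib, ← Finset.sum_sub_distrib]
    refine Finset.sum_congr rfl fun i _ => ?_
    linear_combination (norm := noncomm_ring) - hΞX i i * X j - X i * hΞX i j - hΞX i i * Y j
      - Ξ i * hYX i j + hBX i i j + hBX i j i - hΞX i j * Y i
      + hXX j i * Ξ i
  · simp only [projElem, revElem, gammaPart, eulerOp, mul_add,
      Finset.sum_add_distrib, Finset.sum_sub_distrib]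
    simp only [hΞX]
    noncomm_ring

/-- In `∑ E_{IJ} E_{JI}` the blocks `E_{∞j}`, where the remainder lives, meet only `E_{j∞}`, which
acts by `-P_j`. So nothing is quadratic in the remainder, and the two orders of the product give the
factor 2. -/
theorem sum_projElem_add_gammaPart {X P Ξ Y : Fin m → A} {L B : Fin m → Fin m → A}
    (hP : ∀ i j, gammaElem Ξ Y B j * P i = P i * gammaElem Ξ Y B j) :
    ∑ I, ∑ J, (projElem X P L I J + gammaPart Ξ Y B I J) *
        (projElem X P L J I + gammaPart Ξ Y B J I) =
      ∑ I, ∑ J, projElem X P L I J * projElem X P L J I - 2 * ∑ j, gammaElem Ξ Y B j * P j := by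
  simp only [Fintype.sum_sum_type, Finset.univ_unique, Finset.sum_singleton, gammaPart, projElem,
    mul_zero, zero_mul, Finset.sum_const_zero, mul_add, add_mul, Finset.sum_add_distrib, neg_mul, mul_neg, Finset.sum_neg_distrib,
    ← hP]
  noncomm_ring

/-- `Ξ`, `Y` are `ξ_i`, `∂/∂ξ_i`; `L`, `B` are left and right multiplications by elementary
matrices. -/
structure FibreSystem (Ξ Y : Fin m → A) (L B : Fin m → Fin m → A) : Prop where
  ΞΞ : ∀ i j, Ξ i * Ξ j = Ξ j * Ξ i
  YY : ∀ i j, Y i * Y j = Y j * Y i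
  YΞ : ∀ i j, Y i * Ξ j = Ξ j * Y i + if i = j then 1 else 0
  LΞ : ∀ i j k, L i j * Ξ k = Ξ k * L i j
  LY : ∀ i j k, L i j * Y k = Y k * L i j
  BΞ : ∀ i j k, B i j * Ξ k = Ξ k * B i j
  BY : ∀ i j k, B i j * Y k = Y k * B i j
  LB : ∀ i j k l, L i j * B k l = B k l * L i j
  LL : IsGL L
  BB : ∀ i j k l, B k l * B i j - B i j * B k l =
    (if j = k then B i l else 0) - (if l = i then B k j else 0)

namespace FibreSystem

variable {Ξ Y : Fin m → A} {L B : Fin m → Fin m → A} (h : FibreSystem Ξ Y L B)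
include h

theorem xiD_xiD (i j k l : Fin m) : Ξ i * Y j * (Ξ k * Y l) - Ξ k * Y l * (Ξ i * Y j) =
    (if j = k then Ξ i * Y l else 0) - (if l = i then Ξ k * Y j else 0) := by
  have key : Ξ i * Y j * (Ξ k * Y l) - Ξ k * Y l * (Ξ i * Y j) =
      Ξ i * (if j = k then 1 else 0) * Y l - Ξ k * (if l = i then 1 else 0) * Y j := by
    linear_combination (norm := noncomm_ring) Ξ i * h.YΞ j k * Y l - Ξ k * h.YΞ l i * Y j
      + h.ΞΞ i k * Y j * Y l + Ξ k * Ξ i * h.YY j l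
  rw [key]
  split_ifs <;> noncomm_ring

/-- Three mutually commuting actions add up: `ξ_i ∂/∂ξ_j`, left composition, and minus right
composition, the sign compensating the reversed relations of `B`. -/
theorem isGL : IsGL fun i j => Ξ i * Y j + (L i j - B i j) := by
  intro i j k l
  have h1 := h.xiD_xiD i j k l
  have h2 := h.LL i j k l
  have h3 := h.BB i j k l
  have e : ∀ (p : Prop) [Decidable p] (a b c : A), (if p then a + (b - c) else 0) =
      (if p then a else 0) + ((if p then b else 0) - if p then c else 0) := by
    intro p _ a b c
    split_ifs <;> simp
  simp only [e]
  linear_combination (norm := noncomm_ring) h1 + h2 - h3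
    - Ξ i * h.LY k l j - h.LΞ k l i * Y j + Ξ i * h.BY k l j + h.BΞ k l i * Y j
    + Ξ k * h.LY i j l + h.LΞ i j k * Y l - Ξ k * h.BY i j l - h.BΞ i j k * Y l
    - h.LB i j k l + h.LB k l i j

theorem xiD_euler (a b : Fin m) :
    Ξ a * Y b * ∑ i, Ξ i * Y i = (∑ i, Ξ i * Y i) * (Ξ a * Y b) := by
  rw [← sub_eq_zero, Finset.mul_sum, Finset.sum_mul, ← Finset.sum_sub_distrib]
  simp [h.xiD_xiD]

theorem tr_B (a b : Fin m) : B a b * ∑ i, B i i = (∑ i, B i i) * B a b := by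
  rw [← sub_eq_zero, Finset.mul_sum, Finset.sum_mul, ← Finset.sum_sub_distrib]
  simp [h.BB]

theorem xiD_Y (a b j : Fin m) : Ξ a * Y b * Y j = Y j * (Ξ a * Y b) - if j = a then Y b else 0 := by
  have h1 := h.YΞ j a
  split_ifs at h1 ⊢ <;>
  linear_combination (norm := noncomm_ring) Ξ a * h.YY b j - h1 * Y b

theorem xiD_sum (a b j : Fin m) : Ξ a * Y b * ∑ i, B i j * Y i =
    (∑ i, B i j * Y i) * (Ξ a * Y b) - B a j * Y b := by
  have : ∀ i, Ξ a * Y b * (B i j * Y i) =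
      B i j * Y i * (Ξ a * Y b) - if i = a then B i j * Y b else 0 := by
    intro i
    have h1 := h.xiD_Y a b i
    split_ifs at h1 ⊢ <;>
    linear_combination (norm := noncomm_ring)
      B i j * h1 - Ξ a * h.BY i j b * Y i - h.BΞ i j a * Y b * Y i
  simp [Finset.mul_sum, Finset.sum_mul, this]

theorem B_sum (a b j : Fin m) : B a b * ∑ i, B i j * Y i =
    (∑ i, B i j * Y i) * B a b + ((if j = a then ∑ i, B i b * Y i else 0) - B a j * Y b) := by
  have : ∀ i, B a b * (B i j * Y i) = B i j * Y i * B a b +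
      ((if j = a then B i b * Y i else 0) - if b = i then B a j * Y i else 0) := by
    intro i
    have h1 := h.BB i j a b
    split_ifs at h1 ⊢ <;>
    linear_combination (norm := noncomm_ring) h1 * Y i + B i j * h.BY a b i
  simp only [Finset.mul_sum, Finset.sum_mul, this, Finset.sum_add_distrib, Finset.sum_sub_distrib]
  split_ifs <;> simp

/-- `γ` restricted to `g₁ ≅ ℝ^{m*}` is `gl(m)`-equivariant; this keeps the tree-like subspaces
stable under `gl(m)`. -/
theorem gammaElem_equivariant (a b j : Fin m) :
    (Ξ a * Y b + (L a b - B a b)) * gammaElem Ξ Y B j =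
      gammaElem Ξ Y B j * (Ξ a * Y b + (L a b - B a b)) -
        if j = a then gammaElem Ξ Y B b else 0 := by
  have b1 := h.xiD_euler a b
  have b2 := h.xiD_Y a b j
  have b3 : Ξ a * Y b * (∑ i, B i i) = (∑ i, B i i) * (Ξ a * Y b) := by
    rw [Finset.mul_sum, Finset.sum_mul]
    refine Finset.sum_congr rfl fun i _ => ?_
    linear_combination (norm := noncomm_ring) - Ξ a * h.BY i i b - h.BΞ i i a * Y b
  have b4 := h.xiD_sum a b j
  have comm : ∀ Z : A, (∀ k, Z * Ξ k = Ξ k * Z) → (∀ k, Z * Y k = Y k * Z) →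
      Z * (∑ i, Ξ i * Y i) = (∑ i, Ξ i * Y i) * Z := by
    intro Z h1 h2
    rw [Finset.mul_sum, Finset.sum_mul]
    refine Finset.sum_congr rfl fun i _ => ?_
    rw [← mul_assoc, h1, mul_assoc, h2, mul_assoc]
  have c1 := comm (L a b) (h.LΞ a b) (h.LY a b)
  have c2 := comm (B a b) (h.BΞ a b) (h.BY a b)
  have c3 := h.LY a b j
  have c4 := h.BY a b j
  have c5 : L a b * ∑ i, B i i = (∑ i, B i i) * L a b := by
    simp only [Finset.mul_sum, Finset.sum_mul, h.LB]
  have c6 := h.tr_B a b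
  have c7 : L a b * ∑ i, B i j * Y i = (∑ i, B i j * Y i) * L a b := by
    rw [Finset.mul_sum, Finset.sum_mul]
    refine Finset.sum_congr rfl fun i _ => ?_
    rw [← mul_assoc, h.LB, mul_assoc, h.LY, mul_assoc]
  have c8 := h.B_sum a b j
  simp only [gammaElem]
  generalize hN : ∑ i, Ξ i * Y i = N at *
  generalize hT : ∑ i, B i i = T at *
  generalize ∑ i, B i j * Y i = S at *
  split_ifs at b2 c8 ⊢ <;>
  linear_combination (norm := noncomm_ring) - b1 * Y j - N * b2 + b3 * Y j + T * b2 + b4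
    - (c1 - c2) * Y j - N * (c3 - c4) + (c5 - c6) * Y j + T * (c3 - c4) + c7 - c8

end FibreSystem
end Abstract

/-! ### The actions on symbols and on operators -/

section Actions

variable {m : ℕ} {V₁ V₂ : Type*}
  [NormedAddCommGroup V₁] [NormedSpace ℝ V₁] [FiniteDimensional ℝ V₁]
  [NormedAddCommGroup V₂] [NormedSpace ℝ V₂] [FiniteDimensional ℝ V₂]

variable (ρ₁ : Representation ℝ (GL (Fin m) ℝ) V₁) (ρ₂ : Representation ℝ (GL (Fin m) ℝ) V₂)

set_option linter.unusedSectionVars false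

variable (V₁ V₂) in
/-- Multiplication of symbols by the coordinate function `x_i`. -/
def symX (i : Fin m) : Module.End ℝ (Symbol m V₁ V₂) := coeffMap (coordOp i)

variable (V₁ V₂) in
/-- The partial derivative `∂/∂x_i` of symbols. -/
def symP (i : Fin m) : Module.End ℝ (Symbol m V₁ V₂) := coeffMap (partialD i)

variable (V₁ V₂) in
/-- Multiplication of symbols by `ξ_i`. -/
def symΞ (i : Fin m) : Module.End ℝ (Symbol m V₁ V₂) := xiMul i

variable (V₁ V₂) in
/-- The derivation `∂/∂ξ_i` of symbols. -/
def symY (i : Fin m) : Module.End ℝ (Symbol m V₁ V₂) := xiDer i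

variable (V₁) in
/-- Composition of symbols on the left with `ρ₂_*(E_{ij})`. -/
def symL (i j : Fin m) : Module.End ℝ (Symbol m V₁ V₂) :=
  coeffMap (postComp (compLeft (infinitesimal ρ₂ (Matrix.single i j 1))))

variable (V₂) in
/-- Composition of symbols on the right with `ρ₁_*(E_{ij})`. -/
def symB (i j : Fin m) : Module.End ℝ (Symbol m V₁ V₂) :=
  coeffMap (postComp (compRight (infinitesimal ρ₁ (Matrix.single i j 1))))

/-- The action of `E_{ij}` on the values of symbols. -/
def symR (i j : Fin m) : Module.End ℝ (Symbol m V₁ V₂) :=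
  symΞ V₁ V₂ i * symY V₁ V₂ j + (symL V₁ ρ₂ i j - symB V₂ ρ₁ i j)

/-- The action of `E_{IJ}` on operators. -/
def opElem (I J : Fin m ⊕ Unit) : Module.End ℝ (Operator m V₁ V₂) :=
  leftOp (projElem coordOp partialD (elemOp (infinitesimal ρ₂)) I J) -
    rightOp (projElem coordOp partialD (elemOp (infinitesimal ρ₁)) I J)

theorem leftOp_projElem (I J : Fin m ⊕ Unit) :
    (leftOp (projElem coordOp partialD (elemOp (infinitesimal ρ₂)) I J) :
      Module.End ℝ (Operator m V₁ V₂)) =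
    projElem (fun i => leftOp (coordOp i)) (fun i => leftOp (partialD i))
      (fun i j => leftOp (elemOp (infinitesimal ρ₂) i j)) I J := by
  rcases I with i | ⟨⟩ <;> rcases J with j | ⟨⟩ <;>
  simp only [projElem, eulerOp, map_neg, map_add, map_sub, map_sum, leftOp_mul]

theorem rightOp_projElem (I J : Fin m ⊕ Unit) :
    (rightOp (projElem coordOp partialD (elemOp (infinitesimal ρ₁)) I J) :
      Module.End ℝ (Operator m V₁ V₂)) =
    revElem (fun i => rightOp (coordOp i)) (fun i => rightOp (partialD i))
      (fun i j => rightOp (elemOp (infinitesimal ρ₁) i j)) I J := by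
  rcases I with i | ⟨⟩ <;> rcases J with j | ⟨⟩ <;>
  simp only [projElem, revElem, eulerOp, map_neg, map_add, map_sub, map_sum, rightOp_mul]

theorem Corresponds.projElem {x d : Fin m → Module.End ℝ (Operator m V₁ V₂)}
    {r : Fin m → Fin m → Module.End ℝ (Operator m V₁ V₂)}
    {x' d' : Fin m → Module.End ℝ (Symbol m V₁ V₂)}
    {r' : Fin m → Fin m → Module.End ℝ (Symbol m V₁ V₂)}
    (hx : ∀ i, Corresponds (x i) (x' i)) (hd : ∀ i, Corresponds (d i) (d' i))
    (hr : ∀ i j, Corresponds (r i j) (r' i j)) (I J : Fin m ⊕ Unit) :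
    Corresponds (projElem x d r I J) (ProjQuant.projElem x' d' r' I J) := by
  have hE : Corresponds (eulerOp x d) (eulerOp x' d') := .sum _ fun i => (hx i).mul (hd i)
  rcases I with i | ⟨⟩ <;> rcases J with j | ⟨⟩
  · exact ((hx j).mul (hd i)).neg.add (hr i j)
  · exact (hd i).neg
  · exact ((hx j).mul (hE.sub (.sum _ fun i => hr i i))).sub (.sum _ fun i => (hx i).mul (hr i j))
  · exact hE.sub (.sum _ fun i => hr i i)

theorem Corresponds.revElem {x d : Fin m → Module.End ℝ (Operator m V₁ V₂)}
    {r : Fin m → Fin m → Module.End ℝ (Operator m V₁ V₂)}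
    {x' d' : Fin m → Module.End ℝ (Symbol m V₁ V₂)}
    {r' : Fin m → Fin m → Module.End ℝ (Symbol m V₁ V₂)}
    (hx : ∀ i, Corresponds (x i) (x' i)) (hd : ∀ i, Corresponds (d i) (d' i))
    (hr : ∀ i j, Corresponds (r i j) (r' i j)) (I J : Fin m ⊕ Unit) :
    Corresponds (revElem x d r I J) (ProjQuant.revElem x' d' r' I J) := by
  have hE : Corresponds (∑ i, d i * x i) (∑ i, d' i * x' i) := .sum _ fun i => (hd i).mul (hx i)
  rcases I with i | ⟨⟩ <;> rcases J with j | ⟨⟩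
  · exact ((hd i).mul (hx j)).neg.add (hr i j)
  · exact (hd i).neg
  · exact ((hE.sub (.sum _ fun i => hr i i)).mul (hx j)).sub (.sum _ fun i => (hr i j).mul (hx i))
  · exact hE.sub (.sum _ fun i => hr i i)

/-- The action of `E_{IJ}` on symbols. -/
def symElem (I J : Fin m ⊕ Unit) : Module.End ℝ (Symbol m V₁ V₂) :=
  projElem (symX V₁ V₂) (symP V₁ V₂) (symR ρ₁ ρ₂) I J

variable (V₂) in
/-- The operator `γ(E_{IJ})` on symbols. -/
def symGammaPart (I J : Fin m ⊕ Unit) : Module.End ℝ (Symbol m V₁ V₂) :=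
  gammaPart (symΞ V₁ V₂) (symY V₁ V₂) (symB V₂ ρ₁) I J

variable (V₂) in
/-- The operator `γ(ε^j)` on symbols. -/
def symGamma (j : Fin m) : Module.End ℝ (Symbol m V₁ V₂) :=
  gammaElem (symΞ V₁ V₂) (symY V₁ V₂) (symB V₂ ρ₁) j

theorem coeffMap_zero : (coeffMap 0 : Module.End ℝ (Symbol m V₁ V₂)) = 0 :=
  LinearMap.ext fun _ => Finsupp.ext fun _ => rfl

theorem coeffMap_commute_xiMul (u : Module.End ℝ (SmoothFn m (V₁ →L[ℝ] V₂))) (i : Fin m) :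
    symΞ V₁ V₂ i * coeffMap u = coeffMap u * symΞ V₁ V₂ i :=
  LinearMap.ext fun T => (coeffMap_xiMul u i T).symm

theorem coeffMap_commute_xiDer (u : Module.End ℝ (SmoothFn m (V₁ →L[ℝ] V₂))) (i : Fin m) :
    symY V₁ V₂ i * coeffMap u = coeffMap u * symY V₁ V₂ i :=
  LinearMap.ext fun T => (coeffMap_xiDer u i T).symm

theorem symX_comm (i j : Fin m) : symX V₁ V₂ i * symX V₁ V₂ j = symX V₁ V₂ j * symX V₁ V₂ i := by
  rw [symX, symX, ← coeffMap_mul, ← coeffMap_mul, (weylSystem_smoothFn 0).xx]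

theorem symB_symX (i j k : Fin m) :
    symB V₂ ρ₁ i j * symX V₁ V₂ k = symX V₁ V₂ k * symB V₂ ρ₁ i j := by
  rw [symB, symX, ← coeffMap_mul, ← coeffMap_mul]
  exact congrArg coeffMap (LinearMap.ext fun f => postComp_mulFn _ _ f)

theorem symB_symP (i j k : Fin m) :
    symB V₂ ρ₁ i j * symP V₁ V₂ k = symP V₁ V₂ k * symB V₂ ρ₁ i j := by
  rw [symB, symP, ← coeffMap_mul, ← coeffMap_mul]
  exact congrArg coeffMap (LinearMap.ext fun f => (partialD_postComp _ _ f).symm)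

theorem symL_symX (i j k : Fin m) :
    symL V₁ ρ₂ i j * symX V₁ V₂ k = symX V₁ V₂ k * symL V₁ ρ₂ i j := by
  rw [symL, symX, ← coeffMap_mul, ← coeffMap_mul]
  exact congrArg coeffMap (LinearMap.ext fun f => postComp_mulFn _ _ f)

theorem symL_symP (i j k : Fin m) :
    symL V₁ ρ₂ i j * symP V₁ V₂ k = symP V₁ V₂ k * symL V₁ ρ₂ i j := by
  rw [symL, symP, ← coeffMap_mul, ← coeffMap_mul]
  exact congrArg coeffMap (LinearMap.ext fun f => (partialD_postComp _ _ f).symm)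

theorem corresponds_left_projElem (I J : Fin m ⊕ Unit) :
    Corresponds (leftOp (projElem coordOp partialD (elemOp (infinitesimal ρ₂)) I J))
      (projElem (symX V₁ V₂) (fun i => symP V₁ V₂ i + symΞ V₁ V₂ i) (symL V₁ ρ₂) I J) := by
  rw [leftOp_projElem]
  exact Corresponds.projElem Corresponds.left_coordOp Corresponds.left_partialD
    (fun i j => Corresponds.left_postComp _) I J

theorem corresponds_right_projElem (I J : Fin m ⊕ Unit) :
    Corresponds (rightOp (projElem coordOp partialD (elemOp (infinitesimal ρ₁)) I J))
      (revElem (fun i => symX V₁ V₂ i + symY V₁ V₂ i) (symΞ V₁ V₂) (symB V₂ ρ₁) I J) := by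
  rw [rightOp_projElem]
  exact Corresponds.revElem Corresponds.right_coordOp Corresponds.right_partialD
    (fun i j => Corresponds.right_postComp _) I J

theorem symElem_add_symGammaPart (I J : Fin m ⊕ Unit) :
    projElem (symX V₁ V₂) (fun i => symP V₁ V₂ i + symΞ V₁ V₂ i) (symL V₁ ρ₂) I J -
      revElem (fun i => symX V₁ V₂ i + symY V₁ V₂ i) (symΞ V₁ V₂) (symB V₂ ρ₁) I J =
      symElem ρ₁ ρ₂ I J + symGammaPart V₂ ρ₁ I J :=
  projElem_sub_revElem symX_comm (fun i _ => coeffMap_commute_xiMul _ i)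
    (fun i _ => coeffMap_commute_xiDer _ i) (symB_symX ρ₁) I J

/-- The decomposition `𝓛 = L + γ` on the elementary matrices. -/
theorem corresponds_opElem (I J : Fin m ⊕ Unit) :
    Corresponds (opElem ρ₁ ρ₂ I J) (symElem ρ₁ ρ₂ I J + symGammaPart V₂ ρ₁ I J) := by
  rw [← symElem_add_symGammaPart]
  exact (corresponds_left_projElem ρ₂ I J).sub (corresponds_right_projElem ρ₁ I J)

theorem lieOperator_eq (h : SL m) :
    lieOperator ρ₁ ρ₂ h = ∑ I, ∑ J, h.1 I J • opElem ρ₁ ρ₂ I J := by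
  have : lieOperator ρ₁ ρ₂ h = leftOp (lieDeriv (infinitesimal ρ₂) (projField h)) -
      rightOp (lieDeriv (infinitesimal ρ₁) (projField h)) := rfl
  rw [this, lieDeriv_projField, lieDeriv_projField]
  simp only [map_sum, map_smul, opElem, smul_sub, Finset.sum_sub_distrib]

theorem homAct_eq (M : Matrix (Fin m) (Fin m) ℝ) :
    homAct ρ₁ ρ₂ M = compLeft (infinitesimal ρ₂ M) - compRight (infinitesimal ρ₁ M) := rfl

theorem symR_eq (i j : Fin m) :
    symR ρ₁ ρ₂ i j = xiD i j + coeffMap (elemOp (homAct ρ₁ ρ₂) i j) := by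
  rw [xiD_eq, elemOp, homAct_eq, map_sub, coeffMap_sub]
  rfl

theorem xiD_mul_coeffMap (u : Module.End ℝ (SmoothFn m (V₁ →L[ℝ] V₂))) (i j : Fin m) :
    (xiD i j : Module.End ℝ (Symbol m V₁ V₂)) * coeffMap u = coeffMap u * xiD i j := by
  rw [xiD_eq]
  change symΞ V₁ V₂ i * symY V₁ V₂ j * _ = _ * (symΞ V₁ V₂ i * symY V₁ V₂ j)
  rw [mul_assoc, coeffMap_commute_xiDer, ← mul_assoc, coeffMap_commute_xiMul, mul_assoc]

theorem lieSymbol_def (h : SL m) : lieSymbol ρ₁ ρ₂ h =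
    coeffMap (lieDeriv (homAct ρ₁ ρ₂) (projField h)) -
      ∑ i, ∑ j, coeffMap (mulFn (jacobian (projField h) i j)) * xiD i j := by
  simp only [← xiD_mul_coeffMap]
  rfl

theorem lieSymbol_eq (h : SL m) :
    lieSymbol ρ₁ ρ₂ h = ∑ I, ∑ J, h.1 I J • symElem ρ₁ ρ₂ I J := by
  have hf : ∀ i, fieldElem (symX V₁ V₂) h.1 i = coeffMap (fieldElem coordOp h.1 i) := by
    intro i
    simp only [fieldElem, coeffMap_add, coeffMap_sub, coeffMap_sum, coeffMap_smul, coeffMap_mul,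
      coeffMap_one]
    rfl
  have hj : ∀ i j, jacobianElem (symX V₁ V₂) h.1 i j = coeffMap (jacobianElem coordOp h.1 i j) := by
    intro i j
    simp only [jacobianElem]
    split_ifs
    · simp only [coeffMap_add, coeffMap_sum, coeffMap_smul, coeffMap_one]
      rfl
    · simp only [coeffMap_add, coeffMap_smul, coeffMap_one, coeffMap_zero]
      rfl
  simp only [symElem]
  rw [sum_smul_projElem, lieSymbol_def, lieDeriv_projField, sum_smul_projElem,
    coeffMap_sub]
  simp only [hf, hj, symR_eq, coeffMap_sum, coeffMap_mul, jacobianElem_eq, mul_add,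
    Finset.sum_add_distrib]
  rw [sub_sub, add_comm (∑ i, ∑ j, _ * xiD i j)]
  rfl

end Actions

/-! ### Casimir operators of symbols and of operators -/

section CasimirOperators

variable {m : ℕ} {V₁ V₂ : Type*}
  [NormedAddCommGroup V₁] [NormedSpace ℝ V₁] [FiniteDimensional ℝ V₁]
  [NormedAddCommGroup V₂] [NormedSpace ℝ V₂] [FiniteDimensional ℝ V₂]

variable (ρ₁ : Representation ℝ (GL (Fin m) ℝ) V₁) (ρ₂ : Representation ℝ (GL (Fin m) ℝ) V₂)

set_option linter.unusedSectionVars false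

theorem symP_comm (i j : Fin m) : symP V₁ V₂ i * symP V₁ V₂ j = symP V₁ V₂ j * symP V₁ V₂ i := by
  rw [symP, symP, ← coeffMap_mul, ← coeffMap_mul, (weylSystem_smoothFn 0).dd]

theorem symP_symX (i j : Fin m) : symP V₁ V₂ i * symX V₁ V₂ j =
    symX V₁ V₂ j * symP V₁ V₂ i + if i = j then 1 else 0 := by
  rw [symP, symX, ← coeffMap_mul, ← coeffMap_mul]
  have : (partialD i * coordOp j : Module.End ℝ (SmoothFn m (V₁ →L[ℝ] V₂))) =
      coordOp j * partialD i + if i = j then 1 else 0 := (weylSystem_smoothFn 0).dx i j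
  rw [this, coeffMap_add]
  split_ifs
  · rw [coeffMap_one]
  · rw [coeffMap_zero]

theorem symR_symX (i j k : Fin m) :
    symR ρ₁ ρ₂ i j * symX V₁ V₂ k = symX V₁ V₂ k * symR ρ₁ ρ₂ i j := by
  have h1 : symY V₁ V₂ j * symX V₁ V₂ k = symX V₁ V₂ k * symY V₁ V₂ j :=
    coeffMap_commute_xiDer _ j
  have h2 : symΞ V₁ V₂ i * symX V₁ V₂ k = symX V₁ V₂ k * symΞ V₁ V₂ i :=
    coeffMap_commute_xiMul _ i
  rw [symR, add_mul, sub_mul, symL_symX, symB_symX, mul_assoc, h1, ← mul_assoc, h2, mul_assoc,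
    mul_add, mul_sub]

theorem symR_symP (i j k : Fin m) :
    symR ρ₁ ρ₂ i j * symP V₁ V₂ k = symP V₁ V₂ k * symR ρ₁ ρ₂ i j := by
  have h1 : symY V₁ V₂ j * symP V₁ V₂ k = symP V₁ V₂ k * symY V₁ V₂ j :=
    coeffMap_commute_xiDer _ j
  have h2 : symΞ V₁ V₂ i * symP V₁ V₂ k = symP V₁ V₂ k * symΞ V₁ V₂ i :=
    coeffMap_commute_xiMul _ i
  rw [symR, add_mul, sub_mul, symL_symP, symB_symP, mul_assoc, h1, ← mul_assoc, h2, mul_assoc,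
    mul_add, mul_sub]

theorem symGamma_symP (i j : Fin m) :
    symGamma V₂ ρ₁ j * symP V₁ V₂ i = symP V₁ V₂ i * symGamma V₂ ρ₁ j := by
  have h1 : ∀ k, Commute (symY V₁ V₂ k) (symP V₁ V₂ i) := fun k => coeffMap_commute_xiDer _ k
  have h2 : ∀ k, Commute (symΞ V₁ V₂ k) (symP V₁ V₂ i) := fun k => coeffMap_commute_xiMul _ k
  have h3 : ∀ k l, Commute (symB V₂ ρ₁ k l) (symP V₁ V₂ i) := fun k l => symB_symP ρ₁ k l i
  have h : Commute (symGamma V₂ ρ₁ j) (symP V₁ V₂ i) := by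
    refine Commute.add_left (Commute.add_left (Commute.mul_left (Commute.neg_left ?_) (h1 j))
      (Commute.mul_left ?_ (h1 j))) ?_
    · exact Commute.sum_left _ _ _ fun k _ => (h2 k).mul_left (h1 k)
    · exact Commute.sum_left _ _ _ fun k _ => h3 k k
    · exact Commute.sum_left _ _ _ fun k _ => (h3 k j).mul_left (h1 k)
  exact h

theorem weylSystem_symbol : WeylSystem (symX V₁ V₂) (symP V₁ V₂) (symR ρ₁ ρ₂) where
  xx := symX_comm
  dd := symP_comm
  dx := symP_symX
  rx := symR_symX ρ₁ ρ₂
  rd := symR_symP ρ₁ ρ₂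

theorem casimirSymbol_eq : casimirSymbol ρ₁ ρ₂ = (2 * (m + 1) : ℝ)⁻¹ •
    ∑ I, ∑ J, symElem ρ₁ ρ₂ I J * symElem ρ₁ ρ₂ J I :=
  casimir_eq _ _ (lieSymbol_eq ρ₁ ρ₂) WeylSystem.sum_projElem

theorem sum_opElem : ∑ I, opElem ρ₁ ρ₂ I I = 0 := by
  simp only [opElem, Finset.sum_sub_distrib, ← map_sum]
  rw [WeylSystem.sum_projElem, WeylSystem.sum_projElem, map_zero, map_zero, sub_zero]

theorem casimirOperator_eq : casimirOperator ρ₁ ρ₂ = (2 * (m + 1) : ℝ)⁻¹ •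
    ∑ I, ∑ J, opElem ρ₁ ρ₂ I J * opElem ρ₁ ρ₂ J I :=
  casimir_eq _ _ (lieOperator_eq ρ₁ ρ₂) (sum_opElem ρ₁ ρ₂)

/-- The difference `𝒞 - C` on symbols. -/
def symN : Module.End ℝ (Symbol m V₁ V₂) :=
  - (m + 1 : ℝ)⁻¹ • ∑ j, symGamma V₂ ρ₁ j * symP V₁ V₂ j

theorem sum_symElem_add : ∑ I, ∑ J, (symElem ρ₁ ρ₂ I J + symGammaPart V₂ ρ₁ I J) *
    (symElem ρ₁ ρ₂ J I + symGammaPart V₂ ρ₁ J I) =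
    ∑ I, ∑ J, symElem ρ₁ ρ₂ I J * symElem ρ₁ ρ₂ J I -
      2 * ∑ j, symGamma V₂ ρ₁ j * symP V₁ V₂ j :=
  sum_projElem_add_gammaPart (symGamma_symP ρ₁)

/-- The factor 2 of the cross terms cancels against the normalization `(2(m+1))⁻¹` coming from the
Killing form, which leaves the constant `-(m+1)⁻¹` of `symN`. -/
theorem corresponds_casimirOperator :
    Corresponds (casimirOperator ρ₁ ρ₂) (casimirSymbol ρ₁ ρ₂ + symN (V₂ := V₂) ρ₁) := by
  have h : casimirSymbol ρ₁ ρ₂ + symN ρ₁ = (2 * (m + 1) : ℝ)⁻¹ •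
      ∑ I, ∑ J, (symElem ρ₁ ρ₂ I J + symGammaPart V₂ ρ₁ I J) *
        (symElem ρ₁ ρ₂ J I + symGammaPart V₂ ρ₁ J I) := by
    have h2 : 2 * (∑ j, symGamma V₂ ρ₁ j * symP V₁ V₂ j) =
        (2 : ℝ) • ∑ j, symGamma V₂ ρ₁ j * symP V₁ V₂ j := by
      rw [two_smul, two_mul]
    rw [sum_symElem_add, smul_sub, ← casimirSymbol_eq, sub_eq_add_neg, symN, h2, smul_smul,
      mul_inv, mul_right_comm, inv_mul_cancel₀ two_ne_zero, one_mul, neg_smul]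
  rw [h, casimirOperator_eq]
  exact .smul _ (.sum _ fun I => .sum _ fun J =>
    (corresponds_opElem ρ₁ ρ₂ I J).mul (corresponds_opElem ρ₁ ρ₂ J I))

theorem corresponds_lieOperator (h : SL m) : Corresponds (lieOperator ρ₁ ρ₂ h)
    (lieSymbol ρ₁ ρ₂ h + ∑ j, h.1 (.inr ()) (.inl j) • symGamma V₂ ρ₁ j) := by
  -- `γ` is zero on every elementary matrix outside `g₁`, so only the row `ξ` of `h` contributes.
  have e : ∑ j, h.1 (.inr ()) (.inl j) • symGamma V₂ ρ₁ j =
      ∑ I, ∑ J, h.1 I J • symGammaPart V₂ ρ₁ I J := by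
    simp [symGammaPart, gammaPart, symGamma]
  have e2 : lieSymbol ρ₁ ρ₂ h + ∑ j, h.1 (.inr ()) (.inl j) • symGamma V₂ ρ₁ j =
      ∑ I, ∑ J, h.1 I J • (symElem ρ₁ ρ₂ I J + symGammaPart V₂ ρ₁ I J) := by
    rw [e, lieSymbol_eq]
    simp only [smul_add, Finset.sum_add_distrib]
  rw [e2, lieOperator_eq]
  exact .sum _ fun I => .sum _ fun J => .smul _ (corresponds_opElem ρ₁ ρ₂ I J)

/-- Injectivity of the standard ordering turns the relation `IsGamma` into an honest operator on
symbols. -/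
theorem isGamma_iff (ξ : Fin m → ℝ) (T U : Symbol m V₁ V₂) :
    IsGamma ρ₁ ρ₂ (g1 ξ) T U ↔ U = ∑ j, ξ j • symGamma V₂ ρ₁ j T := by
  rw [IsGamma, corresponds_lieOperator, ← map_sub, affineQuantization_injective.eq_iff]
  rw [LinearMap.add_apply, add_sub_cancel_left, LinearMap.sum_apply]
  rfl

variable {ρ₁ ρ₂}

/-- Left composition is multiplicative, right composition antimultiplicative, and the two commute;
so their difference is again a representation. -/
theorem isGL_opElem
    (h₁ : ∀ A B, infinitesimal ρ₁ (A * B - B * A) =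
      infinitesimal ρ₁ A * infinitesimal ρ₁ B - infinitesimal ρ₁ B * infinitesimal ρ₁ A)
    (h₂ : ∀ A B, infinitesimal ρ₂ (A * B - B * A) =
      infinitesimal ρ₂ A * infinitesimal ρ₂ B - infinitesimal ρ₂ B * infinitesimal ρ₂ A) :
    IsGL (opElem ρ₁ ρ₂) := by
  intro I J K L
  have e1 := congrArg (rightOp (V₁ := V₁) (V₂ := V₂))
    ((weylSystem_smoothFn (infinitesimal ρ₁)).isGL_projElem (isGL_elemOp h₁) I J K L)
  have e2 := congrArg (leftOp (V₁ := V₁) (V₂ := V₂))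
    ((weylSystem_smoothFn (infinitesimal ρ₂)).isGL_projElem (isGL_elemOp h₂) I J K L)
  rw [map_sub, map_sub, rightOp_mul, rightOp_mul] at e1
  rw [map_sub, map_sub, leftOp_mul, leftOp_mul] at e2
  have c := leftOp_rightOp (V₁ := V₁) (V₂ := V₂) (m := m)
  have key : opElem ρ₁ ρ₂ I J * opElem ρ₁ ρ₂ K L - opElem ρ₁ ρ₂ K L * opElem ρ₁ ρ₂ I J =
      (leftOp (if J = K then projElem coordOp partialD (elemOp (infinitesimal ρ₂)) I L else 0) -
      leftOp (if L = I then projElem coordOp partialD (elemOp (infinitesimal ρ₂)) K J else 0)) -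
      (rightOp (if J = K then projElem coordOp partialD (elemOp (infinitesimal ρ₁)) I L else 0) -
      rightOp (if L = I then projElem coordOp partialD (elemOp (infinitesimal ρ₁)) K J else 0)) := by
    rw [← e1, ← e2]
    simp only [opElem, mul_sub, sub_mul, c]
    abel
  rw [key]
  simp only [opElem]
  split_ifs <;> (try simp only [map_zero]) <;> abel

theorem casimirOperator_comm
    (h₁ : ∀ A B, infinitesimal ρ₁ (A * B - B * A) =
      infinitesimal ρ₁ A * infinitesimal ρ₁ B - infinitesimal ρ₁ B * infinitesimal ρ₁ A)
    (h₂ : ∀ A B, infinitesimal ρ₂ (A * B - B * A) =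
      infinitesimal ρ₂ A * infinitesimal ρ₂ B - infinitesimal ρ₂ B * infinitesimal ρ₂ A)
    (h : SL m) (D : Operator m V₁ V₂) :
    casimirOperator ρ₁ ρ₂ (lieOperator ρ₁ ρ₂ h D) =
      lieOperator ρ₁ ρ₂ h (casimirOperator ρ₁ ρ₂ D) := by
  have : Commute (casimirOperator ρ₁ ρ₂) (lieOperator ρ₁ ρ₂ h) := by
    rw [casimirOperator_eq, lieOperator_eq]
    refine Commute.smul_left (Commute.sum_right _ _ _ fun I _ => Commute.sum_right _ _ _ fun J _ =>
      Commute.smul_right ?_ _) _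
    exact (isGL_opElem h₁ h₂).commute_casimir I J
  exact LinearMap.congr_fun this.eq D

end CasimirOperators

/-! ### The actions on the fibre -/

section FibreActions

variable {m : ℕ} {V₁ V₂ : Type*}
  [NormedAddCommGroup V₁] [NormedSpace ℝ V₁] [FiniteDimensional ℝ V₁]
  [NormedAddCommGroup V₂] [NormedSpace ℝ V₂] [FiniteDimensional ℝ V₂]

variable (ρ₁ : Representation ℝ (GL (Fin m) ℝ) V₁) (ρ₂ : Representation ℝ (GL (Fin m) ℝ) V₂)

set_option linter.unusedSectionVars false

scoped instance : Ring (Module.End ℝ (Fibre m V₁ V₂)) := Module.End.instRing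

scoped instance : Algebra ℝ (Module.End ℝ (Fibre m V₁ V₂)) := Module.End.instAlgebra ℝ ℝ _

scoped instance : SMul ℝ (Module.End ℝ (Fibre m V₁ V₂)) := LinearMap.instSMul

/-- A bounded endomorphism of `Hom(V₁, V₂)`, applied to the coefficients of a polynomial. -/
def fibCoeff (u : (V₁ →L[ℝ] V₂) →L[ℝ] (V₁ →L[ℝ] V₂)) : Module.End ℝ (Fibre m V₁ V₂) :=
  coeffMap u.toLinearMap

theorem fibCoeff_mul (u v : (V₁ →L[ℝ] V₂) →L[ℝ] (V₁ →L[ℝ] V₂)) :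
    (fibCoeff (u * v) : Module.End ℝ (Fibre m V₁ V₂)) = fibCoeff u * fibCoeff v :=
  LinearMap.ext fun _ => Finsupp.ext fun _ => rfl

theorem fibCoeff_sub (u v : (V₁ →L[ℝ] V₂) →L[ℝ] (V₁ →L[ℝ] V₂)) :
    (fibCoeff (u - v) : Module.End ℝ (Fibre m V₁ V₂)) = fibCoeff u - fibCoeff v :=
  coeffMap_sub _ _

theorem fibCoeff_zero : (fibCoeff 0 : Module.End ℝ (Fibre m V₁ V₂)) = 0 :=
  LinearMap.ext fun _ => Finsupp.ext fun _ => rfl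

variable (V₁ V₂) in
/-- Multiplication by `ξ_i`. -/
def fibΞ (i : Fin m) : Module.End ℝ (Fibre m V₁ V₂) := xiMul i

variable (V₁ V₂) in
/-- The derivation `∂/∂ξ_i`. -/
def fibY (i : Fin m) : Module.End ℝ (Fibre m V₁ V₂) := xiDer i

variable (V₁) in
/-- Composition on the left with `ρ₂_*(E_{ij})`. -/
def fibL (i j : Fin m) : Module.End ℝ (Fibre m V₁ V₂) :=
  fibCoeff (compLeft (infinitesimal ρ₂ (Matrix.single i j 1)))

variable (V₂) in
/-- Composition on the right with `ρ₁_*(E_{ij})`. -/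
def fibB (i j : Fin m) : Module.End ℝ (Fibre m V₁ V₂) :=
  fibCoeff (compRight (infinitesimal ρ₁ (Matrix.single i j 1)))

/-- The action of `E_{ij}`. -/
def fibR (i j : Fin m) : Module.End ℝ (Fibre m V₁ V₂) :=
  fibΞ V₁ V₂ i * fibY V₁ V₂ j + (fibL V₁ ρ₂ i j - fibB V₂ ρ₁ i j)

variable (V₂) in
/-- The operator `γ(ε^j)` on the fibre. -/
def fibGamma (j : Fin m) : Module.End ℝ (Fibre m V₁ V₂) :=
  gammaElem (fibΞ V₁ V₂) (fibY V₁ V₂) (fibB V₂ ρ₁) j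

/-- The Casimir operator `C` on the fibre. -/
def fibCasimir : Module.End ℝ (Fibre m V₁ V₂) :=
  (2 * (m + 1) : ℝ)⁻¹ • (∑ i, ∑ j, fibR ρ₁ ρ₂ i j * fibR ρ₁ ρ₂ j i +
    (∑ i, fibR ρ₁ ρ₂ i i) * (∑ i, fibR ρ₁ ρ₂ i i) +
    (m + 1 : Module.End ℝ (Fibre m V₁ V₂)) * ∑ i, fibR ρ₁ ρ₂ i i)

theorem fibreAct_eq (M : Matrix (Fin m) (Fin m) ℝ) :
    fibreAct ρ₁ ρ₂ M = ∑ i, ∑ j, M i j • fibR ρ₁ ρ₂ i j := by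
  have h1 : (coeffMap (homAct ρ₁ ρ₂ M).toLinearMap : Module.End ℝ (Fibre m V₁ V₂)) =
      ∑ i, ∑ j, M i j • (fibL V₁ ρ₂ i j - fibB V₂ ρ₁ i j) := by
    conv_lhs => rw [Matrix.matrix_eq_sum_single M]
    refine LinearMap.ext fun P => Finsupp.ext fun α => ?_
    have e : ∀ i j, homAct ρ₁ ρ₂ (Matrix.single i j (M i j)) =
        M i j • homAct ρ₁ ρ₂ (Matrix.single i j 1) := fun i j => by
      rw [← map_smul, Matrix.smul_single, smul_eq_mul, mul_one]
    rw [coeffMap_apply, map_sum]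
    simp only [map_sum, e, LinearMap.sum_apply, Finsupp.finsetSum_apply,
      ContinuousLinearMap.coe_coe, sum_apply]
    rfl
  rw [fibreAct, h1]
  simp only [← Finset.sum_add_distrib, ← smul_add, xiD_eq]
  rfl

theorem fibreAct_single (i j : Fin m) :
    fibreAct ρ₁ ρ₂ (Matrix.single i j 1) = fibR ρ₁ ρ₂ i j := by
  rw [fibreAct_eq]
  simp [Matrix.single_apply, ite_and]

theorem fibCoeff_xiMul (u : (V₁ →L[ℝ] V₂) →L[ℝ] (V₁ →L[ℝ] V₂)) (k : Fin m) :
    fibCoeff u * fibΞ V₁ V₂ k = fibΞ V₁ V₂ k * fibCoeff u :=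
  LinearMap.ext fun P => coeffMap_xiMul _ k P

theorem fibCoeff_xiDer (u : (V₁ →L[ℝ] V₂) →L[ℝ] (V₁ →L[ℝ] V₂)) (k : Fin m) :
    fibCoeff u * fibY V₁ V₂ k = fibY V₁ V₂ k * fibCoeff u :=
  LinearMap.ext fun P => coeffMap_xiDer _ k P

theorem compLeft_mul (u v : V₂ →L[ℝ] V₂) :
    (compLeft (u * v) : (V₁ →L[ℝ] V₂) →L[ℝ] (V₁ →L[ℝ] V₂)) = compLeft u * compLeft v := rfl

theorem compRight_mul (u v : V₁ →L[ℝ] V₁) :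
    (compRight (u * v) : (V₁ →L[ℝ] V₂) →L[ℝ] (V₁ →L[ℝ] V₂)) = compRight v * compRight u := rfl

theorem single_mul_single (i j k l : Fin m) :
    (Matrix.single i j 1 * Matrix.single k l 1 : Matrix (Fin m) (Fin m) ℝ) =
      if j = k then Matrix.single i l 1 else 0 := by
  split_ifs with h
  · subst h; simp
  · simp [h]

variable {ρ₁ ρ₂}

theorem fibreSystem
    (h₁ : ∀ A B, infinitesimal ρ₁ (A * B - B * A) =
      infinitesimal ρ₁ A * infinitesimal ρ₁ B - infinitesimal ρ₁ B * infinitesimal ρ₁ A)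
    (h₂ : ∀ A B, infinitesimal ρ₂ (A * B - B * A) =
      infinitesimal ρ₂ A * infinitesimal ρ₂ B - infinitesimal ρ₂ B * infinitesimal ρ₂ A) :
    FibreSystem (fibΞ V₁ V₂) (fibY V₁ V₂) (fibL V₁ ρ₂) (fibB V₂ ρ₁) where
  ΞΞ i j := LinearMap.ext fun P => xiMul_comm i j P
  YY i j := LinearMap.ext fun P => xiDer_comm i j P
  YΞ i j := LinearMap.ext fun P => by
    refine (xiDer_xiMul i j P).trans ?_
    rw [LinearMap.add_apply]
    split_ifs <;> rfl
  LΞ i j k := fibCoeff_xiMul _ k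
  LY i j k := fibCoeff_xiDer _ k
  BΞ i j k := fibCoeff_xiMul _ k
  BY i j k := fibCoeff_xiDer _ k
  LB i j k l := by
    rw [fibL, fibB, ← fibCoeff_mul, ← fibCoeff_mul]
    rfl
  LL i j k l := by
    have := h₂ (Matrix.single i j 1) (Matrix.single k l 1)
    rw [fibL, fibL, ← fibCoeff_mul, ← fibCoeff_mul, ← compLeft_mul, ← compLeft_mul, ← fibCoeff_sub,
      compLeft, compLeft, ← map_sub, ← this, single_mul_single, single_mul_single, map_sub, map_sub,
      fibCoeff_sub]
    congr 1 <;> split_ifs <;> first | rfl | (rw [map_zero, map_zero, fibCoeff_zero])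
  -- Right composition reverses products, whence the exchanged order in this relation.
  BB i j k l := by
    have := h₁ (Matrix.single i j 1) (Matrix.single k l 1)
    rw [fibB, fibB, ← fibCoeff_mul, ← fibCoeff_mul, ← compRight_mul, ← compRight_mul,
      ← fibCoeff_sub, compRight, compRight, ← map_sub, ← this, single_mul_single,
      single_mul_single, map_sub, map_sub, fibCoeff_sub]
    congr 1 <;> split_ifs <;> first | rfl | (rw [map_zero, map_zero, fibCoeff_zero])

theorem valueAt_coeffMap_postComp (x : Fin m → ℝ) (u : (V₁ →L[ℝ] V₂) →L[ℝ] (V₁ →L[ℝ] V₂))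
    (T : Symbol m V₁ V₂) : valueAt x (coeffMap (postComp u) T) = fibCoeff u (valueAt x T) :=
  Finsupp.ext fun _ => rfl

/-- `a` acts on symbols pointwise, through `u`. -/
def Pointwise (a : Module.End ℝ (Symbol m V₁ V₂)) (u : Module.End ℝ (Fibre m V₁ V₂)) : Prop :=
  ∀ x T, valueAt x (a T) = u (valueAt x T)

namespace Pointwise

variable {a b : Module.End ℝ (Symbol m V₁ V₂)} {u v : Module.End ℝ (Fibre m V₁ V₂)}

theorem add (h : Pointwise a u) (h' : Pointwise b v) : Pointwise (a + b) (u + v) := fun x T => by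
  rw [LinearMap.add_apply, map_add, h, h', LinearMap.add_apply]

theorem sub (h : Pointwise a u) (h' : Pointwise b v) : Pointwise (a - b) (u - v) := fun x T => by
  rw [LinearMap.sub_apply, map_sub, h, h', LinearMap.sub_apply]

theorem neg (h : Pointwise a u) : Pointwise (-a) (-u) := fun x T => by
  rw [LinearMap.neg_apply, map_neg, h, LinearMap.neg_apply]

theorem smul (c : ℝ) (h : Pointwise a u) : Pointwise (c • a) (c • u) := fun x T => by
  rw [LinearMap.smul_apply, map_smul, h, LinearMap.smul_apply]

theorem mul (h : Pointwise a u) (h' : Pointwise b v) : Pointwise (a * b) (u * v) := fun x T => by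
  rw [Module.End.mul_apply, h, h', Module.End.mul_apply]

theorem one : Pointwise (1 : Module.End ℝ (Symbol m V₁ V₂)) 1 := fun _ _ => rfl

theorem natCast (n : ℕ) : Pointwise (n : Module.End ℝ (Symbol m V₁ V₂)) n := fun x T => by
  rw [Module.End.natCast_apply, map_nsmul, Module.End.natCast_apply]

theorem sum {ι : Type*} (s : Finset ι) {a : ι → Module.End ℝ (Symbol m V₁ V₂)}
    {u : ι → Module.End ℝ (Fibre m V₁ V₂)} (h : ∀ i, Pointwise (a i) (u i)) :
    Pointwise (∑ i ∈ s, a i) (∑ i ∈ s, u i) := fun x T => by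
  rw [LinearMap.sum_apply, LinearMap.sum_apply, map_sum]
  exact Finset.sum_congr rfl fun i _ => h i x T

theorem xiMul (i : Fin m) : Pointwise (symΞ V₁ V₂ i) (fibΞ V₁ V₂ i) := fun _ T =>
  coeffMap_xiMul _ i T

theorem xiDer (i : Fin m) : Pointwise (symY V₁ V₂ i) (fibY V₁ V₂ i) := fun _ T =>
  coeffMap_xiDer _ i T

end Pointwise

theorem pointwise_symR (i j : Fin m) : Pointwise (symR ρ₁ ρ₂ i j) (fibR ρ₁ ρ₂ i j) :=
  ((Pointwise.xiMul i).mul (Pointwise.xiDer j)).add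
    (Pointwise.sub (fun x T => valueAt_coeffMap_postComp x _ T)
      (fun x T => valueAt_coeffMap_postComp x _ T))

theorem pointwise_symGamma (j : Fin m) : Pointwise (symGamma V₂ ρ₁ j) (fibGamma V₂ ρ₁ j) := by
  have hB : ∀ i j, Pointwise (symB V₂ ρ₁ i j) (fibB V₂ ρ₁ i j) := fun i j x T =>
    valueAt_coeffMap_postComp x _ T
  exact (((Pointwise.sum _ fun i => (Pointwise.xiMul i).mul (Pointwise.xiDer i)).neg.mul
    (Pointwise.xiDer j)).add ((Pointwise.sum _ fun i => hB i i).mul (Pointwise.xiDer j))).add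
    (Pointwise.sum _ fun i => (hB i j).mul (Pointwise.xiDer i))

/-- `WeylSystem.sum_projElem_mul` rewrites `C` in terms of the `r_{ij}` alone, and these act on each
value separately. -/
theorem pointwise_casimirSymbol : Pointwise (casimirSymbol ρ₁ ρ₂) (fibCasimir ρ₁ ρ₂) := by
  have h := (weylSystem_symbol ρ₁ ρ₂).sum_projElem_mul
  rw [casimirSymbol_eq]
  have e : ∑ I, ∑ J, symElem ρ₁ ρ₂ I J * symElem ρ₁ ρ₂ J I = _ := h
  rw [e]
  exact .smul _ (((Pointwise.sum _ fun i => .sum _ fun j =>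
    (pointwise_symR i j).mul (pointwise_symR j i)).add
    ((Pointwise.sum _ fun i => pointwise_symR i i).mul
      (Pointwise.sum _ fun i => pointwise_symR i i))).add
    (((Pointwise.natCast m).add .one).mul (Pointwise.sum _ fun i => pointwise_symR i i)))

theorem symbol_ext {T U : Symbol m V₁ V₂} (h : ∀ x, valueAt x T = valueAt x U) : T = U :=
  Finsupp.ext fun α => Subtype.ext (funext fun x => DFunLike.congr_fun (h x) α)

theorem fibCasimir_comm
    (h₁ : ∀ A B, infinitesimal ρ₁ (A * B - B * A) =
      infinitesimal ρ₁ A * infinitesimal ρ₁ B - infinitesimal ρ₁ B * infinitesimal ρ₁ A)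
    (h₂ : ∀ A B, infinitesimal ρ₂ (A * B - B * A) =
      infinitesimal ρ₂ A * infinitesimal ρ₂ B - infinitesimal ρ₂ B * infinitesimal ρ₂ A)
    (i j : Fin m) : Commute (fibCasimir ρ₁ ρ₂) (fibR ρ₁ ρ₂ i j) := by
  have hr : IsGL (fibR ρ₁ ρ₂) := (fibreSystem h₁ h₂).isGL
  have ht : Commute (∑ i, fibR ρ₁ ρ₂ i i) (fibR ρ₁ ρ₂ i j) := WeylSystem.tr_r hr i j
  have hs : Commute (∑ i, ∑ j, fibR ρ₁ ρ₂ i j * fibR ρ₁ ρ₂ j i) (fibR ρ₁ ρ₂ i j) :=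
    hr.commute_casimir i j
  have hm : Commute (m + 1 : Module.End ℝ (Fibre m V₁ V₂)) (fibR ρ₁ ρ₂ i j) :=
    (Nat.cast_commute m _).add_left (Commute.one_left _)
  exact Commute.smul_left ((hs.add_left (ht.mul_left ht)).add_left (hm.mul_left ht)) _

theorem fibGamma_equivariant
    (h₁ : ∀ A B, infinitesimal ρ₁ (A * B - B * A) =
      infinitesimal ρ₁ A * infinitesimal ρ₁ B - infinitesimal ρ₁ B * infinitesimal ρ₁ A)
    (h₂ : ∀ A B, infinitesimal ρ₂ (A * B - B * A) =
      infinitesimal ρ₂ A * infinitesimal ρ₂ B - infinitesimal ρ₂ B * infinitesimal ρ₂ A)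
    (a b j : Fin m) : fibR ρ₁ ρ₂ a b * fibGamma V₂ ρ₁ j =
      fibGamma V₂ ρ₁ j * fibR ρ₁ ρ₂ a b - if j = a then fibGamma V₂ ρ₁ b else 0 :=
  (fibreSystem h₁ h₂).gammaElem_equivariant a b j

theorem fibR_mem_homogeneous (i j : Fin m) {k : ℕ} {P : Fibre m V₁ V₂}
    (hP : P ∈ homogeneous m (V₁ →L[ℝ] V₂) k) :
    fibR ρ₁ ρ₂ i j P ∈ homogeneous m (V₁ →L[ℝ] V₂) k := by
  refine Submodule.add_mem _ ?_ (Submodule.sub_mem _ (coeffMap_mem_homogeneous _ hP)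
    (coeffMap_mem_homogeneous _ hP))
  cases k with
  | zero =>
    change xiMul i (xiDer j P) ∈ _
    rw [xiDer_eq_zero j hP, map_zero]
    exact Submodule.zero_mem _
  | succ k => exact xiMul_mem_homogeneous i (xiDer_mem_homogeneous j hP)

/-- Each term of `γ(ε^j)` begins by applying some `∂/∂ξ_i`. -/
theorem fibGamma_eq_zero (j : Fin m) {P : Fibre m V₁ V₂}
    (hP : P ∈ homogeneous m (V₁ →L[ℝ] V₂) 0) : fibGamma V₂ ρ₁ j P = 0 := by
  have h : ∀ i, fibY V₁ V₂ i P = 0 := fun i => xiDer_eq_zero i hP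
  simp [fibGamma, gammaElem, h, LinearMap.sum_apply]

theorem fibGamma_mem_homogeneous (j : Fin m) {k : ℕ} {P : Fibre m V₁ V₂}
    (hP : P ∈ homogeneous m (V₁ →L[ℝ] V₂) (k + 1)) :
    fibGamma V₂ ρ₁ j P ∈ homogeneous m (V₁ →L[ℝ] V₂) k := by
  have h : ∀ i, fibY V₁ V₂ i P ∈ homogeneous m (V₁ →L[ℝ] V₂) k := fun i =>
    xiDer_mem_homogeneous i hP
  have hB : ∀ i j, ∀ Q ∈ homogeneous m (V₁ →L[ℝ] V₂) k,
      fibB V₂ ρ₁ i j Q ∈ homogeneous m (V₁ →L[ℝ] V₂) k := fun i j Q hQ =>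
    coeffMap_mem_homogeneous _ hQ
  have hE : ∀ i, ∀ Q ∈ homogeneous m (V₁ →L[ℝ] V₂) k,
      fibΞ V₁ V₂ i (fibY V₁ V₂ i Q) ∈ homogeneous m (V₁ →L[ℝ] V₂) k := by
    intro i Q hQ
    -- For polynomials of degree 0 the operator `ξ_i ∂/∂ξ_i` vanishes; otherwise it lowers and then
    -- restores the degree.
    cases k with
    | zero =>
      change xiMul i (xiDer i Q) ∈ _
      rw [xiDer_eq_zero i hQ, map_zero]
      exact Submodule.zero_mem _
    | succ k => exact xiMul_mem_homogeneous i (xiDer_mem_homogeneous i hQ)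
  refine Submodule.add_mem _ (Submodule.add_mem _ ?_ ?_) ?_
  · rw [Module.End.mul_apply, LinearMap.neg_apply, LinearMap.sum_apply]
    exact Submodule.neg_mem _ (Submodule.sum_mem _ fun i _ => hE i _ (h j))
  · rw [Module.End.mul_apply, LinearMap.sum_apply]
    exact Submodule.sum_mem _ fun i _ => hB i i _ (h j)
  · rw [LinearMap.sum_apply]
    exact Submodule.sum_mem _ fun i _ => hB i j _ (h i)

end FibreActions

/-! ### Differentials of representations of `GL(m, ℝ)` -/

section Differential

attribute [local instance] Matrix.normedAddCommGroup Matrix.normedSpace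

open Filter Topology

variable {m : ℕ} {V : Type*} [NormedAddCommGroup V] [NormedSpace ℝ V] [FiniteDimensional ℝ V]

set_option linter.unusedSectionVars false

open Classical in
/-- A representation of `GL(m, ℝ)`, extended by `0` to all matrices. -/
def extendRep (ρ : Representation ℝ (GL (Fin m) ℝ) V) (A : Matrix (Fin m) (Fin m) ℝ) : V →L[ℝ] V :=
  if h : IsUnit A then LinearMap.toContinuousLinearMap (ρ h.unit) else 0

theorem infinitesimal_apply (ρ : Representation ℝ (GL (Fin m) ℝ) V)
    (B : Matrix (Fin m) (Fin m) ℝ) : infinitesimal ρ B = fderiv ℝ (extendRep ρ) 1 B := rfl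

theorem extendRep_mul (ρ : Representation ℝ (GL (Fin m) ℝ) V) {A B : Matrix (Fin m) (Fin m) ℝ}
    (hA : IsUnit A) (hB : IsUnit B) : extendRep ρ (A * B) = extendRep ρ A * extendRep ρ B := by
  have h : (hA.mul hB).unit = hA.unit * hB.unit := Units.ext rfl
  rw [extendRep, extendRep, extendRep, dif_pos hA, dif_pos hB, dif_pos (hA.mul hB), h, map_mul]
  rfl

theorem eventually_isUnit : ∀ᶠ A in 𝓝 (1 : Matrix (Fin m) (Fin m) ℝ), IsUnit A := by
  have h : ContinuousAt (fun A : Matrix (Fin m) (Fin m) ℝ => A.det) 1 :=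
    (continuous_id.matrix_det).continuousAt
  filter_upwards [h.eventually_ne (by simp : (1 : Matrix (Fin m) (Fin m) ℝ).det ≠ 0)] with A hA
  exact (Matrix.isUnit_iff_isUnit_det A).2 (isUnit_iff_ne_zero.2 hA)

/-- With `F = extendRep ρ`, differentiating `F(AX) = F(A) F(X)` in `X` and then in `A` expresses the
product `DF(A) DF(B)` as `D²F(A, B) + DF(AB)`. The second derivative is symmetric, so it disappears
from the commutator. -/
theorem infinitesimal_bracket (ρ : Representation ℝ (GL (Fin m) ℝ) V)
    (hρ : ContDiffAt ℝ 2 (extendRep ρ) 1) (A B : Matrix (Fin m) (Fin m) ℝ) :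
    infinitesimal ρ (A * B - B * A) =
      infinitesimal ρ A * infinitesimal ρ B - infinitesimal ρ B * infinitesimal ρ A := by
  let F := extendRep ρ
  let L : Matrix (Fin m) (Fin m) ℝ → Matrix (Fin m) (Fin m) ℝ →L[ℝ] Matrix (Fin m) (Fin m) ℝ :=
    fun A => LinearMap.toContinuousLinearMap (LinearMap.mulLeft ℝ A)
  let R : Matrix (Fin m) (Fin m) ℝ → Matrix (Fin m) (Fin m) ℝ →L[ℝ] Matrix (Fin m) (Fin m) ℝ :=
    fun A => LinearMap.toContinuousLinearMap (LinearMap.mulRight ℝ A)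
  have hd : ∀ᶠ A in 𝓝 (1 : Matrix (Fin m) (Fin m) ℝ), DifferentiableAt ℝ F A := by
    filter_upwards [hρ.eventually (by simp)] with A hA
    exact hA.differentiableAt (by simp)
  -- Derivative of `X ↦ F(AX) = F(A) F(X)` at the identity, for `A` near the identity so that
  -- everything is invertible.
  have h1 : ∀ B, ∀ᶠ A in 𝓝 (1 : Matrix (Fin m) (Fin m) ℝ),
      fderiv ℝ F A (A * B) = F A * fderiv ℝ F 1 B := by
    intro B
    filter_upwards [hd, eventually_isUnit] with A hA hu
    have e : (fun X => F (L A X)) =ᶠ[𝓝 1] fun X => F A * F X := by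
      filter_upwards [eventually_isUnit] with X hX
      exact extendRep_mul ρ hu hX
    have hL : L A 1 = A := mul_one A
    have d1 : HasFDerivAt (fun X => F (L A X)) ((fderiv ℝ F A).comp (L A)) 1 := by
      have d0 : HasFDerivAt F (fderiv ℝ F A) (L A 1) := by
        rw [hL]
        exact hA.hasFDerivAt
      exact d0.comp (1 : Matrix (Fin m) (Fin m) ℝ) (L A).hasFDerivAt
    have d2 : HasFDerivAt (fun X => F A * F X) (F A • fderiv ℝ F 1) 1 :=
      (hd.self_of_nhds.hasFDerivAt).const_mul (F A)
    have := (d1.congr_of_eventuallyEq e.symm).unique d2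
    exact DFunLike.congr_fun this B
  have hd2 : DifferentiableAt ℝ (fderiv ℝ F) 1 :=
    (hρ.fderiv_right (m := 1) (by norm_num)).differentiableAt (by simp)
  -- The previous identity, differentiated at the identity in the direction `A`.
  have h2 : ∀ A B, fderiv ℝ F 1 A * fderiv ℝ F 1 B =
      fderiv ℝ (fderiv ℝ F) 1 A B + fderiv ℝ F 1 (A * B) := by
    intro A B
    have d1 : HasFDerivAt (fun X => fderiv ℝ F X (R B X)) _ 1 :=
      hd2.hasFDerivAt.clm_apply (R B).hasFDerivAt
    have d2 : HasFDerivAt (fun X => F X * fderiv ℝ F 1 B) _ 1 :=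
      (hd.self_of_nhds.hasFDerivAt).mul_const' (fderiv ℝ F 1 B)
    have e : (fun X => fderiv ℝ F X (R B X)) =ᶠ[𝓝 1] fun X => F X * fderiv ℝ F 1 B := h1 B
    have := DFunLike.congr_fun ((d2.congr_of_eventuallyEq e).unique d1) A
    refine Eq.trans this ?_
    have hR : R B 1 = B := one_mul B
    simp only [hR]
    exact add_comm _ _
  have hs : fderiv ℝ (fderiv ℝ F) 1 A B = fderiv ℝ (fderiv ℝ F) 1 B A :=
    (hρ.isSymmSndFDerivAt (by rw [minSmoothness_of_isRCLikeNormedField])) A B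
  rw [infinitesimal_apply, infinitesimal_apply, infinitesimal_apply]
  change fderiv ℝ F 1 _ = fderiv ℝ F 1 A * fderiv ℝ F 1 B - fderiv ℝ F 1 B * fderiv ℝ F 1 A
  rw [h2, h2, hs, map_sub]
  abel

theorem infinitesimal_one_of_scalar (ρ : Representation ℝ (GL (Fin m) ℝ) V)
    (hρ : ContDiffAt ℝ 2 (extendRep ρ) 1) (φ : ℝ → ℝ) (hφ : DifferentiableAt ℝ φ 1)
    (h : ∀ᶠ t in 𝓝 (1 : ℝ), extendRep ρ (t • 1) = φ t • 1) :
    infinitesimal ρ 1 = deriv φ 1 • 1 := by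
  have hF : HasFDerivAt (extendRep ρ) (fderiv ℝ (extendRep ρ) 1)
      ((1 : ℝ) • (1 : Matrix (Fin m) (Fin m) ℝ)) := by
    rw [one_smul]
    exact (hρ.differentiableAt (by simp)).hasFDerivAt
  have d1 := hF.comp_hasDerivAt (1 : ℝ)
    ((hasDerivAt_id (1 : ℝ)).smul_const (1 : Matrix (Fin m) (Fin m) ℝ))
  have d2 : HasDerivAt (fun t => φ t • (1 : V →L[ℝ] V)) (deriv φ 1 • (1 : V →L[ℝ] V)) 1 :=
    hφ.hasDerivAt.smul_const (1 : V →L[ℝ] V)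
  rw [one_smul] at d1
  exact d1.unique (d2.congr_of_eventuallyEq h)

/-- Both sides are derivatives at the identity of functions of `A` that agree on invertible
matrices. -/
theorem form_infinitesimal (ρ : Representation ℝ (GL (Fin m) ℝ) V)
    (hρ : ContDiffAt ℝ 2 (extendRep ρ) 1) (β : LinearMap.BilinForm ℝ V)
    (h : ∀ A : Matrix (Fin m) (Fin m) ℝ, IsUnit A → ∀ u v,
      β (extendRep ρ A.transpose u) v = β u (extendRep ρ A v))
    (B : Matrix (Fin m) (Fin m) ℝ) (u v : V) :
    β (infinitesimal ρ B.transpose u) v = β u (infinitesimal ρ B v) := by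
  let F := extendRep ρ
  let τ : Matrix (Fin m) (Fin m) ℝ →L[ℝ] Matrix (Fin m) (Fin m) ℝ :=
    LinearMap.toContinuousLinearMap (Matrix.transposeLinearEquiv (Fin m) (Fin m) ℝ ℝ).toLinearMap
  let f₁ : (V →L[ℝ] V) →L[ℝ] ℝ := LinearMap.toContinuousLinearMap
    { toFun := fun a => β (a u) v
      map_add' := fun a b => by simp
      map_smul' := fun c a => by simp }
  let f₂ : (V →L[ℝ] V) →L[ℝ] ℝ := LinearMap.toContinuousLinearMap
    { toFun := fun a => β u (a v)
      map_add' := fun a b => by simp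
      map_smul' := fun c a => by simp }
  have hF : HasFDerivAt F (fderiv ℝ F 1) 1 := (hρ.differentiableAt (by simp)).hasFDerivAt
  have hF' : HasFDerivAt F (fderiv ℝ F 1) (τ 1) := by
    have : τ 1 = 1 := Matrix.transpose_one
    rw [this]
    exact hF
  have d1 := f₁.hasFDerivAt.comp (1 : Matrix (Fin m) (Fin m) ℝ)
    (hF'.comp (1 : Matrix (Fin m) (Fin m) ℝ) τ.hasFDerivAt)
  have d2 := f₂.hasFDerivAt.comp (1 : Matrix (Fin m) (Fin m) ℝ) hF
  refine DFunLike.congr_fun (d1.unique (d2.congr_of_eventuallyEq ?_)) B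
  filter_upwards [eventually_isUnit] with A hA
  exact h A hA u v

/-- Since `E` is finite-dimensional, a linear map is given by its finitely many values on a basis.
-/
theorem contDiffAt_clm_of_apply {D E G : Type*} [NormedAddCommGroup D] [NormedSpace ℝ D]
    [NormedAddCommGroup E] [NormedSpace ℝ E] [NormedAddCommGroup G] [NormedSpace ℝ G]
    [FiniteDimensional ℝ E] {n : WithTop ℕ∞} {f : D → E →L[ℝ] G} {x : D}
    (h : ∀ v, ContDiffAt ℝ n (fun y => f y v) x) : ContDiffAt ℝ n f x := by
  let d := Module.finrank ℝ E
  have hd : d = Module.finrank ℝ (Fin d → ℝ) := (Module.finrank_fin_fun ℝ).symm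
  let e₁ := ContinuousLinearEquiv.ofFinrankEq hd
  let e₂ := (e₁.arrowCongr (1 : G ≃L[ℝ] G)).trans (ContinuousLinearEquiv.piRing (Fin d))
  rw [← Function.id_comp f, ← e₂.symm_comp_self]
  exact e₂.symm.contDiff.contDiffAt.comp x (contDiffAt_pi.mpr fun i => h _)

end Differential

/-! ### Differential and invariant form of the tensor representations. -/

section TensorRep

attribute [local instance] Matrix.normedAddCommGroup Matrix.normedSpace

variable {m : ℕ}

theorem extendRep_tensorRep (D : YoungDiagram) (w : ℝ) (z : ℤ) {A : Matrix (Fin m) (Fin m) ℝ}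
    (hA : IsUnit A) (v : schurModule m D) :
    (extendRep (tensorRep m D w z) A v : Tensors m D.cells) =
      (|A.det| ^ w * A.det ^ z) • tensorPow D.cells A v := by
  rw [extendRep, dif_pos hA]
  rfl

theorem contDiffAt_tensorRep (D : YoungDiagram) (w : ℝ) (z : ℤ) :
    ContDiffAt ℝ 2 (extendRep (tensorRep m D w z)) 1 := by
  -- A linear projection onto the Schur module reduces smoothness to the full tensor space, where
  -- the entries are polynomials in `A`.
  obtain ⟨p, hp⟩ := (schurModule m D).subtype.exists_leftInverse_of_injective
    (LinearMap.ker_eq_bot.2 (schurModule m D).injective_subtype)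
  let p' := LinearMap.toContinuousLinearMap p
  have hdet : ContDiff ℝ 2 fun A : Matrix (Fin m) (Fin m) ℝ => A.det := by
    simp only [Matrix.det_apply']
    fun_prop
  have h1 : (1 : Matrix (Fin m) (Fin m) ℝ).det ≠ 0 := by simp
  have hten : ∀ v : Tensors m D.cells,
      ContDiff ℝ 2 fun A : Matrix (Fin m) (Fin m) ℝ => tensorPow D.cells A v := by
    intro v
    refine contDiff_pi.2 fun i => ?_
    change ContDiff ℝ 2 fun A : Matrix (Fin m) (Fin m) ℝ =>
      ∑ j : D.cells → Fin m, (∏ c, A (i c) (j c)) * v j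
    fun_prop
  have hsc : ContDiffAt ℝ 2 (fun A : Matrix (Fin m) (Fin m) ℝ => |A.det| ^ w * A.det ^ z) 1 := by
    have habs : ContDiffAt ℝ 2 (fun A : Matrix (Fin m) (Fin m) ℝ => |A.det|) 1 :=
      (contDiffAt_abs h1).comp _ hdet.contDiffAt
    refine (habs.rpow_const_of_ne (abs_ne_zero.2 h1)).mul ?_
    cases z with
    | ofNat n =>
      simp only [Int.ofNat_eq_natCast, zpow_natCast]
      exact hdet.contDiffAt.pow n
    | negSucc n =>
      simp only [zpow_negSucc]
      exact (hdet.contDiffAt.pow (n + 1)).inv (pow_ne_zero _ h1)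
  refine contDiffAt_clm_of_apply fun v => ?_
  have h2 : ContDiffAt ℝ 2 (fun A : Matrix (Fin m) (Fin m) ℝ =>
      p' ((|A.det| ^ w * A.det ^ z) • tensorPow D.cells A v)) 1 :=
    p'.contDiff.contDiffAt.comp _ (hsc.smul (hten v).contDiffAt)
  refine h2.congr_of_eventuallyEq ?_
  filter_upwards [eventually_isUnit] with A hA
  rw [← extendRep_tensorRep D w z hA]
  exact (LinearMap.congr_fun hp _).symm

theorem tensorPow_smul_one (ι : Type) [Fintype ι] [DecidableEq ι] (c : ℝ) (t : Tensors m ι) :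
    tensorPow ι (c • (1 : Matrix (Fin m) (Fin m) ℝ)) t = c ^ Fintype.card ι • t := by
  have h := LinearMap.congr_fun (tensorPow_one (m := m) ι) t
  have e : tensorPow ι (c • (1 : Matrix (Fin m) (Fin m) ℝ)) t =
      c ^ Fintype.card ι • tensorPow ι (1 : Matrix (Fin m) (Fin m) ℝ) t := by
    funext i
    change ∑ j : ι → Fin m, (∏ k, (c • (1 : Matrix (Fin m) (Fin m) ℝ)) (i k) (j k)) * t j =
      c ^ Fintype.card ι * ∑ j : ι → Fin m, (∏ k, (1 : Matrix (Fin m) (Fin m) ℝ) (i k) (j k)) * t j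
    simp only [Matrix.smul_apply, smul_eq_mul, Finset.prod_mul_distrib, Finset.prod_const,
      Finset.card_univ, Finset.mul_sum, mul_assoc]
  rw [e, h]
  rfl

/-- A scalar matrix `t` acts by a scalar: its determinant is `t^m`, and on tensors with one factor
per box it acts by `t` to the number of boxes. -/
theorem infinitesimal_tensorRep_one (D : YoungDiagram) (w : ℝ) (z : ℤ) :
    ∃ s : ℝ, infinitesimal (tensorRep m D w z) 1 = s • 1 := by
  let φ : ℝ → ℝ := fun t => |t ^ m| ^ w * (t ^ m) ^ z * t ^ Fintype.card D.cells
  have hφ : DifferentiableAt ℝ φ 1 := by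
    have h1 : DifferentiableAt ℝ (fun t : ℝ => |t ^ m|) 1 :=
      DifferentiableAt.abs (by fun_prop) (by simp)
    refine ((h1.rpow_const (Or.inl (by simp))).mul ?_).mul (by fun_prop)
    exact DifferentiableAt.zpow (by fun_prop) (Or.inl (by simp))
  refine ⟨deriv φ 1, infinitesimal_one_of_scalar _ (contDiffAt_tensorRep D w z) φ hφ ?_⟩
  filter_upwards [(isOpen_ne.mem_nhds one_ne_zero : {t : ℝ | t ≠ 0} ∈ nhds 1)] with t ht
  have hu : IsUnit (t • (1 : Matrix (Fin m) (Fin m) ℝ)) :=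
    (Matrix.isUnit_iff_isUnit_det _).2 (isUnit_iff_ne_zero.2 (by simp [ht]))
  refine ContinuousLinearMap.ext fun v => Subtype.ext ?_
  refine (extendRep_tensorRep D w z hu v).trans ?_
  rw [tensorPow_smul_one, smul_smul, Matrix.det_smul]
  simp [φ]

/-- The standard scalar product of tensors. -/
def tensorForm (m : ℕ) (D : YoungDiagram) : LinearMap.BilinForm ℝ (schurModule m D) :=
  LinearMap.mk₂ ℝ (fun u v => ∑ i, u.1 i * v.1 i)
    (fun u u' v => by simp [add_mul, Finset.sum_add_distrib])
    (fun c u v => by simp [Finset.mul_sum, mul_assoc])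
    (fun u v v' => by simp [mul_add, Finset.sum_add_distrib])
    (fun c u v => by simp [Finset.mul_sum, mul_left_comm])

theorem tensorForm_apply (D : YoungDiagram) (u v : schurModule m D) :
    tensorForm m D u v = ∑ i, u.1 i * v.1 i := rfl

/-- The transpose is adjoint to `A` on `ℝ^m`, hence on tensor powers, and it has the same
determinant. -/
theorem tensorForm_extendRep (D : YoungDiagram) (w : ℝ) (z : ℤ) {A : Matrix (Fin m) (Fin m) ℝ}
    (hA : IsUnit A) (u v : schurModule m D) :
    tensorForm m D (extendRep (tensorRep m D w z) A.transpose u) v =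
      tensorForm m D u (extendRep (tensorRep m D w z) A v) := by
  have hA' : IsUnit A.transpose := by
    rw [Matrix.isUnit_iff_isUnit_det, Matrix.det_transpose, ← Matrix.isUnit_iff_isUnit_det]
    exact hA
  rw [tensorForm_apply, tensorForm_apply, extendRep_tensorRep D w z hA',
    extendRep_tensorRep D w z hA, Matrix.det_transpose]
  simp only [Pi.smul_apply, smul_eq_mul]
  change ∑ i, (_ * ∑ j : D.cells → Fin m, (∏ c, A.transpose (i c) (j c)) * u.1 j) * v.1 i =
    ∑ i, u.1 i * (_ * ∑ j : D.cells → Fin m, (∏ c, A (i c) (j c)) * v.1 j)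
  simp only [Finset.mul_sum, Finset.sum_mul, Matrix.transpose_apply]
  rw [Finset.sum_comm]
  refine Finset.sum_congr rfl fun i _ => Finset.sum_congr rfl fun j _ => ?_
  ring

theorem tensorForm_infinitesimal (D : YoungDiagram) (w : ℝ) (z : ℤ) (B : Matrix (Fin m) (Fin m) ℝ)
    (u v : schurModule m D) :
    tensorForm m D (infinitesimal (tensorRep m D w z) B.transpose u) v =
      tensorForm m D u (infinitesimal (tensorRep m D w z) B v) :=
  form_infinitesimal _ (contDiffAt_tensorRep D w z) _
    (fun _ hA u v => tensorForm_extendRep D w z hA u v) B u v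

theorem tensorForm_comm (D : YoungDiagram) (u v : schurModule m D) :
    tensorForm m D u v = tensorForm m D v u := by
  simp only [tensorForm_apply, mul_comm]

theorem tensorForm_pos (D : YoungDiagram) {u : schurModule m D} (hu : u ≠ 0) :
    0 < tensorForm m D u u := by
  rw [tensorForm_apply]
  obtain ⟨i, hi⟩ : ∃ i, u.1 i ≠ 0 := by
    by_contra! h
    exact hu (Subtype.ext (funext h))
  exact Finset.sum_pos' (fun i _ => mul_self_nonneg _)
    ⟨i, Finset.mem_univ _, mul_self_pos.2 hi⟩

end TensorRep

/-! ### Scalar products and complete reducibility -/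

section ScalarProduct

variable {W : Type*} [AddCommGroup W] [Module ℝ W]

/-- A symmetric, positive definite bilinear form. -/
structure IsScalarProduct (β : LinearMap.BilinForm ℝ W) : Prop where
  comm : ∀ u v, β u v = β v u
  pos : ∀ u, u ≠ 0 → 0 < β u u

/-- Stability of a subspace under a set of endomorphisms. -/
def StableUnder (S : Set (Module.End ℝ W)) (I : Submodule ℝ W) : Prop :=
  ∀ a ∈ S, ∀ w ∈ I, a w ∈ I

/-- Irreducibility of a subspace under a set of endomorphisms. -/
def IrreducibleUnder (S : Set (Module.End ℝ W)) (I : Submodule ℝ W) : Prop :=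
  StableUnder S I ∧ I ≠ ⊥ ∧ ∀ J ≤ I, StableUnder S J → J = ⊥ ∨ J = I

theorem exists_irreducibleUnder (S : Set (Module.End ℝ W)) (H : Submodule ℝ W)
    [FiniteDimensional ℝ H] (hH : StableUnder S H) (h0 : H ≠ ⊥) :
    ∃ I ≤ H, IrreducibleUnder S I := by
  induction hn : Module.finrank ℝ H using Nat.strong_induction_on generalizing H with
  | _ n ih =>
    by_cases hI : ∀ J ≤ H, StableUnder S J → J = ⊥ ∨ J = H
    · exact ⟨H, le_rfl, hH, h0, hI⟩
    · push Not at hI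
      obtain ⟨J, hJ, hs, hJ0, hJH⟩ := hI
      have : FiniteDimensional ℝ J := Submodule.finiteDimensional_of_le hJ
      have hlt := Submodule.finrank_lt_finrank_of_lt (lt_of_le_of_ne hJ hJH)
      obtain ⟨I, hIJ, hI⟩ := ih _ (hn ▸ hlt) J hs hJ0 rfl
      exact ⟨I, hIJ.trans hJ, hI⟩

namespace IsScalarProduct

variable {β : LinearMap.BilinForm ℝ W}

theorem eq_zero (hβ : IsScalarProduct β) {u : W} (h : β u u = 0) : u = 0 := by
  by_contra h0
  exact (hβ.pos u h0).ne' h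

/-- Orthogonal projection onto `I` needs only that `I` be finite-dimensional, whereas the fibre `W`
of the application has all degrees at once. -/
theorem exists_orthogonal_sub (hβ : IsScalarProduct β) (I : Submodule ℝ W)
    [FiniteDimensional ℝ I] (w : W) : ∃ u ∈ I, ∀ v ∈ I, β v (w - u) = 0 := by
  let f : I →ₗ[ℝ] Module.Dual ℝ I := (LinearMap.lcomp ℝ ℝ I.subtype) ∘ₗ β ∘ₗ I.subtype
  have hf : ∀ u v : I, f u v = β u v := fun _ _ => rfl
  have hinj : Function.Injective f := by
    refine (injective_iff_map_eq_zero f).2 fun u hu => Subtype.ext (hβ.eq_zero ?_)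
    rw [← hf, hu]
    rfl
  obtain ⟨u, hu⟩ := (LinearMap.injective_iff_surjective_of_finrank_eq_finrank
    (Subspace.dual_finrank_eq).symm).1 hinj (β w ∘ₗ I.subtype)
  refine ⟨u, u.2, fun v hv => ?_⟩
  have := LinearMap.congr_fun hu ⟨v, hv⟩
  rw [hf] at this
  rw [map_sub, hβ.comm v w, hβ.comm v u, this]
  exact sub_self _

/-- The orthogonal complement of `I` in `H`. -/
def complementIn (β : LinearMap.BilinForm ℝ W) (H I : Submodule ℝ W) : Submodule ℝ W :=
  H ⊓ LinearMap.BilinForm.orthogonal β I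

theorem sup_complementIn (hβ : IsScalarProduct β) {H I : Submodule ℝ W} [FiniteDimensional ℝ I]
    (hI : I ≤ H) : I ⊔ complementIn β H I = H := by
  refine le_antisymm (sup_le hI inf_le_left) fun w hw => ?_
  obtain ⟨u, hu, h⟩ := hβ.exists_orthogonal_sub I w
  exact Submodule.mem_sup.2 ⟨u, hu, w - u, ⟨H.sub_mem hw (hI hu), h⟩, by abel⟩

theorem complementIn_lt (hβ : IsScalarProduct β) {H I : Submodule ℝ W} (hI : I ≤ H)
    (h0 : I ≠ ⊥) : complementIn β H I < H := by
  refine lt_of_le_of_ne inf_le_left fun h => h0 ((Submodule.eq_bot_iff _).2 fun u hu => ?_)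
  have h1 : u ∈ complementIn β H I := h.ge (hI hu)
  exact hβ.eq_zero (h1.2 u hu)

/-- Because `S` is closed under adjoints, the orthogonal complement of a stable subspace is stable;
an irreducible summand is split off and the dimension drops. -/
theorem exists_orthogonal_irreducibles (hβ : IsScalarProduct β) (S : Set (Module.End ℝ W))
    (hS : ∀ a ∈ S, ∃ b ∈ S, ∀ u v, β (b u) v = β u (a v)) (H : Submodule ℝ W)
    [FiniteDimensional ℝ H] (hH : StableUnder S H) :
    ∃ (n : ℕ) (I : Fin n → Submodule ℝ W), (∀ s, IrreducibleUnder S (I s)) ∧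
      (∀ s t, s ≠ t → ∀ u ∈ I s, ∀ v ∈ I t, β u v = 0) ∧ ⨆ s, I s = H := by
  induction hn : Module.finrank ℝ H using Nat.strong_induction_on generalizing H with
  | _ N ih =>
    by_cases h0 : H = ⊥
    · exact ⟨0, Fin.elim0, fun s => s.elim0, fun s => s.elim0, by rw [iSup_of_empty, h0]⟩
    obtain ⟨I, hIH, hI⟩ := exists_irreducibleUnder S H hH h0
    have : FiniteDimensional ℝ I := Submodule.finiteDimensional_of_le hIH
    have hlt := hβ.complementIn_lt hIH hI.2.1
    have : FiniteDimensional ℝ (complementIn β H I) := Submodule.finiteDimensional_of_le hlt.le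
    have hst : StableUnder S (complementIn β H I) := by
      intro a ha w hw
      refine ⟨hH a ha w hw.1, fun u hu => ?_⟩
      obtain ⟨b, hb, hab⟩ := hS a ha
      exact (hab u w).symm.trans (hw.2 _ (hI.1 b hb u hu))
    obtain ⟨n, J, hJ, hort, hsum⟩ :=
      ih _ (hn ▸ Submodule.finrank_lt_finrank_of_lt hlt) _ hst rfl
    have hle : ∀ s, J s ≤ complementIn β H I := fun s => hsum ▸ le_iSup J s
    refine ⟨n + 1, Fin.cons I J, Fin.cases hI hJ, ?_, ?_⟩
    · refine Fin.cases (Fin.cases (fun h => absurd rfl h) fun t _ u hu v hv => ?_)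
        fun s => Fin.cases (fun _ u hu v hv => ?_) fun t h => ?_
      · exact (hle t hv).2 u hu
      · rw [hβ.comm]
        exact (hle s hu).2 v hv
      · exact hort s t fun e => h (congrArg _ e)
    · rw [← hβ.sup_complementIn hIH, ← hsum]
      refine le_antisymm (iSup_le (Fin.cases le_sup_left fun s => ?_))
        (sup_le (le_iSup (Fin.cons I J : Fin (n + 1) → Submodule ℝ W) 0) (iSup_le fun s =>
          le_iSup (Fin.cons I J : Fin (n + 1) → Submodule ℝ W) s.succ))
      exact (le_iSup J s).trans le_sup_right

theorem iSupIndep_of_orthogonal (hβ : IsScalarProduct β) {ι : Type*} {I : ι → Submodule ℝ W}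
    (h : ∀ s t, s ≠ t → ∀ u ∈ I s, ∀ v ∈ I t, β u v = 0) : iSupIndep I := by
  intro s
  rw [Submodule.disjoint_def]
  intro u hu hu'
  have hle : ⨆ (t) (_ : t ≠ s), I t ≤ LinearMap.BilinForm.orthogonal β (I s) :=
    iSup₂_le fun t ht v hv w hw => h s t ht.symm w hw v hv
  exact hβ.eq_zero (hle hu' u hu)

/-- The spectral theorem: symmetry replaces algebraic closedness of the field. -/
theorem exists_eigenvector [FiniteDimensional ℝ W] [Nontrivial W] (hβ : IsScalarProduct β)
    (a : Module.End ℝ W) (ha : ∀ u v, β (a u) v = β u (a v)) :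
    ∃ (μ : ℝ) (v : W), v ≠ 0 ∧ a v = μ • v := by
  let core : InnerProductSpace.Core ℝ W :=
    { inner := fun u v => β u v
      conj_inner_symm := fun u v => hβ.comm v u
      re_inner_nonneg := fun u => by
        by_cases h : u = 0
        · simp [h]
        · exact (hβ.pos u h).le
      add_left := fun u v w => by simp
      smul_left := fun u v r => by simp
      definite := fun u h => hβ.eq_zero h }
  let _ : NormedAddCommGroup W := core.toNormedAddCommGroup
  let _ : InnerProductSpace ℝ W := InnerProductSpace.ofCore core.toCore
  have hs : a.IsSymmetric := ha
  obtain ⟨v, hv⟩ := hs.hasEigenvalue_iSup_of_finiteDimensional.exists_hasEigenvector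
  exact ⟨_, v, hv.2, hv.apply_eq_smul⟩

theorem exists_eigenvector_mem (hβ : IsScalarProduct β) {I : Submodule ℝ W}
    [FiniteDimensional ℝ I] (h0 : I ≠ ⊥) (a : Module.End ℝ W) (haI : ∀ w ∈ I, a w ∈ I)
    (ha : ∀ u v, β (a u) v = β u (a v)) : ∃ (μ : ℝ), ∃ v ∈ I, v ≠ 0 ∧ a v = μ • v := by
  have : Nontrivial I := Submodule.nontrivial_iff_ne_bot.2 h0
  let β' : LinearMap.BilinForm ℝ I := (LinearMap.lcomp ℝ ℝ I.subtype) ∘ₗ β ∘ₗ I.subtype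
  have hβ' : IsScalarProduct β' :=
    ⟨fun u v => hβ.comm u v, fun u hu => hβ.pos u fun h => hu (Subtype.ext h)⟩
  obtain ⟨μ, v, hv, h⟩ := hβ'.exists_eigenvector (a.restrict haI) fun u v => ha u v
  exact ⟨μ, v, v.2, fun h => hv (Subtype.ext h), congrArg Subtype.val h⟩

/-- Schur's lemma over `ℝ`. A commuting endomorphism of a real irreducible representation need not
be scalar, but a symmetric one has a real eigenvalue, whose eigenspace in `I` is stable and so is
all of `I`. -/
theorem exists_scalar_of_irreducible (hβ : IsScalarProduct β) {S : Set (Module.End ℝ W)}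
    {I : Submodule ℝ W} [FiniteDimensional ℝ I] (hI : IrreducibleUnder S I) (a : Module.End ℝ W)
    (haI : ∀ w ∈ I, a w ∈ I) (ha : ∀ u v, β (a u) v = β u (a v)) (hc : ∀ b ∈ S, Commute a b) :
    ∃ μ : ℝ, ∀ w ∈ I, a w = μ • w := by
  obtain ⟨μ, v, hv, hv0, h⟩ := hβ.exists_eigenvector_mem hI.2.1 a haI ha
  let J : Submodule ℝ W := I ⊓ LinearMap.ker (a - μ • LinearMap.id)
  have hJ : ∀ w, w ∈ J ↔ w ∈ I ∧ a w = μ • w := fun w => by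
    simp [J, sub_eq_zero]
  have hs : StableUnder S J := by
    intro b hb w hw
    rw [hJ] at hw ⊢
    refine ⟨hI.1 b hb w hw.1, ?_⟩
    have := LinearMap.congr_fun (hc b hb).eq w
    rw [Module.End.mul_apply, Module.End.mul_apply] at this
    rw [this, hw.2, map_smul]
  rcases hI.2.2 J inf_le_left hs with h' | h'
  · exact absurd ((Submodule.mem_bot ℝ).1 (h' ▸ (hJ v).2 ⟨hv, h⟩)) hv0
  · exact ⟨μ, fun w hw => ((hJ w).1 (h'.ge hw)).2⟩

end IsScalarProduct

end ScalarProduct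

/-! ### Invariant scalar products on the fibre -/

section HomForm

variable {V₁ V₂ : Type*}
  [NormedAddCommGroup V₁] [NormedSpace ℝ V₁] [FiniteDimensional ℝ V₁]
  [NormedAddCommGroup V₂] [NormedSpace ℝ V₂]

theorem IsScalarProduct.exists_orthogonal_basis {β : LinearMap.BilinForm ℝ V₁}
    (hβ : IsScalarProduct β) : ∃ e : Module.Basis (Fin (Module.finrank ℝ V₁)) ℝ V₁,
      ∀ v, v = ∑ i, ((β (e i) (e i))⁻¹ * β v (e i)) • e i := by
  have hs : LinearMap.IsSymm β := ⟨fun u v => hβ.comm u v⟩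
  obtain ⟨e, he⟩ := LinearMap.BilinForm.exists_orthogonal_basis hs
  refine ⟨e, fun v => ?_⟩
  have h : ∀ i, e.repr v i = (β (e i) (e i))⁻¹ * β v (e i) := by
    intro i
    have h1 : β v (e i) = ∑ j, e.repr v j * β (e j) (e i) := by
      conv_lhs => rw [← e.sum_repr v]
      simp only [map_sum, map_smul, LinearMap.sum_apply, LinearMap.smul_apply, smul_eq_mul]
    rw [h1, Finset.sum_eq_single i (fun j _ hj => by
      rw [show β (e j) (e i) = 0 from he hj, mul_zero]) (by simp)]
    field_simp [(hβ.pos _ (e.ne_zero i)).ne']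
  simp only [← h]
  exact (e.sum_repr v).symm

/-- The Hilbert–Schmidt product on `Hom(V₁, V₂)`. The weights `w_i = β₁(e_i, e_i)⁻¹` let an
orthogonal basis do the work of an orthonormal one. -/
theorem exists_homForm {β₁ : LinearMap.BilinForm ℝ V₁} {β₂ : LinearMap.BilinForm ℝ V₂}
    (h₁ : IsScalarProduct β₁) (h₂ : IsScalarProduct β₂) :
    ∃ B : LinearMap.BilinForm ℝ (V₁ →L[ℝ] V₂), IsScalarProduct B ∧
      (∀ a b : V₂ →L[ℝ] V₂, (∀ u v, β₂ (b u) v = β₂ u (a v)) →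
        ∀ c d : V₁ →L[ℝ] V₂, B (b ∘L c) d = B c (a ∘L d)) ∧
      (∀ a b : V₁ →L[ℝ] V₁, (∀ u v, β₁ (b u) v = β₁ u (a v)) →
        ∀ c d : V₁ →L[ℝ] V₂, B (c ∘L b) d = B c (d ∘L a)) := by
  obtain ⟨e, he⟩ := h₁.exists_orthogonal_basis
  have hw : ∀ i, 0 < (β₁ (e i) (e i))⁻¹ := fun i => inv_pos.2 (h₁.pos _ (e.ne_zero i))
  generalize hwd : (fun i => (β₁ (e i) (e i))⁻¹) = w at *
  have he : ∀ v, v = ∑ i, (w i * β₁ v (e i)) • e i := by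
    intro v
    simpa only [← hwd] using he v
  have hw : ∀ i, 0 < w i := fun i => by simpa only [← hwd] using hw i
  let B : LinearMap.BilinForm ℝ (V₁ →L[ℝ] V₂) :=
    LinearMap.mk₂ ℝ (fun c d => ∑ i, w i * β₂ (c (e i)) (d (e i)))
      (fun c c' d => by simp [mul_add, Finset.sum_add_distrib])
      (fun r c d => by simp [Finset.mul_sum, mul_left_comm])
      (fun c d d' => by simp [mul_add, Finset.sum_add_distrib])
      (fun r c d => by simp [Finset.mul_sum, mul_left_comm])
  have hB : ∀ c d, B c d = ∑ i, w i * β₂ (c (e i)) (d (e i)) := fun _ _ => rfl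
  refine ⟨B, ⟨fun c d => ?_, fun c hc => ?_⟩, fun a b hab c d => ?_, fun a b hab c d => ?_⟩
  · simp only [hB, h₂.comm]
  · rw [hB]
    obtain ⟨i, hi⟩ : ∃ i, c (e i) ≠ 0 := by
      by_contra! h
      refine hc (ContinuousLinearMap.coe_injective (e.ext fun i => ?_))
      exact h i
    refine Finset.sum_pos' (fun i _ => mul_nonneg (hw i).le ?_)
      ⟨i, Finset.mem_univ _, mul_pos (hw i) (h₂.pos _ hi)⟩
    by_cases h : c (e i) = 0
    · simp [h]
    · exact (h₂.pos _ h).le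
  · simp only [hB]
    exact Finset.sum_congr rfl fun i _ => congrArg _ (hab _ _)
  -- Right composition with an endomorphism is expanded in the basis on both sides; the adjoint has
  -- the transposed matrix, so the two double sums differ by the order of summation.
  · have h3 : ∀ i, c (b (e i)) = ∑ j, (w j * β₁ (b (e i)) (e j)) • c (e j) := fun i => by
      conv_lhs => rw [he (b (e i))]
      simp
    have h4 : ∀ i, d (a (e i)) = ∑ j, (w j * β₁ (b (e j)) (e i)) • d (e j) := fun i => by
      conv_lhs => rw [he (a (e i))]
      simp [hab, h₁.comm]
    simp only [hB, ContinuousLinearMap.comp_apply, h3, h4, map_sum, map_smul, LinearMap.sum_apply,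
      LinearMap.smul_apply, smul_eq_mul, Finset.mul_sum]
    rw [Finset.sum_comm]
    refine Finset.sum_congr rfl fun i _ => Finset.sum_congr rfl fun j _ => ?_
    ring

end HomForm

/-! ### The Fischer product on polynomials with vector coefficients. -/

section PolyForm

variable {m : ℕ} {F : Type*} [AddCommGroup F] [Module ℝ F]

/-- The factorial `∏ αᵢ!` of a multi-index. -/
def multiFactorial (α : Fin m →₀ ℕ) : ℝ := ∏ i, ((α i).factorial : ℝ)

theorem multiFactorial_pos (α : Fin m →₀ ℕ) : 0 < multiFactorial α :=
  Finset.prod_pos fun i _ => by exact_mod_cast (α i).factorial_pos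

theorem multiFactorial_add_single (α : Fin m →₀ ℕ) (i : Fin m) :
    multiFactorial (α + Finsupp.single i 1) = (α i + 1) * multiFactorial α := by
  rw [multiFactorial, multiFactorial, ← Finset.mul_prod_erase _ _ (Finset.mem_univ i),
    ← Finset.mul_prod_erase _ (fun j => ((α j).factorial : ℝ)) (Finset.mem_univ i), ← mul_assoc]
  congr 1
  · simp [Nat.factorial_succ]
  · refine Finset.prod_congr rfl fun j hj => ?_
    rw [Finsupp.add_apply, Finsupp.single_eq_of_ne (Finset.ne_of_mem_erase hj), add_zero]

/-- The scalar product of polynomials for which `∂/∂ξ_i` is the adjoint of `ξ_i`. -/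
def polyForm (B : LinearMap.BilinForm ℝ F) : LinearMap.BilinForm ℝ (Poly m F) :=
  Finsupp.lsum ℝ fun α => multiFactorial α • LinearMap.lcomp ℝ ℝ (Finsupp.lapply α) ∘ₗ B

variable {B : LinearMap.BilinForm ℝ F}

theorem polyForm_single (α : Fin m →₀ ℕ) (c : F) (Q : Poly m F) :
    polyForm B (Finsupp.single α c) Q = multiFactorial α * B c (Q α) := by
  rw [polyForm, Finsupp.lsum_single]
  rfl

theorem polyForm_comm (hB : IsScalarProduct B) (P Q : Poly m F) :
    polyForm B P Q = polyForm B Q P := by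
  induction P using Finsupp.induction_linear with
  | zero => simp
  | add P P' h h' => rw [map_add, LinearMap.add_apply, h, h', map_add]
  | single α c =>
    induction Q using Finsupp.induction_linear with
    | zero => simp
    | add Q Q' h h' => rw [map_add, h, h', map_add, LinearMap.add_apply]
    | single β d =>
      rw [polyForm_single, polyForm_single]
      by_cases h : α = β
      · subst h
        simp [hB.comm]
      · simp [h, Ne.symm h]

theorem polyForm_self (P : Poly m F) :
    polyForm B P P = ∑ α ∈ P.support, multiFactorial α * B (P α) (P α) := by
  conv_lhs => rw [polyForm, Finsupp.lsum_apply, Finsupp.sum, LinearMap.sum_apply]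
  rfl

theorem isScalarProduct_polyForm (hB : IsScalarProduct B) :
    IsScalarProduct (polyForm B : LinearMap.BilinForm ℝ (Poly m F)) := by
  refine ⟨polyForm_comm hB, fun P hP => ?_⟩
  rw [polyForm_self]
  exact Finset.sum_pos (fun α hα => mul_pos (multiFactorial_pos α)
    (hB.pos _ (Finsupp.mem_support_iff.1 hα))) (Finsupp.support_nonempty_iff.2 hP)

/-- The factorials in the form are made for this: raising `α` by `ε_i` multiplies the weight by `α_i
+ 1`, the factor produced by `∂/∂ξ_i`. -/
theorem polyForm_xiMul (i : Fin m) (P Q : Poly m F) :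
    polyForm B (xiMul i P) Q = polyForm B P (xiDer i Q) := by
  induction P using Finsupp.induction_linear with
  | zero => simp
  | add P P' h h' => rw [map_add, map_add, LinearMap.add_apply, h, h', map_add, LinearMap.add_apply]
  | single α c =>
    rw [xiMul_single, polyForm_single, polyForm_single, xiDer_apply, multiFactorial_add_single,
      map_smul, smul_eq_mul]
    ring

theorem polyForm_xiDer (hB : IsScalarProduct B) (i : Fin m) (P Q : Poly m F) :
    polyForm B (xiDer i P) Q = polyForm B P (xiMul i Q) := by
  rw [polyForm_comm hB, ← polyForm_xiMul, polyForm_comm hB]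

theorem polyForm_coeffMap {a b : F →ₗ[ℝ] F} (hab : ∀ c d, B (b c) d = B c (a d))
    (P Q : Poly m F) : polyForm B (coeffMap b P) Q = polyForm B P (coeffMap a Q) := by
  induction P using Finsupp.induction_linear with
  | zero => simp
  | add P P' h h' => rw [map_add, map_add, LinearMap.add_apply, h, h', map_add, LinearMap.add_apply]
  | single α c => rw [coeffMap_single, polyForm_single, polyForm_single, coeffMap_apply, hab]

theorem finiteDimensional_homogeneous [FiniteDimensional ℝ F] (k : ℕ) :
    FiniteDimensional ℝ (homogeneous m F k) := by
  have hf : Set.Finite {α : Fin m →₀ ℕ | α.degree = k} :=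
    (Finsupp.finite_of_degree_le (σ := Fin m) k).subset fun α hα => le_of_eq hα
  have := hf.to_subtype
  exact Module.Finite.equiv (Finsupp.supportedEquivFinsupp {α : Fin m →₀ ℕ | α.degree = k}).symm

/-- Euler's identity, read off coefficient by coefficient. -/
theorem sum_xiMul_xiDer {k : ℕ} {P : Poly m F} (hP : P ∈ homogeneous m F k) :
    ∑ i, xiMul i (xiDer i P) = (k : ℝ) • P := by
  refine Finsupp.ext fun α => ?_
  rw [Finsupp.finsetSum_apply, Finsupp.smul_apply]
  have h : ∀ i, xiMul i (xiDer i P) α = (α i : ℝ) • P α := by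
    intro i
    by_cases h0 : α i = 0
    · rw [xiMul_apply_of_eq_zero _ _ _ h0, h0, Nat.cast_zero, zero_smul]
    · obtain ⟨β, rfl⟩ : ∃ β, α = β + Finsupp.single i 1 := by
        refine ⟨α - Finsupp.single i 1, (tsub_add_cancel_of_le ?_).symm⟩
        exact Finsupp.single_le_iff.2 (Nat.one_le_iff_ne_zero.2 h0)
      rw [xiMul_apply_add, xiDer_apply]
      simp
  rw [Finset.sum_congr rfl fun i _ => h i, ← Finset.sum_smul]
  by_cases hα : α.degree = k
  · rw [← hα, Finsupp.degree_eq_sum, Nat.cast_sum]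
  · rw [mem_homogeneous_iff.1 hP α hα, smul_zero, smul_zero]

end PolyForm

/-! ### Complete reducibility of the fibre and the scalar action of its Casimir operator. -/

section Irreducible

variable {m : ℕ} {V₁ V₂ : Type*}
  [NormedAddCommGroup V₁] [NormedSpace ℝ V₁] [FiniteDimensional ℝ V₁]
  [NormedAddCommGroup V₂] [NormedSpace ℝ V₂] [FiniteDimensional ℝ V₂]

/-- The properties of a representation of `GL(m, ℝ)` on which the quantization relies: its
differential is a representation of `gl(m, ℝ)`, the identity matrix acts by a scalar, and the
transposed matrix acts by the adjoint for some scalar product. -/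
structure IsReductive {V : Type*} [NormedAddCommGroup V] [NormedSpace ℝ V] [FiniteDimensional ℝ V]
    (ρ : Representation ℝ (GL (Fin m) ℝ) V) : Prop where
  bracket : ∀ A B, infinitesimal ρ (A * B - B * A) =
    infinitesimal ρ A * infinitesimal ρ B - infinitesimal ρ B * infinitesimal ρ A
  scalar : ∃ s : ℝ, infinitesimal ρ 1 = s • 1
  form : ∃ β : LinearMap.BilinForm ℝ V, IsScalarProduct β ∧
    ∀ B u v, β (infinitesimal ρ B.transpose u) v = β u (infinitesimal ρ B v)

theorem isReductive_tensorRep (D : YoungDiagram) (w : ℝ) (z : ℤ) :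
    IsReductive (tensorRep m D w z) where
  bracket := infinitesimal_bracket _ (contDiffAt_tensorRep D w z)
  scalar := infinitesimal_tensorRep_one D w z
  form := ⟨tensorForm m D, ⟨tensorForm_comm D, fun _ => tensorForm_pos D⟩,
    tensorForm_infinitesimal D w z⟩

variable {ρ₁ : Representation ℝ (GL (Fin m) ℝ) V₁} {ρ₂ : Representation ℝ (GL (Fin m) ℝ) V₂}

/-- The Fischer product makes `ξ_i ∂/∂ξ_j` adjoint to `ξ_j ∂/∂ξ_i`, and the Hilbert–Schmidt product
does the same for the action on the coefficients. -/
theorem exists_fibreForm (h₁ : IsReductive ρ₁) (h₂ : IsReductive ρ₂) :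
    ∃ β : LinearMap.BilinForm ℝ (Fibre m V₁ V₂), IsScalarProduct β ∧
      ∀ i j u v, β (fibR ρ₁ ρ₂ j i u) v = β u (fibR ρ₁ ρ₂ i j v) := by
  obtain ⟨β₁, hβ₁, ha₁⟩ := h₁.form
  obtain ⟨β₂, hβ₂, ha₂⟩ := h₂.form
  obtain ⟨B, hB, hl, hr⟩ := exists_homForm hβ₁ hβ₂
  refine ⟨polyForm B, isScalarProduct_polyForm hB, fun i j u v => ?_⟩
  have t : ∀ i j : Fin m, Matrix.single j i (1 : ℝ) = (Matrix.single i j 1).transpose :=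
    fun i j => (Matrix.transpose_single i j 1).symm
  have e : ∀ (i j : Fin m) (P : Fibre m V₁ V₂), fibR ρ₁ ρ₂ i j P =
      xiMul i (xiDer j P) + (coeffMap (compLeft
        (infinitesimal ρ₂ (Matrix.single i j 1))).toLinearMap P - coeffMap (compRight
        (infinitesimal ρ₁ (Matrix.single i j 1))).toLinearMap P) := fun _ _ _ => rfl
  rw [e, e, map_add, LinearMap.add_apply, map_sub, LinearMap.sub_apply, polyForm_xiMul,
    polyForm_xiDer hB, map_add, map_sub]
  congr 2
  · refine polyForm_coeffMap (fun c d => hl _ _ (fun u v => ?_) c d) u v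
    rw [t, ha₂]
  · refine polyForm_coeffMap (fun c d => hr _ _ (fun u v => ?_) c d) u v
    rw [t, ha₁]

variable (ρ₁ ρ₂) in
/-- The operators by which `sl(m, ℝ)` acts on the fibre. -/
def slOperators : Set (Module.End ℝ (Fibre m V₁ V₂)) :=
  {a | ∃ B : Matrix (Fin m) (Fin m) ℝ, B.trace = 0 ∧ a = fibreAct ρ₁ ρ₂ B}

theorem stableUnder_iff {I : Submodule ℝ (Fibre m V₁ V₂)} :
    StableUnder (slOperators ρ₁ ρ₂) I ↔ IsSLStable ρ₁ ρ₂ I := by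
  constructor
  · exact fun h B hB w hw => h _ ⟨B, hB, rfl⟩ w hw
  · rintro h _ ⟨B, hB, rfl⟩ w hw
    exact h B hB w hw

theorem irreducibleUnder_iff {I : Submodule ℝ (Fibre m V₁ V₂)} :
    IrreducibleUnder (slOperators ρ₁ ρ₂) I ↔ IsIrreducibleSL ρ₁ ρ₂ I := by
  simp only [IrreducibleUnder, IsIrreducibleSL, stableUnder_iff]

theorem fibreAct_mem {I : Submodule ℝ (Fibre m V₁ V₂)}
    (hI : ∀ i j, ∀ w ∈ I, fibR ρ₁ ρ₂ i j w ∈ I) (B : Matrix (Fin m) (Fin m) ℝ)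
    {w : Fibre m V₁ V₂} (hw : w ∈ I) : fibreAct ρ₁ ρ₂ B w ∈ I := by
  rw [fibreAct_eq]
  simp only [LinearMap.sum_apply, LinearMap.smul_apply]
  exact Submodule.sum_mem _ fun i _ => Submodule.sum_mem _ fun j _ =>
    Submodule.smul_mem _ _ (hI i j w hw)

theorem fibreAct_adjoint {β : LinearMap.BilinForm ℝ (Fibre m V₁ V₂)}
    (hβ : ∀ i j u v, β (fibR ρ₁ ρ₂ j i u) v = β u (fibR ρ₁ ρ₂ i j v))
    (B : Matrix (Fin m) (Fin m) ℝ) (u v : Fibre m V₁ V₂) :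
    β (fibreAct ρ₁ ρ₂ B.transpose u) v = β u (fibreAct ρ₁ ρ₂ B v) := by
  rw [fibreAct_eq, fibreAct_eq]
  simp only [LinearMap.sum_apply, LinearMap.smul_apply, map_sum, map_smul, hβ,
    Matrix.transpose_apply]
  exact Finset.sum_comm

/-- The transpose of a traceless matrix is traceless, so the operators of `sl(m)` are closed under
adjoints. -/
theorem nonempty_decomposition (h₁ : IsReductive ρ₁) (h₂ : IsReductive ρ₂) :
    Nonempty (Decomposition ρ₁ ρ₂) := by
  obtain ⟨β, hβ, hadj⟩ := exists_fibreForm h₁ h₂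
  have hS : ∀ a ∈ slOperators ρ₁ ρ₂, ∃ b ∈ slOperators ρ₁ ρ₂, ∀ u v, β (b u) v = β u (a v) := by
    rintro _ ⟨B, hB, rfl⟩
    exact ⟨_, ⟨B.transpose, by rw [Matrix.trace_transpose, hB], rfl⟩, fibreAct_adjoint hadj B⟩
  have h := fun k => by
    have := finiteDimensional_homogeneous (m := m) (F := V₁ →L[ℝ] V₂) k
    refine hβ.exists_orthogonal_irreducibles (slOperators ρ₁ ρ₂) hS
      (homogeneous m (V₁ →L[ℝ] V₂) k) (stableUnder_iff.2 fun B _ w hw => ?_)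
    exact fibreAct_mem (fun i j w hw => fibR_mem_homogeneous i j hw) B hw
  choose n I hI hort hsum using h
  exact ⟨⟨n, I, fun k s => irreducibleUnder_iff.1 (hI k s),
    fun k => hβ.iSupIndep_of_orthogonal (hort k), hsum⟩⟩

theorem fibreAct_one (h₁ : IsReductive ρ₁) (h₂ : IsReductive ρ₂) (k : ℕ) :
    ∃ s : ℝ, ∀ P ∈ homogeneous m (V₁ →L[ℝ] V₂) k, fibreAct ρ₁ ρ₂ 1 P = s • P := by
  obtain ⟨s₁, hs₁⟩ := h₁.scalar
  obtain ⟨s₂, hs₂⟩ := h₂.scalar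
  refine ⟨k + (s₂ - s₁), fun P hP => ?_⟩
  have hE : (∑ i : Fin m, ∑ j : Fin m, (1 : Matrix (Fin m) (Fin m) ℝ) i j • xiD i j) P =
      (k : ℝ) • P := by
    rw [← sum_xiMul_xiDer hP]
    simp [Matrix.one_apply, xiD_eq, LinearMap.sum_apply]
  have hH : coeffMap (homAct ρ₁ ρ₂ 1).toLinearMap P = (s₂ - s₁) • P := by
    refine Finsupp.ext fun α => ?_
    rw [coeffMap_apply, Finsupp.smul_apply]
    change infinitesimal ρ₂ 1 ∘L P α - P α ∘L infinitesimal ρ₁ 1 = _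
    rw [hs₁, hs₂]
    ext v
    simp [sub_smul]
  rw [fibreAct, LinearMap.add_apply, hE, hH, add_smul]

/-- On polynomials of a fixed degree the identity matrix acts by a scalar, so adding it to `sl(m)`
imposes no further condition on a subspace. -/
theorem fibR_mem_of_isSLStable (hm : m ≠ 0) (h₁ : IsReductive ρ₁) (h₂ : IsReductive ρ₂) {k : ℕ}
    {I : Submodule ℝ (Fibre m V₁ V₂)} (hk : I ≤ homogeneous m (V₁ →L[ℝ] V₂) k)
    (hI : IsSLStable ρ₁ ρ₂ I) (i j : Fin m) {w : Fibre m V₁ V₂} (hw : w ∈ I) :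
    fibR ρ₁ ρ₂ i j w ∈ I := by
  obtain ⟨s, hs⟩ := fibreAct_one h₁ h₂ k
  let M : Matrix (Fin m) (Fin m) ℝ := Matrix.single i j 1
  let t : ℝ := M.trace / m
  have hM : fibreAct ρ₁ ρ₂ (M - t • 1) = fibreAct ρ₁ ρ₂ M - t • fibreAct ρ₁ ρ₂ 1 := by
    simp only [fibreAct_eq, Matrix.sub_apply, Matrix.smul_apply, sub_smul, smul_assoc,
      Finset.sum_sub_distrib, Finset.smul_sum]
  have h : fibreAct ρ₁ ρ₂ (M - t • 1) w ∈ I := by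
    refine hI _ ?_ w hw
    rw [Matrix.trace_sub, Matrix.trace_smul, Matrix.trace_one, Fintype.card_fin, smul_eq_mul,
      div_mul_cancel₀ _ (Nat.cast_ne_zero.2 hm), sub_self]
  rw [hM, LinearMap.sub_apply, LinearMap.smul_apply, hs w (hk hw), fibreAct_single] at h
  exact (Submodule.sub_mem_iff_left _ (Submodule.smul_mem _ _ (Submodule.smul_mem _ _ hw))).1 h

theorem fibCasimir_mem {I : Submodule ℝ (Fibre m V₁ V₂)}
    (hI : ∀ i j, ∀ w ∈ I, fibR ρ₁ ρ₂ i j w ∈ I) {w : Fibre m V₁ V₂} (hw : w ∈ I) :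
    fibCasimir ρ₁ ρ₂ w ∈ I := by
  have ht : ∀ w ∈ I, (∑ i, fibR ρ₁ ρ₂ i i) w ∈ I := fun w hw => by
    rw [LinearMap.sum_apply]
    exact Submodule.sum_mem _ fun i _ => hI i i w hw
  have hs : (∑ i, ∑ j, fibR ρ₁ ρ₂ i j * fibR ρ₁ ρ₂ j i) w ∈ I := by
    simp only [LinearMap.sum_apply, Module.End.mul_apply]
    exact Submodule.sum_mem _ fun i _ => Submodule.sum_mem _ fun j _ => hI i j _ (hI j i w hw)
  have hn : ∀ w ∈ I, (m + 1 : Module.End ℝ (Fibre m V₁ V₂)) w ∈ I := fun w hw => by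
    rw [LinearMap.add_apply, Module.End.natCast_apply, Module.End.one_apply]
    exact Submodule.add_mem _ (nsmul_mem hw m) hw
  exact Submodule.smul_mem _ _ (Submodule.add_mem _ (Submodule.add_mem _ hs (ht _ (ht w hw)))
    (hn _ (ht w hw)))

theorem fibCasimir_adjoint {β : LinearMap.BilinForm ℝ (Fibre m V₁ V₂)}
    (hβ : ∀ i j u v, β (fibR ρ₁ ρ₂ j i u) v = β u (fibR ρ₁ ρ₂ i j v)) (u v : Fibre m V₁ V₂) :
    β (fibCasimir ρ₁ ρ₂ u) v = β u (fibCasimir ρ₁ ρ₂ v) := by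
  have ht : ∀ u v, β ((∑ i, fibR ρ₁ ρ₂ i i) u) v = β u ((∑ i, fibR ρ₁ ρ₂ i i) v) := fun u v => by
    simp only [LinearMap.sum_apply, map_sum, hβ]
  have hs : β ((∑ i, ∑ j, fibR ρ₁ ρ₂ i j * fibR ρ₁ ρ₂ j i) u) v =
      β u ((∑ i, ∑ j, fibR ρ₁ ρ₂ i j * fibR ρ₁ ρ₂ j i) v) := by
    simp only [LinearMap.sum_apply, Module.End.mul_apply, map_sum, hβ]
  simp only [fibCasimir, LinearMap.smul_apply, LinearMap.add_apply, map_smul, map_add,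
    Module.End.mul_apply, ht, hs, Module.End.natCast_apply, Module.End.one_apply, map_nsmul]

theorem exists_fibCasimir_scalar (hm : m ≠ 0) (h₁ : IsReductive ρ₁) (h₂ : IsReductive ρ₂) {k : ℕ}
    {I : Submodule ℝ (Fibre m V₁ V₂)} (hk : I ≤ homogeneous m (V₁ →L[ℝ] V₂) k)
    (hI : IsIrreducibleSL ρ₁ ρ₂ I) : ∃ a : ℝ, ∀ w ∈ I, fibCasimir ρ₁ ρ₂ w = a • w := by
  obtain ⟨β, hβ, hadj⟩ := exists_fibreForm h₁ h₂
  have := finiteDimensional_homogeneous (m := m) (F := V₁ →L[ℝ] V₂) k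
  have : FiniteDimensional ℝ I := Submodule.finiteDimensional_of_le hk
  refine hβ.exists_scalar_of_irreducible (irreducibleUnder_iff.2 hI) _
    (fun w hw => fibCasimir_mem (fun i j w hw => fibR_mem_of_isSLStable hm h₁ h₂ hk hI.1 i j hw) hw)
    (fibCasimir_adjoint hadj) ?_
  rintro _ ⟨B, -, rfl⟩
  rw [fibreAct_eq]
  exact Commute.sum_right _ _ _ fun i _ => Commute.sum_right _ _ _ fun j _ =>
    (fibCasimir_comm h₁.bracket h₂.bracket i j).smul_right _

end Irreducible

/-! ### Lifting endomorphisms of the fibre to symbols -/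

section Lift

variable {m : ℕ} {V₁ V₂ : Type*}
  [NormedAddCommGroup V₁] [NormedSpace ℝ V₁] [FiniteDimensional ℝ V₁]
  [NormedAddCommGroup V₂] [NormedSpace ℝ V₂] [FiniteDimensional ℝ V₂]

set_option linter.unusedSectionVars false

/-- The function `x ↦ g(x) c`. -/
def smulConst : SmoothFn m ℝ →ₗ[ℝ] (V₁ →L[ℝ] V₂) →ₗ[ℝ] SmoothFn m (V₁ →L[ℝ] V₂) :=
  LinearMap.mk₂ ℝ (fun g c => ⟨fun x => g.1 x • c, (contDiff_of g).smul contDiff_const⟩)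
    (fun _ _ _ => Subtype.ext (funext fun _ => add_smul _ _ _))
    (fun _ _ _ => Subtype.ext (funext fun _ => mul_smul _ _ _))
    (fun _ _ _ => Subtype.ext (funext fun _ => smul_add _ _ _))
    (fun _ _ _ => Subtype.ext (funext fun _ => smul_comm _ _ _))

/-- The symbol `x ↦ g(x) P`. -/
def smulFibre (P : Fibre m V₁ V₂) : SmoothFn m ℝ →ₗ[ℝ] Symbol m V₁ V₂ where
  toFun g := coeffMap (smulConst g) P
  map_add' g h := by
    rw [map_add, coeffMap_add, LinearMap.add_apply]
  map_smul' r g := by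
    rw [map_smul, coeffMap_smul, LinearMap.smul_apply]
    rfl

theorem valueAt_smulFibre (P : Fibre m V₁ V₂) (g : SmoothFn m ℝ) (x : Fin m → ℝ) :
    valueAt x (smulFibre P g) = g.1 x • P := Finsupp.ext fun _ => rfl

theorem symP_smulFibre (P : Fibre m V₁ V₂) (g : SmoothFn m ℝ) (j : Fin m) :
    symP V₁ V₂ j (smulFibre P g) = smulFibre P (partialD j g) := by
  refine Finsupp.ext fun α => Subtype.ext (funext fun x => ?_)
  change fderiv ℝ (fun y => g.1 y • P α) x (Pi.single j 1) = fderiv ℝ g.1 x (Pi.single j 1) • P α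
  exact congrArg (fun u : (Fin m → ℝ) →L[ℝ] (V₁ →L[ℝ] V₂) => u (Pi.single j 1))
    ((differentiableAt_of g x).hasFDerivAt.smul_const (P α : V₁ →L[ℝ] V₂)).fderiv

/-- Linear constructions on the fibre become smooth operations on symbols. The lift has constant
coefficients, hence it commutes with `∂/∂x_j`. -/
theorem exists_lift (u : Module.End ℝ (Fibre m V₁ V₂)) :
    ∃ a : Module.End ℝ (Symbol m V₁ V₂), Pointwise a u ∧
      ∀ j T, symP V₁ V₂ j (a T) = a (symP V₁ V₂ j T) := by
  -- Only the coefficient space needs a basis: a symbol has finitely many monomials, and `u` is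
  -- prescribed on each `ξ^α e_i`.
  let e := Module.finBasis ℝ (V₁ →L[ℝ] V₂)
  let co : Fin (Module.finrank ℝ (V₁ →L[ℝ] V₂)) → (V₁ →L[ℝ] V₂) →L[ℝ] ℝ := fun i =>
    LinearMap.toContinuousLinearMap (e.coord i)
  let b : (Fin m →₀ ℕ) → SmoothFn m (V₁ →L[ℝ] V₂) →ₗ[ℝ] Symbol m V₁ V₂ := fun α =>
    ∑ i, smulFibre (u (Finsupp.single α (e i))) ∘ₗ postComp (co i)
  have hb : ∀ α f, b α f = ∑ i, smulFibre (u (Finsupp.single α (e i))) (postComp (co i) f) :=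
    fun α f => by simp only [b, LinearMap.sum_apply, LinearMap.comp_apply]
  let a : Module.End ℝ (Symbol m V₁ V₂) := Finsupp.lsum ℝ b
  have ha : ∀ α f, a (Finsupp.single α f) = b α f := fun α f => Finsupp.lsum_single _ _ _ _
  refine ⟨a, fun x T => ?_, fun j T => ?_⟩
  · induction T using Finsupp.induction_linear with
    | zero => simp
    | add T U hT hU => rw [map_add, map_add, hT, hU, map_add, map_add]
    | single α f =>
      rw [ha, hb, map_sum]
      simp only [valueAt_smulFibre]
      have : valueAt x (Finsupp.single α f : Symbol m V₁ V₂) = Finsupp.single α (f.1 x) :=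
        coeffMap_single _ _ _
      rw [this]
      conv_rhs => rw [← e.sum_repr (f.1 x)]
      rw [← Finsupp.lsingle_apply (R := ℝ), map_sum, map_sum]
      simp only [map_smul]
      rfl
  · induction T using Finsupp.induction_linear with
    | zero => simp
    | add T U hT hU => rw [map_add, map_add, hT, hU, map_add, map_add]
    | single α f =>
      have : symP V₁ V₂ j (Finsupp.single α f) = Finsupp.single α (partialD j f) :=
        coeffMap_single _ _ _
      rw [this, ha, ha, hb, hb, map_sum]
      simp only [symP_smulFibre, partialD_postComp]

theorem mem_sections {J : Submodule ℝ (Fibre m V₁ V₂)} {T : Symbol m V₁ V₂} :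
    T ∈ sections J ↔ ∀ x, valueAt x T ∈ J := by
  simp [sections]

theorem Pointwise.mem_sections {a : Module.End ℝ (Symbol m V₁ V₂)}
    {u : Module.End ℝ (Fibre m V₁ V₂)} (h : Pointwise a u) {J K : Submodule ℝ (Fibre m V₁ V₂)}
    (hu : ∀ w ∈ J, u w ∈ K) {T : Symbol m V₁ V₂} (hT : T ∈ sections J) : a T ∈ sections K :=
  ProjQuant.mem_sections.2 fun x => h x T ▸ hu _ (ProjQuant.mem_sections.1 hT x)

/-- A projection onto `J`, lifted to symbols, fixes `T` and commutes with the derivative, so it also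
fixes the derivative. -/
theorem symP_mem_sections (j : Fin m) {J : Submodule ℝ (Fibre m V₁ V₂)} {T : Symbol m V₁ V₂}
    (hT : T ∈ sections J) : symP V₁ V₂ j T ∈ sections J := by
  obtain ⟨p, hp⟩ := LinearMap.exists_extend (LinearMap.id : J →ₗ[ℝ] J)
  obtain ⟨a, ha, hc⟩ := exists_lift (J.subtype ∘ₗ p)
  have h : a T = T := symbol_ext fun x => by
    rw [ha]
    exact congrArg Subtype.val (LinearMap.congr_fun hp ⟨_, mem_sections.1 hT x⟩)
  rw [← h, hc]
  exact mem_sections.2 fun x => ha x _ ▸ (p _).2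

theorem sections_le_homogeneous {J : Submodule ℝ (Fibre m V₁ V₂)} {k : ℕ}
    (hJ : J ≤ homogeneous m (V₁ →L[ℝ] V₂) k) :
    sections J ≤ homogeneous m (SmoothFn m (V₁ →L[ℝ] V₂)) k := by
  intro T hT
  rw [mem_homogeneous_iff]
  intro α hα
  exact Subtype.ext (funext fun x => mem_homogeneous_iff.1 (hJ (mem_sections.1 hT x)) α hα)

theorem homogeneous_le_sections (k : ℕ) : homogeneous m (SmoothFn m (V₁ →L[ℝ] V₂)) k ≤
    sections (homogeneous m (V₁ →L[ℝ] V₂) k) := by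
  intro T hT
  refine mem_sections.2 fun x => mem_homogeneous_iff.2 fun α hα => ?_
  change (T α).1 x = 0
  rw [mem_homogeneous_iff.1 hT α hα]
  rfl

theorem sections_bot : sections (⊥ : Submodule ℝ (Fibre m V₁ V₂)) = ⊥ := by
  refine (Submodule.eq_bot_iff _).2 fun T hT => symbol_ext fun x => ?_
  rw [(Submodule.mem_bot ℝ).1 (mem_sections.1 hT x), map_zero]

/-- On the finite-dimensional `J` the injective map `c - a` is invertible; its inverse, extended
linearly to the fibre, is lifted to symbols. -/
theorem exists_resolvent (J : Submodule ℝ (Fibre m V₁ V₂)) [FiniteDimensional ℝ J]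
    {C : Module.End ℝ (Symbol m V₁ V₂)} {c : Module.End ℝ (Fibre m V₁ V₂)} (hC : Pointwise C c)
    (hJ : ∀ w ∈ J, c w ∈ J) (a : ℝ) (h0 : ∀ w ∈ J, c w = a • w → w = 0) :
    ∃ R : Module.End ℝ (Symbol m V₁ V₂), (∀ T, R T ∈ sections J) ∧
      ∀ T ∈ sections J, C (R T) - a • R T = T := by
  let f : J →ₗ[ℝ] J := c.restrict hJ - a • LinearMap.id
  have hinj : Function.Injective f := by
    refine (injective_iff_map_eq_zero f).2 fun w hw => Subtype.ext (h0 w w.2 ?_)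
    exact congrArg Subtype.val (sub_eq_zero.1 hw)
  obtain ⟨g, hg⟩ := f.exists_rightInverse_of_surjective
    (LinearMap.range_eq_top.2 (LinearMap.injective_iff_surjective.1 hinj))
  obtain ⟨g', hg'⟩ := LinearMap.exists_extend g
  obtain ⟨R, hR, -⟩ := exists_lift (J.subtype ∘ₗ g')
  refine ⟨R, fun T => mem_sections.2 fun x => hR x T ▸ (g' _).2, fun T hT => symbol_ext fun x => ?_⟩
  have h1 : g' (valueAt x T) = g ⟨_, mem_sections.1 hT x⟩ :=
    LinearMap.congr_fun hg' ⟨_, mem_sections.1 hT x⟩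
  have h2 := congrArg Subtype.val (LinearMap.congr_fun hg ⟨_, mem_sections.1 hT x⟩)
  rw [map_sub, map_smul, hC, hR, LinearMap.comp_apply, h1]
  exact h2

end Lift

/-! ### Tree-like subspaces as spaces of sections. -/

section TreeFibre

variable {m : ℕ} {V₁ V₂ : Type*}
  [NormedAddCommGroup V₁] [NormedSpace ℝ V₁] [FiniteDimensional ℝ V₁]
  [NormedAddCommGroup V₂] [NormedSpace ℝ V₂] [FiniteDimensional ℝ V₂]

set_option linter.unusedSectionVars false

variable (ρ₁ : Representation ℝ (GL (Fin m) ℝ) V₁) {ρ₂ : Representation ℝ (GL (Fin m) ℝ) V₂}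

/-- The map `(w_j) ↦ ∑ γ(ε^j) w_j`. -/
def gammaSum (J : Submodule ℝ (Fibre m V₁ V₂)) : (Fin m → J) →ₗ[ℝ] Fibre m V₁ V₂ :=
  ∑ j, fibGamma V₂ ρ₁ j ∘ₗ J.subtype ∘ₗ LinearMap.proj j

theorem gammaSum_apply (J : Submodule ℝ (Fibre m V₁ V₂)) (w : Fin m → J) :
    gammaSum ρ₁ J w = ∑ j, fibGamma V₂ ρ₁ j (w j) := by
  rw [gammaSum, LinearMap.sum_apply]
  rfl

/-- The values of the elements of `tree^l(C^∞(ℝ^m, I))`. -/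
def treeFibre (I : Submodule ℝ (Fibre m V₁ V₂)) : ℕ → Submodule ℝ (Fibre m V₁ V₂)
  | 0 => I
  | l + 1 => LinearMap.range (gammaSum ρ₁ (treeFibre I l))

variable {ρ₁} {I : Submodule ℝ (Fibre m V₁ V₂)}

theorem fibGamma_mem_treeFibre (j : Fin m) (l : ℕ) {w : Fibre m V₁ V₂}
    (hw : w ∈ treeFibre ρ₁ I l) : fibGamma V₂ ρ₁ j w ∈ treeFibre ρ₁ I (l + 1) := by
  refine ⟨Pi.single j ⟨w, hw⟩, ?_⟩
  rw [gammaSum_apply, Finset.sum_eq_single j]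
  · rw [Pi.single_eq_same]
  · intro i _ hi
    rw [Pi.single_eq_of_ne hi]
    exact map_zero _
  · simp

theorem exists_inverse_on_range {X W : Type*} [AddCommGroup X] [Module ℝ X] [AddCommGroup W]
    [Module ℝ W] (f : X →ₗ[ℝ] W) : ∃ g : W →ₗ[ℝ] X, ∀ w ∈ LinearMap.range f, f (g w) = w := by
  obtain ⟨g, hg⟩ := f.rangeRestrict.exists_rightInverse_of_surjective f.range_rangeRestrict
  obtain ⟨g', hg'⟩ := LinearMap.exists_extend g
  refine ⟨g', fun w hw => ?_⟩
  have h1 : g' w = g ⟨w, hw⟩ := LinearMap.congr_fun hg' ⟨w, hw⟩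
  rw [h1]
  exact congrArg Subtype.val (LinearMap.congr_fun hg ⟨w, hw⟩)

/-- A linear choice of preimages under `∑ γ(ε^j)`; linearity is what makes the choice smooth once it
is lifted to symbols. -/
theorem exists_treeFibre_section (I : Submodule ℝ (Fibre m V₁ V₂)) (l : ℕ) :
    ∃ s : Fin m → Module.End ℝ (Fibre m V₁ V₂), (∀ j w, s j w ∈ treeFibre ρ₁ I l) ∧
      ∀ w ∈ treeFibre ρ₁ I (l + 1), ∑ j, fibGamma V₂ ρ₁ j (s j w) = w := by
  obtain ⟨g, hg⟩ := exists_inverse_on_range (gammaSum ρ₁ (treeFibre ρ₁ I l))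
  exact ⟨fun j => (treeFibre ρ₁ I l).subtype ∘ₗ LinearMap.proj j ∘ₗ g, fun j w => (g w j).2,
    fun w hw => (gammaSum_apply ρ₁ _ (g w)).symm.trans (hg w hw)⟩

/-- That values of tree elements lie in `treeFibre` is immediate. Conversely, a section of the next
level is written as `∑ γ(ε^j) T_j` with smooth `T_j` by lifting a linear section of the fibre map.
-/
theorem tree_sections (I : Submodule ℝ (Fibre m V₁ V₂)) (l : ℕ) :
    tree ρ₁ ρ₂ (sections I) l = sections (treeFibre ρ₁ I l) := by
  induction l with
  | zero => rfl
  | succ l ih =>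
    rw [tree]
    refine le_antisymm (Submodule.span_le.2 ?_) fun U hU => ?_
    · rintro U ⟨ξ, T, hT, hU⟩
      rw [isGamma_iff] at hU
      rw [hU]
      rw [ih] at hT
      exact Submodule.sum_mem _ fun j _ => Submodule.smul_mem _ _
        ((pointwise_symGamma j).mem_sections (fun w hw => fibGamma_mem_treeFibre j l hw) hT)
    · obtain ⟨s, hs, hsum⟩ := exists_treeFibre_section (ρ₁ := ρ₁) I l
      choose a ha _ using fun j => exists_lift (s j)
      have h : U = ∑ j, symGamma V₂ ρ₁ j (a j U) := symbol_ext fun x => by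
        rw [map_sum, ← hsum _ (mem_sections.1 hU x)]
        exact Finset.sum_congr rfl fun j _ => by rw [pointwise_symGamma, ha]
      rw [h]
      refine Submodule.sum_mem _ fun j _ => Submodule.subset_span ⟨Pi.single j 1, a j U, ?_, ?_⟩
      · rw [ih]
        exact mem_sections.2 fun x => ha j x U ▸ hs j _
      · rw [isGamma_iff, Finset.sum_eq_single j]
        · simp
        · intro i _ hi
          rw [Pi.single_eq_of_ne hi, zero_smul]
        · simp

/-- Equivariance of `γ` moves `gl(m)` past `γ(ε^j)` at the cost of another `γ(ε^b)`. -/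
theorem fibR_mem_treeFibre (h₁ : IsReductive ρ₁) (h₂ : IsReductive ρ₂)
    (hI : ∀ i j, ∀ w ∈ I, fibR ρ₁ ρ₂ i j w ∈ I) (l : ℕ) :
    ∀ i j, ∀ w ∈ treeFibre ρ₁ I l, fibR ρ₁ ρ₂ i j w ∈ treeFibre ρ₁ I l := by
  induction l with
  | zero => exact hI
  | succ l ih =>
    rintro a b _ ⟨w, rfl⟩
    rw [gammaSum_apply, map_sum]
    refine Submodule.sum_mem _ fun j _ => ?_
    have h := LinearMap.congr_fun (fibGamma_equivariant h₁.bracket h₂.bracket a b j)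
      (w j : Fibre m V₁ V₂)
    rw [Module.End.mul_apply, LinearMap.sub_apply, Module.End.mul_apply] at h
    rw [h]
    refine Submodule.sub_mem _ (fibGamma_mem_treeFibre j l (ih a b _ (w j).2)) ?_
    split_ifs
    · exact fibGamma_mem_treeFibre b l (w j).2
    · exact Submodule.zero_mem _

theorem treeFibre_le_homogeneous {k : ℕ} (hI : I ≤ homogeneous m (V₁ →L[ℝ] V₂) k) (l : ℕ)
    (hl : l ≤ k) : treeFibre ρ₁ I l ≤ homogeneous m (V₁ →L[ℝ] V₂) (k - l) := by
  induction l with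
  | zero => exact hI
  | succ l ih =>
    rintro _ ⟨w, rfl⟩
    rw [gammaSum_apply]
    refine Submodule.sum_mem _ fun j _ => fibGamma_mem_homogeneous j ?_
    have := ih (by omega) (w j).2
    rwa [show k - l = k - (l + 1) + 1 by omega] at this

/-- After `k` steps the degree has dropped to 0, where `γ` vanishes. -/
theorem treeFibre_eq_bot {k : ℕ} (hI : I ≤ homogeneous m (V₁ →L[ℝ] V₂) k) :
    treeFibre ρ₁ I (k + 1) = ⊥ := by
  refine (Submodule.eq_bot_iff _).2 ?_
  rintro _ ⟨w, rfl⟩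
  rw [gammaSum_apply]
  refine Finset.sum_eq_zero fun j _ => fibGamma_eq_zero j ?_
  have := treeFibre_le_homogeneous hI k le_rfl (w j).2
  rwa [Nat.sub_self] at this

theorem finiteDimensional_treeFibre [FiniteDimensional ℝ I] (l : ℕ) :
    FiniteDimensional ℝ (treeFibre ρ₁ I l) := by
  induction l with
  | zero => assumption
  | succ l ih => exact Module.Finite.range (gammaSum ρ₁ (treeFibre ρ₁ I l))

/-- Derivatives in `x` preserve a level and `γ` raises it, so `N = 𝒞 - C` moves exactly one level
up. -/
theorem symN_mem_sections (l : ℕ) {T : Symbol m V₁ V₂} (hT : T ∈ sections (treeFibre ρ₁ I l)) :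
    symN ρ₁ T ∈ sections (treeFibre ρ₁ I (l + 1)) := by
  rw [symN, LinearMap.smul_apply, LinearMap.sum_apply]
  exact Submodule.smul_mem _ _ (Submodule.sum_mem _ fun j _ =>
    (pointwise_symGamma j).mem_sections (fun w hw => fibGamma_mem_treeFibre j l hw)
      (symP_mem_sections j hT))

/-- At each point the Lie derivative combines partial derivatives of `T`, which stay in `I`, with
the action of `gl(m)` on the value of `T`. -/
theorem lieSymbol_mem_sections (h : SL m) (hI : ∀ i j, ∀ w ∈ I, fibR ρ₁ ρ₂ i j w ∈ I)
    {T : Symbol m V₁ V₂} (hT : T ∈ sections I) : lieSymbol ρ₁ ρ₂ h T ∈ sections I := by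
  refine mem_sections.2 fun x => ?_
  have e : valueAt x (lieSymbol ρ₁ ρ₂ h T) =
      ∑ i, (projField h).1 x i • valueAt x (symP V₁ V₂ i T) -
        fibreAct ρ₁ ρ₂ (jacobianMatrix (projField h) x) (valueAt x T) := by
    refine Finsupp.ext fun α => ?_
    refine (valueAt_lieSymbolField ρ₁ ρ₂ _ T x α).trans ?_
    rw [Finsupp.sub_apply, Finsupp.finsetSum_apply]
    congr 1
    exact fderiv_eq_sum (T α) x _
  rw [e]
  exact Submodule.sub_mem _ (Submodule.sum_mem _ fun i _ => Submodule.smul_mem _ _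
    (mem_sections.1 (symP_mem_sections i hT) x)) (fibreAct_mem hI _ (mem_sections.1 hT x))

/-- Non-criticality speaks about symbols. An eigenvector of the fibre operator, regarded as a
constant symbol, would be an eigenvector of `C` in the tree. -/
theorem eq_zero_of_not_isCritical {d : Decomposition ρ₁ ρ₂} (hd : ¬ d.IsCritical) {k : ℕ}
    {s : Fin (d.n k)} {a : ℝ} (ha : d.IsAlpha k s a) (l : ℕ) {w : Fibre m V₁ V₂}
    (hw : w ∈ treeFibre ρ₁ (d.I k s) (l + 1)) (h : fibCasimir ρ₁ ρ₂ w = a • w) : w = 0 := by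
  by_contra h0
  let g : SmoothFn m ℝ := ⟨fun _ => 1, show ContDiff ℝ ∞ _ from contDiff_const⟩
  have hv : ∀ x, valueAt x (smulFibre w g) = w := fun x => by
    rw [valueAt_smulFibre]
    exact one_smul ℝ w
  refine hd ⟨k, s, a, ha, smulFibre w g, ?_, fun h' => h0 ?_, symbol_ext fun x => ?_⟩
  · refine Submodule.mem_iSup_of_mem l ?_
    rw [Decomposition.E, tree_sections]
    exact mem_sections.2 fun x => (hv x).symm ▸ hw
  · rw [← hv 0, h', map_zero]
  · rw [pointwise_casimirSymbol, map_smul, hv, h]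

end TreeFibre

/-! ### Projections onto independent subspaces. -/

section Projections

variable {W : Type*} [AddCommGroup W] [Module ℝ W]

/-- The map from the direct sum to `W` is injective; the components of a linear left inverse are the
projections. -/
theorem exists_projections {n : ℕ} {I : Fin n → Submodule ℝ W} (hI : iSupIndep I) :
    ∃ π : Fin n → Module.End ℝ W, (∀ s w, π s w ∈ I s) ∧
      (∀ s, ∀ w ∈ I s, ∀ t, π t w = if t = s then w else 0) ∧
      ∀ w ∈ ⨆ s, I s, ∑ s, π s w = w := by
  classical
  let f := DFinsupp.lsum (R := ℝ) ℕ fun s => (I s).subtype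
  have hf : Function.Injective f := hI.dfinsupp_lsum_injective
  obtain ⟨g, hg⟩ := f.exists_leftInverse_of_injective (LinearMap.ker_eq_bot.2 hf)
  have h1 : ∀ s, ∀ w ∈ I s, ∀ t, ((g w t : I t) : W) = if t = s then w else 0 := by
    intro s w hw t
    have e : f (DFinsupp.single s ⟨w, hw⟩) = w := DFinsupp.lsum_single _ _ _ _
    have e' : g w = DFinsupp.single s ⟨w, hw⟩ := by
      conv_lhs => rw [← e]
      exact LinearMap.congr_fun hg _
    rw [e', DFinsupp.single_apply]
    split_ifs with h h' h'
    · subst h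
      rfl
    · exact absurd h.symm h'
    · exact absurd h'.symm h
    · rfl
  refine ⟨fun s => (I s).subtype ∘ₗ DFinsupp.lapply s ∘ₗ g, fun s w => (g w s).2, h1,
    fun w hw => ?_⟩
  induction hw using Submodule.iSup_induction' with
  | mem s w hw =>
    refine (Finset.sum_congr rfl fun t _ => h1 s w hw t).trans ?_
    simp
  | zero => simp
  | add u v _ _ hu hv => simp only [map_add, Finset.sum_add_distrib, hu, hv]

end Projections

/-! ### Eigenvectors of a triangular perturbation -/

section Ladder

variable {S : Type*} [AddCommGroup S] [Module ℝ S]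

/-- Independent subspaces `T_0, …, T_k`, where `T_{k+1} = 0`, that are stable under `C` and moved
one step up by `N`; `C` has on `T_0` an eigenvalue `a` that it does not have on any `T_{l+1}`. -/
structure IsLadder (C N : Module.End ℝ S) (T : ℕ → Submodule ℝ S) (k : ℕ) (a : ℝ) : Prop where
  indep : ∀ s : ℕ → S, (∀ l, s l ∈ T l) → ∑ l ∈ Finset.range (k + 1), s l = 0 →
    ∀ l ≤ k, s l = 0
  top : T (k + 1) = ⊥
  mapC : ∀ l, ∀ t ∈ T l, C t ∈ T l
  mapN : ∀ l, ∀ t ∈ T l, N t ∈ T (l + 1)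
  bottom : ∀ t ∈ T 0, C t = a • t
  eq_zero : ∀ l, ∀ t ∈ T (l + 1), C t = a • t → t = 0

/-- The successive corrections `t_{l+1} = -R_l N t_l` of `t_0 = t`. -/
def ladderTerm (N : Module.End ℝ S) (R : ℕ → Module.End ℝ S) : ℕ → Module.End ℝ S
  | 0 => 1
  | l + 1 => -(R l * N * ladderTerm N R l)

/-- The sum `t_0 + ⋯ + t_k` of the successive corrections. -/
def ladderSum (N : Module.End ℝ S) (R : ℕ → Module.End ℝ S) (k : ℕ) : Module.End ℝ S :=
  ∑ l ∈ Finset.range (k + 1), ladderTerm N R l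

theorem ladderSum_apply (N : Module.End ℝ S) (R : ℕ → Module.End ℝ S) (k : ℕ) (t : S) :
    ladderSum N R k t = ∑ l ∈ Finset.range (k + 1), ladderTerm N R l t :=
  LinearMap.sum_apply _ _ _

namespace IsLadder

variable {C N : Module.End ℝ S} {T : ℕ → Submodule ℝ S} {k : ℕ} {a : ℝ}

/-- The component in `T_l` of `(C + N - a) (s_0 + ⋯ + s_k)`. -/
def residue (C N : Module.End ℝ S) (a : ℝ) (s : ℕ → S) : ℕ → S
  | 0 => C (s 0) - a • s 0
  | l + 1 => C (s (l + 1)) - a • s (l + 1) + N (s l)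

theorem residue_mem (h : IsLadder C N T k a) {s : ℕ → S} (hs : ∀ l, s l ∈ T l) (l : ℕ) :
    residue C N a s l ∈ T l := by
  have hC : ∀ l, C (s l) - a • s l ∈ T l := fun l =>
    Submodule.sub_mem _ (h.mapC l _ (hs l)) (Submodule.smul_mem _ _ (hs l))
  cases l with
  | zero => exact hC 0
  | succ l => exact Submodule.add_mem _ (hC _) (h.mapN l _ (hs l))

/-- Nothing leaves the range of summation, because `N (s k)` lies in `T (k + 1) = ⊥`. -/
theorem sum_residue (h : IsLadder C N T k a) {s : ℕ → S} (hs : ∀ l, s l ∈ T l) :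
    (C + N) (∑ l ∈ Finset.range (k + 1), s l) - a • ∑ l ∈ Finset.range (k + 1), s l =
      ∑ l ∈ Finset.range (k + 1), residue C N a s l := by
  have hN : N (s k) = 0 := (Submodule.mem_bot ℝ).1 (h.top ▸ h.mapN k _ (hs k))
  rw [Finset.sum_range_succ' (residue C N a s), LinearMap.add_apply, map_sum, map_sum,
    Finset.smul_sum, Finset.sum_range_succ (fun l => N (s l)), hN, add_zero,
    Finset.sum_range_succ' (fun l => C (s l)), Finset.sum_range_succ' (fun l => a • s l)]
  simp only [residue, Finset.sum_add_distrib, Finset.sum_sub_distrib]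
  abel

theorem ladderTerm_mem (_h : IsLadder C N T k a) {R : ℕ → Module.End ℝ S}
    (hR : ∀ l t, R l t ∈ T (l + 1)) {t : S} (ht : t ∈ T 0) (l : ℕ) : ladderTerm N R l t ∈ T l := by
  cases l with
  | zero => exact ht
  | succ l => exact Submodule.neg_mem _ (hR l _)

/-- The corrections are built so that `(C - a) t_{l+1} = -N t_l`, which is the vanishing of the
residue at level `l + 1`. -/
theorem eigen_ladderSum (h : IsLadder C N T k a) {R : ℕ → Module.End ℝ S}
    (hR : ∀ l t, R l t ∈ T (l + 1)) (hR' : ∀ l, ∀ t ∈ T (l + 1), C (R l t) - a • R l t = t)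
    {t : S} (ht : t ∈ T 0) : (C + N) (ladderSum N R k t) = a • ladderSum N R k t := by
  have hm := h.ladderTerm_mem hR ht
  rw [← sub_eq_zero, ladderSum_apply, h.sum_residue hm]
  refine Finset.sum_eq_zero fun l _ => ?_
  cases l with
  | zero => exact sub_eq_zero.2 (h.bottom t ht)
  | succ l =>
    have := hR' l _ (h.mapN l _ (hm l))
    change C (-(R l (N (ladderTerm N R l t)))) - a • -(R l (N (ladderTerm N R l t))) +
      N (ladderTerm N R l t) = 0
    rw [map_neg, smul_neg, sub_neg_eq_add, ← sub_eq_neg_add, ← neg_sub, this, neg_add_cancel]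

/-- The difference of two solutions has zero bottom component and zero residues. Going up, `N`
contributes nothing, and `C - a` is injective on the next level. -/
theorem eigen_unique (h : IsLadder C N T k a) {s s' : ℕ → S} (hs : ∀ l, s l ∈ T l)
    (hs' : ∀ l, s' l ∈ T l) (h0 : s 0 = s' 0)
    (he : (C + N) (∑ l ∈ Finset.range (k + 1), s l) = a • ∑ l ∈ Finset.range (k + 1), s l)
    (he' : (C + N) (∑ l ∈ Finset.range (k + 1), s' l) = a • ∑ l ∈ Finset.range (k + 1), s' l) :
    ∑ l ∈ Finset.range (k + 1), s l = ∑ l ∈ Finset.range (k + 1), s' l := by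
  let δ : ℕ → S := fun l => s l - s' l
  have hδ : ∀ l, δ l ∈ T l := fun l => Submodule.sub_mem _ (hs l) (hs' l)
  have hr := h.sum_residue hδ
  have hz : ∑ l ∈ Finset.range (k + 1), residue C N a δ l = 0 := by
    rw [← hr]
    simp only [δ, Finset.sum_sub_distrib]
    rw [map_sub, he, he', smul_sub, sub_self]
  have hz' := h.indep _ (h.residue_mem hδ) hz
  have : ∀ l ≤ k, δ l = 0 := by
    intro l
    induction l with
    | zero => exact fun _ => sub_eq_zero.2 h0
    | succ l ih =>
      intro hl
      have e := hz' (l + 1) hl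
      rw [residue, ih (by omega), map_zero, add_zero, sub_eq_zero] at e
      exact h.eq_zero l _ (hδ _) e
  rw [← sub_eq_zero, ← Finset.sum_sub_distrib]
  exact Finset.sum_eq_zero fun l hl => this l (Nat.lt_succ_iff.1 (Finset.mem_range.1 hl))

/-- `L + G` commutes with `C + N`, so it maps eigenvectors for `a` to eigenvectors for `a`. Only `L`
contributes to the bottom component, and uniqueness identifies the result. -/
theorem ladderSum_equivariant (h : IsLadder C N T k a) {R : ℕ → Module.End ℝ S}
    (hR : ∀ l t, R l t ∈ T (l + 1)) (hR' : ∀ l, ∀ t ∈ T (l + 1), C (R l t) - a • R l t = t)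
    {L G : Module.End ℝ S} (hL : ∀ l, ∀ t ∈ T l, L t ∈ T l) (hG : ∀ l, ∀ t ∈ T l, G t ∈ T (l + 1))
    (hc : ∀ t, (C + N) ((L + G) t) = (L + G) ((C + N) t)) {t : S} (ht : t ∈ T 0) :
    (L + G) (ladderSum N R k t) = ladderSum N R k (L t) := by
  have hm := h.ladderTerm_mem hR ht
  -- The components of the image, sorted by level; the term `G t_k` that would land on level `k + 1`
  -- is zero.
  let s : ℕ → S
    | 0 => L t
    | l + 1 => L (ladderTerm N R (l + 1) t) + G (ladderTerm N R l t)
  have hs : ∀ l, s l ∈ T l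
    | 0 => hL 0 _ ht
    | l + 1 => Submodule.add_mem _ (hL _ _ (hm _)) (hG l _ (hm l))
  have hG0 : G (ladderTerm N R k t) = 0 := (Submodule.mem_bot ℝ).1 (h.top ▸ hG k _ (hm k))
  have e : (L + G) (ladderSum N R k t) = ∑ l ∈ Finset.range (k + 1), s l := by
    rw [ladderSum_apply, Finset.sum_range_succ' s, LinearMap.add_apply, map_sum, map_sum,
      Finset.sum_range_succ (fun l => G (ladderTerm N R l t)), hG0, add_zero,
      Finset.sum_range_succ' (fun l => L (ladderTerm N R l t))]
    simp only [s, Finset.sum_add_distrib]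
    rw [add_right_comm]
    rfl
  have he := h.eigen_ladderSum hR hR' ht
  rw [e, ladderSum_apply]
  refine h.eigen_unique hs (h.ladderTerm_mem hR (hL 0 t ht)) rfl ?_ ?_
  · rw [← e, hc, he, map_smul]
  · rw [← ladderSum_apply]
    exact h.eigen_ladderSum hR hR' (hL 0 t ht)

end IsLadder

end Ladder

/-! ### Unitriangular maps of polynomials -/

section Unitriangular

variable {m : ℕ} {F : Type*} [AddCommGroup F] [Module ℝ F]

/-- The operator that is given by `Φ_k` on the homogeneous polynomials of degree `k`. -/
def byDegree (Φ : ℕ → Module.End ℝ (Poly m F)) : Module.End ℝ (Poly m F) :=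
  Finsupp.lsum ℝ fun α => Φ α.degree ∘ₗ Finsupp.lsingle α

theorem byDegree_single (Φ : ℕ → Module.End ℝ (Poly m F)) (α : Fin m →₀ ℕ) (c : F) :
    byDegree Φ (Finsupp.single α c) = Φ α.degree (Finsupp.single α c) :=
  Finsupp.lsum_single _ _ _ _

theorem byDegree_apply (Φ : ℕ → Module.End ℝ (Poly m F)) {k : ℕ} {P : Poly m F}
    (hP : P ∈ homogeneous m F k) : byDegree Φ P = Φ k P := by
  conv_lhs => rw [← P.sum_single, Finsupp.sum]
  conv_rhs => rw [← P.sum_single, Finsupp.sum]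
  rw [map_sum, map_sum]
  refine Finset.sum_congr rfl fun α hα => ?_
  have : α.degree = k := by
    by_contra h
    exact Finsupp.mem_support_iff.1 hα (mem_homogeneous_iff.1 hP α h)
  rw [byDegree_single, this]

/-- `Φ` is the identity up to terms of lower degree. -/
def IsUnitriangular (Φ : Module.End ℝ (Poly m F)) : Prop :=
  ∀ k, ∀ P ∈ homogeneous m F k, ∀ α : Fin m →₀ ℕ, k ≤ α.degree → Φ P α = P α

/-- The condition on homogeneous polynomials is extended to all polynomials of degree at most `k` by
summing over monomials. -/
theorem IsUnitriangular.apply_eq {Φ : Module.End ℝ (Poly m F)} (h : IsUnitriangular Φ) {k : ℕ}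
    {P : Poly m F} (hP : ∀ α, k < α.degree → P α = 0) {α : Fin m →₀ ℕ} (hα : k ≤ α.degree) :
    Φ P α = P α := by
  conv_lhs => rw [← P.sum_single, Finsupp.sum, map_sum, Finsupp.finsetSum_apply]
  conv_rhs => rw [← P.sum_single, Finsupp.sum, Finsupp.finsetSum_apply]
  refine Finset.sum_congr rfl fun β hβ => h β.degree _ ?_ α ?_
  · exact mem_homogeneous_iff.2 fun γ hγ => Finsupp.single_eq_of_ne fun e => hγ (by rw [e])
  · by_contra hlt
    exact Finsupp.mem_support_iff.1 hβ (hP β (by omega))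

/-- A coefficient of top degree is not changed by `Φ`, which gives injectivity; `P - Φ P` has
smaller degree than `P`, which gives surjectivity by induction. -/
theorem IsUnitriangular.bijective {Φ : Module.End ℝ (Poly m F)} (h : IsUnitriangular Φ) :
    Function.Bijective Φ := by
  constructor
  · refine (injective_iff_map_eq_zero Φ).2 fun P hP => ?_
    by_contra h0
    obtain ⟨α, hα, hmax⟩ := P.support.exists_max_image Finsupp.degree
      (Finsupp.support_nonempty_iff.2 h0)
    refine Finsupp.mem_support_iff.1 hα ?_
    rw [← h.apply_eq (fun β hβ => ?_) (le_refl α.degree), hP]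
    · rfl
    · by_contra hne
      exact absurd (hmax β (Finsupp.mem_support_iff.2 hne)) (by omega)
  · have key : ∀ k (P : Poly m F), (∀ α : Fin m →₀ ℕ, k ≤ α.degree → P α = 0) → ∃ Q, Φ Q = P := by
      intro k
      induction k with
      | zero =>
        intro P hP
        exact ⟨0, by rw [map_zero]; exact (Finsupp.ext fun α => hP α (Nat.zero_le _)).symm⟩
      | succ k ih =>
        intro P hP
        obtain ⟨Q, hQ⟩ := ih (P - Φ P) fun α hα => by
          rw [Finsupp.sub_apply, h.apply_eq (k := k) (fun β hβ => hP β hβ) hα, sub_self]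
        exact ⟨Q + P, by rw [map_add, hQ, sub_add_cancel]⟩
    intro P
    refine key (P.support.sup Finsupp.degree + 1) P fun α hα => ?_
    by_contra hne
    have := Finset.le_sup (f := Finsupp.degree) (Finsupp.mem_support_iff.2 hne)
    omega

/-- The summands have distinct degrees, so they share no monomial. -/
theorem eq_zero_of_sum_eq_zero {k : ℕ} {s : ℕ → Poly m F}
    (hs : ∀ l ≤ k, s l ∈ homogeneous m F (k - l))
    (h : ∑ l ∈ Finset.range (k + 1), s l = 0) (l : ℕ) (hl : l ≤ k) : s l = 0 := by
  refine Finsupp.ext fun α => ?_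
  by_cases hα : α.degree = k - l
  · have e := DFunLike.congr_fun h α
    rw [Finsupp.finsetSum_apply, Finset.sum_eq_single l] at e
    · exact e
    · intro j hj hjl
      have hj' : j ≤ k := Nat.lt_succ_iff.1 (Finset.mem_range.1 hj)
      exact mem_homogeneous_iff.1 (hs j hj') α (by omega)
    · exact fun h => absurd (Finset.mem_range.2 (Nat.lt_succ_iff.2 hl)) h
  · exact mem_homogeneous_iff.1 (hs l hl) α hα

end Unitriangular

/-! ### The quantization -/

section Quantization

variable {m : ℕ} {V₁ V₂ : Type*}
  [NormedAddCommGroup V₁] [NormedSpace ℝ V₁] [FiniteDimensional ℝ V₁]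
  [NormedAddCommGroup V₂] [NormedSpace ℝ V₂] [FiniteDimensional ℝ V₂]
  {ρ₁ : Representation ℝ (GL (Fin m) ℝ) V₁} {ρ₂ : Representation ℝ (GL (Fin m) ℝ) V₂}

namespace Decomposition

variable (d : Decomposition ρ₁ ρ₂)

theorem le_homogeneous (k : ℕ) (s : Fin (d.n k)) :
    d.I k s ≤ homogeneous m (V₁ →L[ℝ] V₂) k := d.sum_eq k ▸ le_iSup (d.I k) s

theorem finiteDimensional (k : ℕ) (s : Fin (d.n k)) : FiniteDimensional ℝ (d.I k s) :=
  have := finiteDimensional_homogeneous (m := m) (F := V₁ →L[ℝ] V₂) k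
  Submodule.finiteDimensional_of_le (d.le_homogeneous k s)

/-- The values of the elements of `tree^l(E_{k,s})`. -/
def level (k : ℕ) (s : Fin (d.n k)) (l : ℕ) : Submodule ℝ (Fibre m V₁ V₂) :=
  treeFibre ρ₁ (d.I k s) l

theorem tree_eq (k : ℕ) (s : Fin (d.n k)) (l : ℕ) :
    tree ρ₁ ρ₂ (d.E k s) l = sections (d.level k s l) := tree_sections _ _

theorem fibR_mem_level (hm : m ≠ 0) (h₁ : IsReductive ρ₁) (h₂ : IsReductive ρ₂) (k : ℕ)
    (s : Fin (d.n k)) (l : ℕ) (i j : Fin m) (w : Fibre m V₁ V₂) (hw : w ∈ d.level k s l) :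
    fibR ρ₁ ρ₂ i j w ∈ d.level k s l :=
  fibR_mem_treeFibre h₁ h₂ (fun i j _ hw => fibR_mem_of_isSLStable hm h₁ h₂ (d.le_homogeneous k s)
    (d.irreducible k s).1 i j hw) l i j w hw

theorem exists_isAlpha (hm : m ≠ 0) (h₁ : IsReductive ρ₁) (h₂ : IsReductive ρ₂) (k : ℕ)
    (s : Fin (d.n k)) : ∃ a : ℝ, d.IsAlpha k s a := by
  obtain ⟨a, ha⟩ := exists_fibCasimir_scalar hm h₁ h₂ (d.le_homogeneous k s) (d.irreducible k s)
  refine ⟨a, fun T hT => symbol_ext fun x => ?_⟩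
  rw [pointwise_casimirSymbol, ha _ (mem_sections.1 hT x), map_smul]

variable {d}

/-- Independence comes from the degrees `k - l`, termination from degree 0, and injectivity above
the bottom from non-criticality. -/
theorem isLadder (hd : ¬ d.IsCritical) (hm : m ≠ 0) (h₁ : IsReductive ρ₁) (h₂ : IsReductive ρ₂)
    {k : ℕ} {s : Fin (d.n k)} {a : ℝ} (ha : d.IsAlpha k s a) :
    IsLadder (casimirSymbol ρ₁ ρ₂) (symN ρ₁) (fun l => sections (d.level k s l)) k a where
  indep t ht h l hl := eq_zero_of_sum_eq_zero (fun l hl => sections_le_homogeneous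
    (treeFibre_le_homogeneous (d.le_homogeneous k s) l hl) (ht l)) h l hl
  top := by
    rw [level, treeFibre_eq_bot (d.le_homogeneous k s), sections_bot]
  mapC l _ ht := pointwise_casimirSymbol.mem_sections
    (fun _ hw => fibCasimir_mem (d.fibR_mem_level hm h₁ h₂ k s l) hw) ht
  mapN l _ ht := symN_mem_sections l ht
  bottom := ha
  eq_zero l t ht h := symbol_ext fun x => by
    rw [map_zero]
    refine eq_zero_of_not_isCritical hd ha l (mem_sections.1 ht x) ?_
    rw [← pointwise_casimirSymbol, h, map_smul]

theorem exists_resolvents (hd : ¬ d.IsCritical) (hm : m ≠ 0) (h₁ : IsReductive ρ₁)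
    (h₂ : IsReductive ρ₂) {k : ℕ} {s : Fin (d.n k)} {a : ℝ} (ha : d.IsAlpha k s a) :
    ∃ R : ℕ → Module.End ℝ (Symbol m V₁ V₂), (∀ l T, R l T ∈ sections (d.level k s (l + 1))) ∧
      ∀ l, ∀ T ∈ sections (d.level k s (l + 1)), casimirSymbol ρ₁ ρ₂ (R l T) - a • R l T = T := by
  have h := fun l => by
    have := d.finiteDimensional k s
    have : FiniteDimensional ℝ (d.level k s (l + 1)) := finiteDimensional_treeFibre (l + 1)
    exact exists_resolvent (d.level k s (l + 1)) (pointwise_casimirSymbol (ρ₁ := ρ₁) (ρ₂ := ρ₂))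
      (fun w hw => fibCasimir_mem (d.fibR_mem_level hm h₁ h₂ k s (l + 1)) hw) a
      fun w hw e => eq_zero_of_not_isCritical hd ha l hw e
  choose R hR hR' using h
  exact ⟨R, hR, hR'⟩

/-- The eigenvalue equation is pulled back from operators to symbols, where it reads `(C + N) U = a
U` on the ladder. -/
theorem isTreeEigenvector_iff {k : ℕ} {s : Fin (d.n k)} {a : ℝ} {T U : Symbol m V₁ V₂} :
    d.IsTreeEigenvector k s a T U ↔
      (∃ t : ℕ → Symbol m V₁ V₂, t 0 = T ∧ (∀ l, t l ∈ sections (d.level k s l)) ∧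
        U = ∑ l ∈ Finset.range (k + 1), t l) ∧
      (casimirSymbol ρ₁ ρ₂ + symN (V₂ := V₂) ρ₁) U = a • U := by
  simp only [IsTreeEigenvector, tree_eq]
  rw [corresponds_casimirOperator, ← map_smul, affineQuantization_injective.eq_iff]

variable (d) in
theorem exists_symbolProjections : ∃ π : (k : ℕ) → Fin (d.n k) → Module.End ℝ (Symbol m V₁ V₂),
    (∀ k s T, π k s T ∈ d.E k s) ∧
    (∀ k s, ∀ T ∈ d.E k s, ∀ t, π k t T = if t = s then T else 0) ∧
    ∀ k, ∀ T ∈ homogeneous m (SmoothFn m (V₁ →L[ℝ] V₂)) k, ∑ s, π k s T = T := by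
  choose p hp hp' hsum using fun k => exists_projections (d.independent k)
  choose π hπ _ using fun k s => exists_lift (p k s)
  refine ⟨π, fun k s T => mem_sections.2 fun x => hπ k s x T ▸ hp k s _,
    fun k s T hT t => symbol_ext fun x => ?_, fun k T hT => symbol_ext fun x => ?_⟩
  · rw [hπ, hp' k s _ (mem_sections.1 hT x) t]
    split_ifs
    · rfl
    · exact (map_zero _).symm
  · rw [map_sum]
    simp only [hπ _ _ x T]
    exact hsum k _ (d.sum_eq k ▸ mem_sections.1 (homogeneous_le_sections k hT) x)

end Decomposition

/-- A unitriangular map of symbols, followed by `Q_Aff`. -/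
def quantizationOf (Φ : Module.End ℝ (Symbol m V₁ V₂)) (hΦ : IsUnitriangular Φ) :
    Symbol m V₁ V₂ ≃ₗ[ℝ] DiffOp m V₁ V₂ :=
  (LinearEquiv.ofBijective Φ hΦ.bijective).trans
    (LinearEquiv.ofInjective affineQuantization affineQuantization_injective)

theorem quantizationOf_apply (Φ : Module.End ℝ (Symbol m V₁ V₂)) (hΦ : IsUnitriangular Φ)
    (T : Symbol m V₁ V₂) : (quantizationOf Φ hΦ T).1 = affineQuantization (Φ T) := rfl

/-- Unitriangularity says that `Φ T` has no terms of degree above `k` and that its part of degree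
`k` is `T`. -/
theorem isQuantization_quantizationOf (Φ : Module.End ℝ (Symbol m V₁ V₂))
    (hΦ : IsUnitriangular Φ) : IsQuantization (quantizationOf Φ hΦ) := by
  intro k T hT
  refine ⟨Φ T, fun α hα => ?_, rfl, Finsupp.ext fun α => ?_⟩
  · rw [hΦ k T hT α hα.le, mem_homogeneous_iff.1 hT α hα.ne']
  · by_cases h : α.degree = k
    · rw [Finsupp.filter_apply_pos (fun α : Fin m →₀ ℕ => α.degree = k) _ h, hΦ k T hT α h.ge]
    · rw [Finsupp.filter_apply_neg (fun α : Fin m →₀ ℕ => α.degree = k) _ h, mem_homogeneous_iff.1 hT α h]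

theorem exists_quantization (hm : m ≠ 0) (h₁ : IsReductive ρ₁) (h₂ : IsReductive ρ₂)
    (d : Decomposition ρ₁ ρ₂) (hd : ¬ d.IsCritical) :
    ∃ Q : Symbol m V₁ V₂ ≃ₗ[ℝ] DiffOp m V₁ V₂, IsQuantization Q ∧
      IsProjectivelyEquivariant ρ₁ ρ₂ Q ∧
      ∀ (k : ℕ) (s : Fin (d.n k)), ∃ a : ℝ, d.IsAlpha k s a ∧
        ∀ T ∈ d.E k s, ∃ U, d.IsTreeEigenvector k s a T U ∧
          (∀ U', d.IsTreeEigenvector k s a T U' → U' = U) ∧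
          (Q T).1 = affineQuantization U := by
  choose a ha using d.exists_isAlpha hm h₁ h₂
  have hlad := fun k s => Decomposition.isLadder hd hm h₁ h₂ (ha k s)
  choose R hR hR' using fun k s => Decomposition.exists_resolvents hd hm h₁ h₂ (ha k s)
  obtain ⟨π, hπ, hπ', hsum⟩ := d.exists_symbolProjections
  -- The map `T ↦ T̂` on `E_{k,s}`; `Φ` glues these maps along the projections, degree by degree.
  let hat : (k : ℕ) → Fin (d.n k) → Module.End ℝ (Symbol m V₁ V₂) := fun k s =>
    ladderSum (symN ρ₁) (R k s) k
  let Φ : Module.End ℝ (Symbol m V₁ V₂) := byDegree fun k => ∑ s, hat k s ∘ₗ π k s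
  have hΦ : ∀ k, ∀ T ∈ homogeneous m (SmoothFn m (V₁ →L[ℝ] V₂)) k,
      Φ T = ∑ s, hat k s (π k s T) := by
    intro k T hT
    refine (byDegree_apply _ hT).trans ?_
    rw [LinearMap.sum_apply]
    rfl
  have hE : ∀ k s, d.E k s ≤ homogeneous m (SmoothFn m (V₁ →L[ℝ] V₂)) k := fun k s =>
    sections_le_homogeneous (d.le_homogeneous k s)
  have hΦE : ∀ k s, ∀ T ∈ d.E k s, Φ T = hat k s T := by
    intro k s T hT
    rw [hΦ k T (hE k s hT), Finset.sum_eq_single s]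
    · rw [hπ' k s T hT, if_pos rfl]
    · intro t _ ht
      rw [hπ' k s T hT, if_neg ht, map_zero]
    · simp
  -- All corrections `T_{k-l}` with `l ≥ 1` have degree less than `k`.
  have hhat : ∀ k s, ∀ T ∈ d.E k s, ∀ α : Fin m →₀ ℕ, k ≤ α.degree → hat k s T α = T α := by
    intro k s T hT α hα
    have hmem := (hlad k s).ladderTerm_mem (hR k s) hT
    change ladderSum (symN ρ₁) (R k s) k T α = T α
    rw [ladderSum_apply, Finset.sum_range_succ', Finsupp.add_apply, Finsupp.finsetSum_apply,
      Finset.sum_eq_zero fun l hl => ?_, zero_add]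
    · rfl
    · have hl' : l + 1 ≤ k := Finset.mem_range.1 hl
      exact mem_homogeneous_iff.1 (sections_le_homogeneous (treeFibre_le_homogeneous
        (d.le_homogeneous k s) (l + 1) hl') (hmem (l + 1))) α (by omega)
  have htri : IsUnitriangular Φ := by
    intro k T hT α hα
    rw [hΦ k T hT]
    conv_rhs => rw [← hsum k T hT]
    rw [Finsupp.finsetSum_apply, Finsupp.finsetSum_apply]
    exact Finset.sum_congr rfl fun s _ => hhat k s _ (hπ k s T) α hα
  refine ⟨quantizationOf Φ htri, isQuantization_quantizationOf Φ htri, fun h T => ?_,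
    fun k s => ⟨a k s, ha k s, fun T hT => ⟨hat k s T, ?_, fun U' hU' => ?_, ?_⟩⟩⟩
  · let M : Module.End ℝ (Symbol m V₁ V₂) := ∑ j, h.1 (.inr ()) (.inl j) • symGamma V₂ ρ₁ j
    have hM : ∀ U, lieOperator ρ₁ ρ₂ h (affineQuantization U) =
        affineQuantization ((lieSymbol ρ₁ ρ₂ h + M) U) := corresponds_lieOperator ρ₁ ρ₂ h
    have hC : ∀ U, casimirOperator ρ₁ ρ₂ (affineQuantization U) = affineQuantization
        ((casimirSymbol ρ₁ ρ₂ + symN (V₂ := V₂) ρ₁) U) := corresponds_casimirOperator ρ₁ ρ₂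
    -- That `𝒞` commutes with `𝓛` is known for operators; injectivity of the standard ordering
    -- transfers it to symbols.
    have hcomm : ∀ U,
        (casimirSymbol ρ₁ ρ₂ + symN (V₂ := V₂) ρ₁) ((lieSymbol ρ₁ ρ₂ h + M) U) =
        (lieSymbol ρ₁ ρ₂ h + M) ((casimirSymbol ρ₁ ρ₂ + symN (V₂ := V₂) ρ₁) U) := fun U =>
      affineQuantization_injective (by
        rw [← hC, ← hM, ← hM, ← hC, casimirOperator_comm h₁.bracket h₂.bracket])
    have hL : ∀ k s l, ∀ U ∈ sections (d.level k s l),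
        lieSymbol ρ₁ ρ₂ h U ∈ sections (d.level k s l) := fun k s l U hU =>
      lieSymbol_mem_sections h (d.fibR_mem_level hm h₁ h₂ k s l) hU
    have hG : ∀ k s l, ∀ U ∈ sections (d.level k s l), M U ∈ sections (d.level k s (l + 1)) := by
      intro k s l U hU
      rw [LinearMap.sum_apply]
      exact Submodule.sum_mem _ fun j _ => Submodule.smul_mem _ _
        ((pointwise_symGamma j).mem_sections (fun w hw => fibGamma_mem_treeFibre j l hw) hU)
    -- The ladder lemma applies with `L` the Lie derivative and `G = γ(h)`, which raises the level.
    have key : ∀ k s, ∀ U ∈ d.E k s,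
        (lieSymbol ρ₁ ρ₂ h + M) (Φ U) = Φ (lieSymbol ρ₁ ρ₂ h U) := by
      intro k s U hU
      rw [hΦE k s U hU, hΦE k s _ (hL k s 0 U hU)]
      exact (hlad k s).ladderSum_equivariant (hR k s) (hR' k s) (hL k s) (hG k s) hcomm hU
    -- Every monomial is the sum of its projections to the `E_{k,s}`, so equivariance extends to all
    -- symbols by linearity.
    have key' : (lieSymbol ρ₁ ρ₂ h + M) (Φ T) = Φ (lieSymbol ρ₁ ρ₂ h T) := by
      induction T using Finsupp.induction_linear with
      | zero => simp only [map_zero]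
      | add T U hT hU => rw [map_add, map_add, hT, hU, map_add, map_add]
      | single α f =>
        have hα : (Finsupp.single α f : Symbol m V₁ V₂) ∈
            homogeneous m (SmoothFn m (V₁ →L[ℝ] V₂)) α.degree :=
          mem_homogeneous_iff.2 fun γ hγ => Finsupp.single_eq_of_ne fun e => hγ (by rw [e])
        rw [← hsum _ _ hα]
        simp only [map_sum]
        exact Finset.sum_congr rfl fun s _ => key _ s _ (hπ _ s _)
    rw [quantizationOf_apply, quantizationOf_apply, hM, key']
  · rw [Decomposition.isTreeEigenvector_iff]
    exact ⟨⟨_, rfl, (hlad k s).ladderTerm_mem (hR k s) hT, ladderSum_apply _ _ _ _⟩,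
      (hlad k s).eigen_ladderSum (hR k s) (hR' k s) hT⟩
  · rw [Decomposition.isTreeEigenvector_iff] at hU'
    obtain ⟨⟨t, ht0, ht, rfl⟩, he⟩ := hU'
    have he' := (hlad k s).eigen_ladderSum (hR k s) (hR' k s) hT
    change _ = ladderSum (symN ρ₁) (R k s) k T
    rw [ladderSum_apply] at he' ⊢
    exact (hlad k s).eigen_unique ht ((hlad k s).ladderTerm_mem (hR k s) hT) ht0 he he'
  · rw [quantizationOf_apply, hΦE k s T hT]

end Quantization

end

end ProjQuant

theorem mainTheorem2 (m : ℕ) (hm : 2 ≤ m) (D₁ D₂ : YoungDiagram)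
    (hD₁ : D₁.colLen 0 < m) (hD₂ : D₂.colLen 0 < m) (w₁ w₂ : ℝ) (z₁ z₂ : ℤ) :
    Nonempty (ProjQuant.Decomposition (ProjQuant.tensorRep m D₁ w₁ z₁)
      (ProjQuant.tensorRep m D₂ w₂ z₂)) ∧
    ∀ d : ProjQuant.Decomposition (ProjQuant.tensorRep m D₁ w₁ z₁)
      (ProjQuant.tensorRep m D₂ w₂ z₂), ¬ d.IsCritical →
      ∃ Q : ProjQuant.Symbol m (ProjQuant.schurModule m D₁) (ProjQuant.schurModule m D₂) ≃ₗ[ℝ]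
          ProjQuant.DiffOp m (ProjQuant.schurModule m D₁) (ProjQuant.schurModule m D₂),
        ProjQuant.IsQuantization Q ∧
        ProjQuant.IsProjectivelyEquivariant (ProjQuant.tensorRep m D₁ w₁ z₁)
          (ProjQuant.tensorRep m D₂ w₂ z₂) Q ∧
        ∀ (k : ℕ) (s : Fin (d.n k)), ∃ a : ℝ, d.IsAlpha k s a ∧
          ∀ T ∈ d.E k s, ∃ U, d.IsTreeEigenvector k s a T U ∧
            (∀ U', d.IsTreeEigenvector k s a T U' → U' = U) ∧
            (Q T).1 = ProjQuant.affineQuantization U :=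
  have hm' : m ≠ 0 := by omega
  ⟨ProjQuant.nonempty_decomposition (ProjQuant.isReductive_tensorRep D₁ w₁ z₁)
      (ProjQuant.isReductive_tensorRep D₂ w₂ z₂),
    ProjQuant.exists_quantization hm' (ProjQuant.isReductive_tensorRep D₁ w₁ z₁)
      (ProjQuant.isReductive_tensorRep D₂ w₂ z₂)⟩
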